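/- For $\Re s>1$ let $$\mathcal Z_1(s)=\int_1^\infty \bigl|\zeta(\tfrac12+ix)\bigr|^{2}x^{-s}\,dx ,$$ where $\zeta$ is the Riemann zeta-function. This integral converges absolutely for $\Re s>1$, and $\mathcal Z_1(s)$ continues meromorphically to all of $\mathbb C$. The continuation has a double pole at $s=1$, at most simple poles at $s=-1,-3,-5,\ldots$, and no other poles. The principal part of its Laurent expansion at $s=1$ is $$\frac1{(s-1)^2}+\frac{2\gamma-\log(2\pi)}{s-1},$$ where $\gamma=-\Gamma'(1)=0.577215\ldots$ is Euler's constant. -/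

import Mathlib

/-- The integrand `|ζ(1/2 + ix)|^{2k} x^{-s}` of the modified Mellin transform. -/
noncomputable def zetaMellinIntegrand (k : ℕ) (s : ℂ) (x : ℝ) : ℂ :=
  ((‖riemannZeta (1 / 2 + Complex.I * (x : ℂ))‖ ^ (2 * k) : ℝ) : ℂ) * (x : ℂ) ^ (-s)

/-- The modified Mellin transform `𝒵_k(s) = ∫_1^∞ |ζ(1/2 + ix)|^{2k} x^{-s} dx`,
meaningful where the integral converges absolutely. -/
noncomputable def modifiedMellinZeta (k : ℕ) (s : ℂ) : ℂ :=
  ∫ x in Set.Ioi (1 : ℝ), zetaMellinIntegrand k s x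

/-! Let L(p) be the Laplace transform of |ζ(1/2 + it)|² over t > 1 (`truncatedLaplace`). By Fubini
its Mellin transform is Γ(s) 𝒵₁(s) (`mellin_truncatedLaplace`), so the poles are read off the
expansion of L at 0+: a term (c_k - e_k log p) p^(k-1) contributes c_k / (s - 1 + k) + e_k / (s - 1
+ k)². Since 1/Γ vanishes at 0, -1, -2, …, dividing by Γ lowers the order there by one, and a pole
at -n survives only through e_(n+1). The e_k are the Taylor coefficients of z / (2 sin (z/2)), an
even function, so only -1, -3, -5, … remain. At s = 1 the values e_0 = 1, c_0 = γ - log 2π and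
1/Γ(s) = 1 + γ(s - 1) + … give the principal part.

The expansion of L comes from the Lambert series φ(z) = ∑ 1 / (e^(nz) - 1), whose Mellin transform
is Γ ζ². Once its singular part (γ - log z)/z is subtracted, the Mellin transform of the remainder
exists for 0 < Re s < 1 and is still Γ ζ² (`mellin_lambertRemainder`). Turning the ray of
integration towards the imaginary axis multiplies it by a^(-s) (`mellin_rotate`). Mellin inversion
at the point 2π, combined with the functional equation, expresses the integral over ℝ of |ζ(1/2 +
iy)|² e^(-py) / (1 + i e^(-πy)) through that remainder at 2πi e^(-ip) (`integral_zetaNormSq`). The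
weight 1 / (1 + i e^(-πy)) differs from the indicator of y > 1 by O(e^(-π|y|)), which changes the
integral only by a function analytic at p = 0.

The period 2πi of φ moves the argument to 2πi (e^(-ip) - 1), close to 0. There z φ(z) = -log (1 -
e^(-z)) + z ∑ K(nz) with K(z) = 1/(e^z - 1) - e^(-z)/z, and the Riemann sum has an Euler–Maclaurin
expansion in sectors (`hasExpansion_riemannSum`). The logarithm yields the e_k log p terms, and ∫ K
= γ over the positive reals yields Euler's constant. -/

open Complex Filter Topology Asymptotics MeasureTheory

/-! ### Differentiation under the integral sign -/

/-- An integral of holomorphic functions which are dominated near `z₀` can be differentiated under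
the integral sign at `z₀`. -/
theorem hasDerivAt_integral_of_dominated {X : Type*} [MeasurableSpace X] {μ : Measure X}
    {F : ℂ → X → ℂ} {z₀ : ℂ} {r : ℝ} (hr : 0 < r) {b : X → ℝ}
    (hmeas : ∀ z ∈ Metric.ball z₀ r, AEStronglyMeasurable (F z) μ)
    (hdiff : ∀ᵐ x ∂μ, DifferentiableOn ℂ (fun z => F z x) (Metric.ball z₀ r))
    (hb : ∀ᵐ x ∂μ, ∀ z ∈ Metric.ball z₀ r, ‖F z x‖ ≤ b x) (hbi : Integrable b μ) :
    Integrable (fun x => deriv (fun z => F z x) z₀) μ ∧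
      HasDerivAt (fun z => ∫ x, F z x ∂μ) (∫ x, deriv (fun z => F z x) z₀ ∂μ) z₀ := by
  have hr2 : 0 < r / 2 := by positivity
  have hz₀ : z₀ ∈ Metric.ball z₀ r := Metric.mem_ball_self hr
  have hmeas' : AEStronglyMeasurable (fun x => deriv (fun z => F z x) z₀) μ := by
    -- The derivative at `z₀` is a limit of difference quotients along a sequence inside the ball,
    -- which makes it measurable in `x`.
    have hu : Tendsto (fun n : ℕ => z₀ + ((r / 2 / (n + 1) : ℝ) : ℂ)) atTop (𝓝[≠] z₀) := by
      rw [tendsto_nhdsWithin_iff]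
      constructor
      · have h1 : Tendsto (fun n : ℕ => (r / 2 / (n + 1) : ℝ)) atTop (𝓝 0) :=
          tendsto_const_nhds.div_atTop
            (tendsto_atTop_add_const_right _ _ tendsto_natCast_atTop_atTop)
        have h2 := (continuous_ofReal.tendsto 0).comp h1
        simpa using h2.const_add z₀
      · refine Eventually.of_forall fun n => ?_
        have : ((r / 2 / (n + 1) : ℝ) : ℂ) ≠ 0 := ofReal_ne_zero.2 (by positivity)
        simpa only [Set.mem_compl_iff, Set.mem_singleton_iff, add_eq_left] using this
    refine aestronglyMeasurable_of_tendsto_ae atTop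
      (f := fun (n : ℕ) x => slope (fun z => F z x) z₀ (z₀ + ((r / 2 / (n + 1) : ℝ) : ℂ))) ?_ ?_
    · intro n
      have hn : z₀ + ((r / 2 / (n + 1) : ℝ) : ℂ) ∈ Metric.ball z₀ r := by
        rw [Metric.mem_ball, dist_eq_norm, add_sub_cancel_left, norm_real,
          Real.norm_of_nonneg (by positivity)]
        refine (div_le_self hr2.le ?_).trans_lt (half_lt_self hr)
        have : (0 : ℝ) ≤ n := n.cast_nonneg
        linarith
      simp only [slope_def_field]
      simp_rw [div_eq_mul_inv]
      exact ((hmeas _ hn).sub (hmeas _ hz₀)).mul_const _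
    · filter_upwards [hdiff] with x hx
      have := (hx.differentiableAt (Metric.ball_mem_nhds _ hr)).hasDerivAt
      exact (hasDerivAt_iff_tendsto_slope.1 this).comp hu
  refine hasDerivAt_integral_of_dominated_loc_of_deriv_le
    (F' := fun z x => deriv (fun z => F z x) z) (bound := fun x => b x / (r / 2))
    (Metric.ball_mem_nhds z₀ hr2) ?_ ?_ hmeas' ?_ (hbi.div_const _) ?_
  · filter_upwards [Metric.ball_mem_nhds z₀ hr] with z hz using hmeas z hz
  · refine hbi.mono' (hmeas _ hz₀) ?_
    filter_upwards [hb] with x hx using hx _ hz₀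
  · filter_upwards [hdiff, hb] with x hx hbx z hz
    -- Cauchy's estimate on a circle of radius `r / 2`, which stays inside the ball when `z` is
    -- within `r / 2` of `z₀`.
    have h1 : ‖deriv (fun z => F z x) z‖ ≤ b x / (r / 2) := by
      have hsub : Metric.closedBall z (r / 2) ⊆ Metric.ball z₀ r := by
        intro w hw
        rw [Metric.mem_closedBall] at hw
        rw [Metric.mem_ball] at hz ⊢
        linarith [dist_triangle w z z₀]
      refine norm_deriv_le_of_forall_mem_sphere_norm_le hr2 ?_ ?_
      · refine DifferentiableOn.diffContOnCl ?_
        exact hx.mono ((closure_mono Metric.ball_subset_closedBall).trans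
          (by rwa [Metric.isClosed_closedBall.closure_eq]))
      · intro w hw
        exact hbx w (hsub (Metric.sphere_subset_closedBall hw))
    exact h1
  · filter_upwards [hdiff] with x hx z hz
    refine (hx.differentiableAt (Metric.isOpen_ball.mem_nhds ?_)).hasDerivAt
    exact Metric.ball_subset_ball (by linarith) hz

/-! ### Finite asymptotic expansions -/

/-- `f` agrees with a polynomial in `x` up to `O(x ^ m)` along the filter `l`. -/
def HasExpansion {α : Type*} (l : Filter α) (x f : α → ℂ) (m : ℕ) : Prop :=
  ∃ P : Polynomial ℂ, (fun a => f a - P.eval (x a)) =O[l] fun a => x a ^ m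

namespace HasExpansion

variable {α : Type*} {l : Filter α} {x f g : α → ℂ} {m : ℕ}

theorem const (c : ℂ) : HasExpansion l x (fun _ => c) m :=
  ⟨Polynomial.C c, by simpa using isBigO_zero _ _⟩

theorem of_isBigO (h : f =O[l] fun a => x a ^ m) : HasExpansion l x f m :=
  ⟨0, by simpa using h⟩

theorem add (hf : HasExpansion l x f m) (hg : HasExpansion l x g m) :
    HasExpansion l x (fun a => f a + g a) m := by
  obtain ⟨P, hP⟩ := hf
  obtain ⟨Q, hQ⟩ := hg
  refine ⟨P + Q, (hP.add hQ).congr_left fun a => ?_⟩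
  simp only [Polynomial.eval_add]
  ring

theorem sum {ι : Type*} {s : Finset ι} {F : ι → α → ℂ}
    (h : ∀ i ∈ s, HasExpansion l x (F i) m) :
    HasExpansion l x (fun a => ∑ i ∈ s, F i a) m := by
  classical
  induction s using Finset.induction_on with
  | empty => simpa using const 0
  | insert i s hi ih =>
    simp only [Finset.sum_insert hi]
    exact (h i (by simp)).add (ih fun j hj => h j (by simp [hj]))

theorem congr' (hf : HasExpansion l x f m) (h : f =ᶠ[l] g) : HasExpansion l x g m := by
  obtain ⟨P, hP⟩ := hf
  refine ⟨P, hP.congr' ?_ EventuallyEq.rfl⟩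
  filter_upwards [h] with a ha
  rw [ha]

theorem mono (hx : Tendsto x l (𝓝 0)) {n : ℕ} (hnm : n ≤ m) (hf : HasExpansion l x f m) :
    HasExpansion l x f n := by
  obtain ⟨P, hP⟩ := hf
  refine ⟨P, hP.trans ?_⟩
  have h1 : (fun a => x a ^ (m - n)) =O[l] fun _ => (1 : ℂ) := (hx.pow _).isBigO_one ℂ
  have h2 := h1.mul (isBigO_refl (fun a => x a ^ n) l)
  refine h2.congr (fun a => ?_) (fun a => by simp)
  rw [← pow_add]
  congr 1
  omega

theorem isBigO_one (hx : Tendsto x l (𝓝 0)) (hf : HasExpansion l x f m) :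
    f =O[l] fun _ => (1 : ℂ) := by
  obtain ⟨P, hP⟩ := hf
  have h1 : (fun a => P.eval (x a)) =O[l] fun _ => (1 : ℂ) :=
    ((P.continuous.tendsto 0).comp hx).isBigO_one ℂ
  have h2 : (fun a => x a ^ m) =O[l] fun _ => (1 : ℂ) := (hx.pow m).isBigO_one ℂ
  refine ((hP.trans h2).add h1).congr_left fun a => by ring

theorem mul (hx : Tendsto x l (𝓝 0)) (hf : HasExpansion l x f m) (hg : HasExpansion l x g m) :
    HasExpansion l x (fun a => f a * g a) m := by
  have hf1 := hf.isBigO_one hx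
  obtain ⟨P, hP⟩ := hf
  obtain ⟨Q, hQ⟩ := hg
  have h1 : (fun a => Q.eval (x a)) =O[l] fun _ => (1 : ℂ) :=
    ((Q.continuous.tendsto 0).comp hx).isBigO_one ℂ
  have h2 := hf1.mul hQ
  have h3 := hP.mul h1
  simp only [one_mul, mul_one] at h2 h3
  refine ⟨P * Q, (h2.add h3).congr_left fun a => ?_⟩
  simp only [Polynomial.eval_mul]
  ring

theorem pow_mul (j : ℕ) (hf : HasExpansion l x f m) :
    HasExpansion l x (fun a => x a ^ j * f a) (m + j) := by
  obtain ⟨P, hP⟩ := hf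
  refine ⟨Polynomial.X ^ j * P,
    ((isBigO_refl (fun a => x a ^ j) l).mul hP).congr (fun a => ?_) (fun a => ?_)⟩
  · simp only [Polynomial.eval_mul, Polynomial.eval_pow, Polynomial.eval_X]
    ring
  · ring

/-- Induction through f(z) = f(0) + z · `dslope f 0 z`, where the slope is again analytic. -/
theorem _root_.AnalyticAt.exists_polynomial_isBigO {f : ℂ → ℂ} (hf : AnalyticAt ℂ f 0) (m : ℕ) :
    ∃ P : Polynomial ℂ, (fun z => f z - P.eval z) =O[𝓝 0] fun z => z ^ m := by
  induction m generalizing f with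
  | zero =>
    refine ⟨0, ?_⟩
    simpa using hf.continuousAt.isBigO_one ℂ
  | succ m ih =>
    have hd : AnalyticAt ℂ (dslope f 0) 0 := by
      obtain ⟨p, hp⟩ := hf
      exact hp.has_fpower_series_dslope_fslope.analyticAt
    obtain ⟨P, hP⟩ := ih hd
    refine ⟨Polynomial.C (f 0) + Polynomial.X * P,
      ((isBigO_refl (fun z : ℂ => z) (𝓝 0)).mul hP).congr (fun z => ?_) (fun z => ?_)⟩
    · have := sub_smul_dslope f 0 z
      simp only [sub_zero, smul_eq_mul] at this
      simp only [Polynomial.eval_add, Polynomial.eval_C, Polynomial.eval_mul, Polynomial.eval_X,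
        mul_sub, this]
      ring
    · ring

theorem of_analyticAt (hx : Tendsto x l (𝓝 0)) {F : ℂ → ℂ} (hF : AnalyticAt ℂ F 0) :
    HasExpansion l x (fun a => F (x a)) m := by
  obtain ⟨P, hP⟩ := hF.exists_polynomial_isBigO m
  exact ⟨P, hP.comp_tendsto hx⟩

/-- Expansions in powers of an analytic function of `x` are expansions in powers of `x`. -/
theorem comp_analyticAt {β : Type*} {l' : Filter β} {y : β → ℂ} (hy : Tendsto y l' (𝓝 0))
    {F : ℂ → ℂ} (hF : AnalyticAt ℂ F 0) (hF0 : F 0 = 0) {f : β → ℂ}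
    (hf : HasExpansion l' (F ∘ y) f m) : HasExpansion l' y f m := by
  obtain ⟨P, hP⟩ := hf
  have h1 : AnalyticAt ℂ (fun z => P.eval (F z)) 0 := by
    have h2 : AnalyticAt ℂ (fun z => P.eval z) (F 0) :=
      P.differentiable.analyticAt _
    exact h2.comp hF
  have h3 : F =O[𝓝 0] fun z => z := by
    simpa [hF0] using hF.differentiableAt.isBigO_sub
  have h4 : HasExpansion l' y (fun b => f b - P.eval (F (y b))) m :=
    of_isBigO (hP.trans ((h3.comp_tendsto hy).pow m))
  exact (h4.add (of_analyticAt hy h1)).congr' (Eventually.of_forall fun b => by simp)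

end HasExpansion

/-! ### Sectors and Taylor's formula along segments -/

/-- The closed sector `|Im z| ≤ M Re z`. -/
def closedSector (M : ℝ) : Set ℂ := {z | |z.im| ≤ M * z.re}

theorem mul_mem_closedSector {M : ℝ} {z : ℂ} (hz : z ∈ closedSector M) {a : ℝ} (ha : 0 ≤ a) :
    (a : ℂ) * z ∈ closedSector M := by
  simp only [closedSector, Set.mem_ofPred_eq, mul_im, ofReal_re, ofReal_im, mul_re, zero_mul,
    add_zero, sub_zero] at *
  rw [abs_mul, abs_of_nonneg ha]
  calc a * |z.im| ≤ a * (M * z.re) := by gcongr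
    _ = _ := by ring

section

variable {M : ℝ} {z : ℂ}

theorem re_nonneg_of_mem_closedSector (hM : 0 < M) (hz : z ∈ closedSector M) : 0 ≤ z.re := by
  have : 0 ≤ M * z.re := (abs_nonneg _).trans hz
  exact nonneg_of_mul_nonneg_right this hM

theorem norm_le_of_mem_closedSector (hM : 0 < M) (hz : z ∈ closedSector M) :
    ‖z‖ ≤ (1 + M) * z.re := by
  have h0 := re_nonneg_of_mem_closedSector hM hz
  have h1 : |z.im| ≤ M * z.re := hz
  calc ‖z‖ ≤ |z.re| + |z.im| := norm_le_abs_re_add_abs_im z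
    _ ≤ _ := by rw [abs_of_nonneg h0]; linarith

theorem re_pos_of_mem_closedSector (hM : 0 < M) (hz : z ∈ closedSector M) (hz0 : z ≠ 0) :
    0 < z.re := by
  have h1 := norm_le_of_mem_closedSector hM hz
  have h2 : 0 < ‖z‖ := norm_pos_iff.2 hz0
  have h3 : 0 < (1 + M) * z.re := h2.trans_le h1
  exact pos_of_mul_pos_right h3 (by linarith)

end

/-- Taylor's formula along a segment for a sequence of successive derivatives. -/
theorem norm_sub_taylor_le {D : ℕ → ℂ → ℂ} {K : Set ℂ}
    (hD : ∀ k, ∀ z ∈ K, HasDerivAt (D k) (D (k + 1) z) z) (m : ℕ) :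
    ∀ (k : ℕ) (w h : ℂ) (B : ℝ), segment ℝ w (w + h) ⊆ K →
      (∀ u ∈ segment ℝ w (w + h), ‖D (k + m) u‖ ≤ B) →
      ‖D k (w + h) - ∑ j ∈ Finset.range m, D (k + j) w * (h ^ j / (j.factorial : ℂ))‖
        ≤ B * ‖h‖ ^ m := by
  induction m with
  | zero =>
    intro k w h B _ hB
    simpa using hB _ (right_mem_segment ℝ _ _)
  | succ m ih =>
    intro k w h B hK hB
    have hB0 : 0 ≤ B := (norm_nonneg _).trans (hB _ (left_mem_segment ℝ _ _))
    set f : ℂ → ℂ := fun u => D k u -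
      ∑ j ∈ Finset.range (m + 1), D (k + j) w * ((u - w) ^ j / (j.factorial : ℂ)) with hf
    set f' : ℂ → ℂ := fun u => D (k + 1) u -
      ∑ j ∈ Finset.range m, D (k + 1 + j) w * ((u - w) ^ j / (j.factorial : ℂ)) with hf'
    have hderiv : ∀ u ∈ segment ℝ w (w + h), HasDerivAt f (f' u) u := by
      intro u hu
      have h1 : HasDerivAt (fun u : ℂ => ∑ j ∈ Finset.range (m + 1),
          D (k + j) w * ((u - w) ^ j / (j.factorial : ℂ)))
          (∑ j ∈ Finset.range m, D (k + 1 + j) w * ((u - w) ^ j / (j.factorial : ℂ))) u := by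
        have h2 := HasDerivAt.fun_sum (u := Finset.range (m + 1)) (x := u)
          (A := fun j (u : ℂ) => D (k + j) w * ((u - w) ^ j / (j.factorial : ℂ)))
          (A' := fun j => D (k + j) w * ((j * (u - w) ^ (j - 1)) / (j.factorial : ℂ)))
          (fun j _ => by
            simpa using ((((hasDerivAt_id u).sub_const w).pow j).div_const _).const_mul (D (k + j) w))
        refine h2.congr_deriv ?_
        rw [Finset.sum_range_succ']
        simp only [Nat.cast_zero, zero_mul, zero_div, mul_zero, add_zero]
        refine Finset.sum_congr rfl fun j _ => ?_
        have hj : ((j : ℂ) + 1) ≠ 0 := Nat.cast_add_one_ne_zero j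
        have hj' : (j.factorial : ℂ) ≠ 0 := Nat.cast_ne_zero.2 j.factorial_ne_zero
        rw [Nat.factorial_succ, show k + (j + 1) = k + 1 + j by ring]
        simp only [Nat.add_sub_cancel]
        push_cast
        field_simp
      exact (hD k u (hK hu)).sub h1
    -- The derivative of the Taylor remainder of `D k` is the remainder of `D (k + 1)` of one order
    -- less, so the induction hypothesis bounds it and the mean value inequality integrates the
    -- bound.
    have hbound : ∀ u ∈ segment ℝ w (w + h), ‖f' u‖ ≤ B * ‖h‖ ^ m := by
      intro u hu
      have hsub : segment ℝ w (w + (u - w)) ⊆ segment ℝ w (w + h) := by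
        rw [add_sub_cancel]
        exact (convex_segment _ _).segment_subset (left_mem_segment ℝ _ _) hu
      have h1 := ih (k + 1) w (u - w) B (hsub.trans hK) (fun v hv => by
        have := hB v (hsub hv)
        rwa [show k + 1 + m = k + (m + 1) by ring])
      rw [add_sub_cancel] at h1
      refine h1.trans ?_
      have h2 : ‖u - w‖ ≤ ‖h‖ := by
        have := norm_sub_le_of_mem_segment hu
        simpa using this
      gcongr
    have h3 := (convex_segment w (w + h)).norm_image_sub_le_of_norm_hasDerivWithin_le
      (fun u hu => (hderiv u hu).hasDerivWithinAt) hbound (left_mem_segment ℝ _ _)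
      (right_mem_segment ℝ _ _)
    have h4 : f w = 0 := by
      simp only [hf]
      rw [Finset.sum_range_succ']
      simp
    rw [h4, sub_zero, add_sub_cancel_left] at h3
    simp only [hf, add_sub_cancel_left] at h3
    calc _ ≤ _ := h3
      _ = _ := by ring

/-! ### Euler–Maclaurin expansion of Riemann sums in a sector -/

/-- A sequence of successive derivatives on a sector, all decaying exponentially. -/
structure IsDerivTower (M : ℝ) (D : ℕ → ℂ → ℂ) : Prop where
  hasDerivAt : ∀ k, ∀ z ∈ closedSector M, HasDerivAt (D k) (D (k + 1) z) z
  bound : ∀ k, ∃ C : ℝ, ∀ z ∈ closedSector M, ‖D k z‖ ≤ C * Real.exp (-(z.re / 2))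

namespace IsDerivTower

variable {M : ℝ} {D : ℕ → ℂ → ℂ}

theorem exists_pos_bound (h : IsDerivTower M D) (k : ℕ) :
    ∃ C : ℝ, 0 < C ∧ ∀ z ∈ closedSector M, ‖D k z‖ ≤ C * Real.exp (-(z.re / 2)) := by
  obtain ⟨C, hC⟩ := h.bound k
  refine ⟨max C 1, by positivity, fun z hz => (hC z hz).trans ?_⟩
  gcongr
  exact le_max_left _ _

theorem _root_.hasSum_exp_neg_nat_mul {a : ℝ} (ha : 0 < a) :
    HasSum (fun n : ℕ => Real.exp (-(n * a))) (1 - Real.exp (-a))⁻¹ := by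
  have h1 := hasSum_geometric_of_lt_one (Real.exp_pos (-a)).le
    (Real.exp_lt_one_iff.2 (by linarith : -a < 0))
  refine h1.congr_fun ?_
  intro n
  rw [← Real.exp_nat_mul]
  ring_nf

theorem _root_.inv_one_sub_exp_neg_le {a : ℝ} (ha : 0 < a) (ha1 : a ≤ 1) :
    (1 - Real.exp (-a))⁻¹ ≤ 2 / a := by
  have h1 : Real.exp (-a) ≤ 1 - a / 2 := by
    have h2 : Real.exp (-a) = (Real.exp a)⁻¹ := Real.exp_neg a
    have h3 : a + 1 ≤ Real.exp a := Real.add_one_le_exp a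
    rw [h2, inv_le_comm₀ (Real.exp_pos _) (by linarith)]
    refine le_trans ?_ h3
    rw [inv_le_comm₀ (by linarith) (by linarith), inv_le_iff_one_le_mul₀ (by linarith)]
    nlinarith
  rw [← inv_div]
  exact inv_anti₀ (by positivity) (by linarith)

theorem norm_apply_nat_mul_le (k : ℕ) {C : ℝ}
    (hC : ∀ z ∈ closedSector M, ‖D k z‖ ≤ C * Real.exp (-(z.re / 2))) {z : ℂ}
    (hz : z ∈ closedSector M) (n : ℕ) :
    ‖D k (n * z)‖ ≤ C * Real.exp (-(n * (z.re / 2))) := by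
  have h1 := hC _ (mul_mem_closedSector hz (Nat.cast_nonneg n))
  simp only [ofReal_natCast, natCast_re, natCast_im, mul_re, zero_mul, sub_zero] at h1
  convert h1 using 3
  ring

theorem summable_nat_mul (h : IsDerivTower M D) (hM : 0 < M) (k : ℕ) {z : ℂ}
    (hz : z ∈ closedSector M) (hz0 : z ≠ 0) : Summable fun n : ℕ => D k (n * z) := by
  obtain ⟨C, hC⟩ := h.bound k
  have hre := re_pos_of_mem_closedSector hM hz hz0
  exact Summable.of_norm_bounded ((hasSum_exp_neg_nat_mul (half_pos hre)).summable.mul_left C)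
    fun n => norm_apply_nat_mul_le k hC hz n

theorem summable_add_one (h : IsDerivTower M D) (hM : 0 < M) (k : ℕ) {z : ℂ}
    (hz : z ∈ closedSector M) (hz0 : z ≠ 0) :
    Summable fun n : ℕ => D k (((n + 1 : ℕ) : ℂ) * z) :=
  (summable_nat_add_iff 1 (f := fun n : ℕ => D k (n * z))).2 (h.summable_nat_mul hM k hz hz0)

/-- The Riemann sum `z ∑_{n ≥ 1} D k (n z)`. -/
noncomputable def riemannSum (D : ℕ → ℂ → ℂ) (k : ℕ) (z : ℂ) : ℂ :=
  z * ∑' n : ℕ, D k (((n + 1 : ℕ) : ℂ) * z)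

/-- Expand `D k (n z)` around `(n + 1) z` with step `-z` to order `m + 1` and sum over `n ≥ 0`. The
zeroth-order terms telescope to `D k 0`, and the higher ones are Riemann sums of later derivatives.
The remainders add up to ‖z‖^(m+1) times a geometric series of size 1 / Re z, and ‖z‖ / Re z is
bounded in the sector, so one power of `z` is lost. -/
theorem norm_sum_riemannSum_sub_le (h : IsDerivTower M D) (hM : 0 < M) (k m : ℕ) :
    ∃ C : ℝ, ∀ z ∈ closedSector M, z ≠ 0 → ‖z‖ ≤ 1 →
      ‖(∑ i ∈ Finset.range m, (-1) ^ (i + 1) / ((i + 1).factorial : ℂ) *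
          (z ^ i * riemannSum D (k + 1 + i) z)) - D k 0‖ ≤ C * ‖z‖ ^ m := by
  obtain ⟨C, hC0, hC⟩ := h.exists_pos_bound (k + (m + 1))
  refine ⟨C * (4 * (1 + M)), fun z hz hz0 hz1 => ?_⟩
  have hre := re_pos_of_mem_closedSector hM hz hz0
  have hre1 : z.re ≤ 1 := (re_le_norm z).trans hz1
  have hterm : ∀ n : ℕ, ‖D k (n * z) - ∑ j ∈ Finset.range (m + 1),
      D (k + j) (((n + 1 : ℕ) : ℂ) * z) * ((-z) ^ j / (j.factorial : ℂ))‖ ≤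
        C * Real.exp (-(n * (z.re / 2))) * ‖z‖ ^ (m + 1) := by
    intro n
    have hadd : ((n + 1 : ℕ) : ℂ) * z + -z = n * z := by push_cast; ring
    have hseg : ∀ u ∈ segment ℝ (((n + 1 : ℕ) : ℂ) * z) ((n : ℂ) * z),
        ∃ a : ℝ, (n : ℝ) ≤ a ∧ u = a * z := by
      rintro u ⟨a, b, ha, hb, hab, rfl⟩
      refine ⟨a + n, by linarith, ?_⟩
      have hb' : b = 1 - a := by linarith
      subst hb'
      simp only [real_smul]
      push_cast
      ring
    have h1 := norm_sub_taylor_le h.hasDerivAt (m + 1) k (((n + 1 : ℕ) : ℂ) * z) (-z)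
      (C * Real.exp (-(n * (z.re / 2))))
    rw [hadd, norm_neg] at h1
    refine h1 (fun u hu => ?_) (fun u hu => ?_)
    · obtain ⟨a, ha, rfl⟩ := hseg u hu
      exact mul_mem_closedSector hz ((Nat.cast_nonneg n).trans ha)
    · obtain ⟨a, ha, rfl⟩ := hseg u hu
      refine (hC _ (mul_mem_closedSector hz ((Nat.cast_nonneg n).trans ha))).trans ?_
      simp only [mul_re, ofReal_re, ofReal_im, zero_mul, sub_zero]
      have : n * (z.re / 2) ≤ a * z.re / 2 := by nlinarith
      gcongr
  have hs0 := h.summable_nat_mul hM k hz hz0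
  have hs := fun j => h.summable_add_one hM (k + j) hz hz0
  have hsum : ∑' n : ℕ, (D k (n * z) - ∑ j ∈ Finset.range (m + 1),
      D (k + j) (((n + 1 : ℕ) : ℂ) * z) * ((-z) ^ j / (j.factorial : ℂ))) =
      D k 0 - ∑ i ∈ Finset.range m, (-1) ^ (i + 1) / ((i + 1).factorial : ℂ) *
          (z ^ i * riemannSum D (k + 1 + i) z) := by
    rw [hs0.tsum_sub (summable_sum fun j _ => (hs j).mul_right _),
      Summable.tsum_finsetSum (fun j _ => (hs j).mul_right _), Finset.sum_range_succ',
      hs0.tsum_eq_zero_add]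
    simp only [tsum_mul_right]
    simp only [Nat.cast_zero, zero_mul, add_zero, pow_zero, Nat.factorial_zero, Nat.cast_one,
      div_one, mul_one]
    rw [add_sub_add_right_eq_sub]
    congr 1
    refine Finset.sum_congr rfl fun i _ => ?_
    rw [riemannSum, show k + (i + 1) = k + 1 + i by ring, neg_pow z]
    ring
  rw [norm_sub_rev, ← hsum]
  have hg := (hasSum_exp_neg_nat_mul (half_pos hre)).mul_left C |>.mul_right (‖z‖ ^ (m + 1))
  refine (tsum_of_norm_bounded hg hterm).trans ?_
  have h2 := inv_one_sub_exp_neg_le (half_pos hre) (by linarith)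
  have h3 := norm_le_of_mem_closedSector hM hz
  calc C * (1 - Real.exp (-(z.re / 2)))⁻¹ * ‖z‖ ^ (m + 1)
      ≤ C * (2 / (z.re / 2)) * ‖z‖ ^ (m + 1) := by gcongr
    _ = C * (4 * (‖z‖ / z.re)) * ‖z‖ ^ m := by
      field_simp
      ring
    _ ≤ C * (4 * (1 + M)) * ‖z‖ ^ m := by
      gcongr
      rwa [div_le_iff₀ hre]

theorem tendsto_id_closedSector :
    Tendsto (fun z : ℂ => z) (𝓝[closedSector M \ {0}] 0) (𝓝 0) :=
  tendsto_id.mono_left nhdsWithin_le_nhds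

theorem isBigO_sum_riemannSum_sub (h : IsDerivTower M D) (hM : 0 < M) (k m : ℕ) :
    (fun z => (∑ i ∈ Finset.range m, (-1) ^ (i + 1) / ((i + 1).factorial : ℂ) *
          (z ^ i * riemannSum D (k + 1 + i) z)) - D k 0)
      =O[𝓝[closedSector M \ {0}] 0] fun z => z ^ m := by
  obtain ⟨C, hC⟩ := h.norm_sum_riemannSum_sub_le hM k m
  refine IsBigO.of_bound C ?_
  have h1 : ∀ᶠ z in 𝓝[closedSector M \ {0}] (0 : ℂ), ‖z‖ ≤ 1 := by
    filter_upwards [nhdsWithin_le_nhds (Metric.closedBall_mem_nhds (0 : ℂ) one_pos)] with z hz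
    simpa using hz
  filter_upwards [h1, self_mem_nhdsWithin] with z hz1 hz
  rw [norm_pow]
  exact hC z hz.1 hz.2 hz1

/-- The Euler–Maclaurin expansion of the Riemann sums. -/
theorem hasExpansion_riemannSum (h : IsDerivTower M D) (hM : 0 < M) (m : ℕ) :
    ∀ k, HasExpansion (𝓝[closedSector M \ {0}] 0) (fun z => z) (riemannSum D (k + 1)) m := by
  -- The `i = 0` term of the telescoped relation is minus the wanted Riemann sum, so the relation is
  -- solved for it. The other sums carry a factor z^i with i ≥ 1, so expansions of one order less
  -- suffice for them, and the Bernoulli numbers are never computed.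
  have h1 : ∀ m k, (∀ i, 1 ≤ i → i < m + 1 → HasExpansion (𝓝[closedSector M \ {0}] 0) (fun z => z)
      (fun z => z ^ i * riemannSum D (k + 1 + i) z) (m + 1)) →
      HasExpansion (𝓝[closedSector M \ {0}] 0) (fun z => z) (riemannSum D (k + 1)) (m + 1) := by
    intro m k hi
    have h2 : HasExpansion (𝓝[closedSector M \ {0}] 0) (fun z => z)
        (fun z => -D k 0 + ∑ i ∈ Finset.range m, (-1) ^ (i + 2) / ((i + 2).factorial : ℂ) *
          (z ^ (i + 1) * riemannSum D (k + 1 + (i + 1)) z)) (m + 1) :=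
      (HasExpansion.const _).add (HasExpansion.sum fun i hi' =>
        (HasExpansion.const _).mul tendsto_id_closedSector
          (hi (i + 1) (by omega) (by simpa using hi')))
    refine (h2.add (HasExpansion.of_isBigO
      (h.isBigO_sum_riemannSum_sub hM k (m + 1)).neg_left)).congr' (Eventually.of_forall fun z => ?_)
    simp only [Finset.sum_range_succ' _ m]
    simp
    ring
  induction m with
  | zero =>
    intro k
    exact (h1 0 k fun i hi hi' => by omega).mono tendsto_id_closedSector (Nat.zero_le _)
  | succ m ih =>
    intro k
    refine h1 m k fun i hi _ => ?_
    have := (ih (k + i)).pow_mul i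
    rw [show k + i + 1 = k + 1 + i by ring] at this
    exact this.mono tendsto_id_closedSector (by omega)

/-- The leading coefficient of the expansion. For `planckTower` and `k = 0` it is minus the value at
0 of the primitive, which turns out to be γ. -/
theorem isBigO_riemannSum_add (h : IsDerivTower M D) (hM : 0 < M) (k : ℕ) :
    (fun z => riemannSum D (k + 1) z + D k 0) =O[𝓝[closedSector M \ {0}] 0] fun z => z := by
  refine (h.isBigO_sum_riemannSum_sub hM k 1).neg_left.congr (fun z => ?_) (fun z => pow_one z)
  simp
  ring

end IsDerivTower

/-! ### The kernel 1/(e^z - 1) - e^(-z)/z and its primitive -/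

/-- The entire function `(e ^ z - 1) / z`. -/
noncomputable def expSubOneDiv : ℂ → ℂ := dslope exp 0

/-- The entire function `(e ^ (-z) - 1 + z) / z ^ 2`. -/
noncomputable def expNegRemainder : ℂ → ℂ := dslope (dslope (fun z => exp (-z) - 1 + z) 0) 0

/-- The function `1 / (e ^ z - 1) - e ^ (-z) / z`, with its removable singularity at `0` filled. -/
noncomputable def planckKernel (z : ℂ) : ℂ := expNegRemainder z / expSubOneDiv z

theorem Differentiable.dslope {f : ℂ → ℂ} (hf : Differentiable ℂ f) (c : ℂ) :
    Differentiable ℂ (dslope f c) := by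
  rw [← differentiableOn_univ] at hf ⊢
  exact (Complex.differentiableOn_dslope univ_mem).2 hf

theorem differentiable_expSubOneDiv : Differentiable ℂ expSubOneDiv := differentiable_exp.dslope 0

theorem differentiable_expNegRemainder : Differentiable ℂ expNegRemainder :=
  Differentiable.dslope (Differentiable.dslope (by fun_prop) 0) 0

theorem expSubOneDiv_of_ne {z : ℂ} (hz : z ≠ 0) : expSubOneDiv z = (exp z - 1) / z := by
  rw [expSubOneDiv, dslope_of_ne _ hz, slope_def_field]
  simp

theorem expSubOneDiv_zero : expSubOneDiv 0 = 1 := by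
  simp [expSubOneDiv, dslope_same]

theorem expSubOneDiv_eq_zero {z : ℂ} (h : expSubOneDiv z = 0) :
    ∃ n : ℤ, n ≠ 0 ∧ z = n * (2 * Real.pi * I) := by
  have hz : z ≠ 0 := by
    rintro rfl
    simp [expSubOneDiv_zero] at h
  rw [expSubOneDiv_of_ne hz, div_eq_zero_iff, or_iff_left hz, sub_eq_zero, exp_eq_one_iff] at h
  obtain ⟨n, rfl⟩ := h
  refine ⟨n, ?_, rfl⟩
  rintro rfl
  simp at hz

theorem planckKernel_of_ne {z : ℂ} (hz : z ≠ 0) (h : exp z ≠ 1) :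
    planckKernel z = 1 / (exp z - 1) - exp (-z) / z := by
  have h1 : expNegRemainder z = (exp (-z) - 1 + z) / z ^ 2 := by
    -- The inner slope takes the derivative as its value at 0; since that is 0, the iterated slope
    -- is the plain quotient by z².
    have hd : HasDerivAt (fun z : ℂ => exp (-z) - 1 + z) 0 0 := by
      refine ((((hasDerivAt_neg (0 : ℂ)).cexp).sub_const 1).add (hasDerivAt_id (0 : ℂ))).congr_deriv ?_
      simp
    rw [expNegRemainder, dslope_of_ne _ hz, slope_def_field, dslope_same, hd.deriv,
      dslope_of_ne _ hz, slope_def_field]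
    simp
    field_simp
  rw [planckKernel, h1, expSubOneDiv_of_ne hz, exp_neg]
  have h2 := exp_ne_zero z
  have h3 : exp z - 1 ≠ 0 := sub_ne_zero.2 h
  field_simp
  ring

/-- A closed neighbourhood of the sector `|Im z| ≤ M Re z` without nonzero multiples of `2πi`. -/
def sectorNhd (M : ℝ) : Set ℂ :=
  {z | -(1 + M)⁻¹ ≤ z.re ∧ |z.im| ≤ M * (z.re + (1 + M)⁻¹) + (1 + M)⁻¹}

section

variable {M : ℝ}

/-- Leaves room for Cauchy estimates of the fixed radius (1 + M)⁻¹ around every point of the sector.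
-/
theorem closedBall_subset_sectorNhd (hM : 0 < M) {w : ℂ} (hw : w ∈ closedSector M) :
    Metric.closedBall w (1 + M)⁻¹ ⊆ sectorNhd M := by
  intro z hz
  rw [mem_closedBall_iff_norm] at hz
  have h1 : |z.re - w.re| ≤ (1 + M)⁻¹ := by
    simpa using (abs_re_le_norm (z - w)).trans hz
  have h2 : |z.im - w.im| ≤ (1 + M)⁻¹ := by
    simpa using (abs_im_le_norm (z - w)).trans hz
  have h3 := re_nonneg_of_mem_closedSector hM hw
  have h4 : |w.im| ≤ M * w.re := hw
  have h5 := (abs_le.1 h1).1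
  refine ⟨by linarith, ?_⟩
  have h6 : |z.im| ≤ |w.im| + |z.im - w.im| := by
    have := abs_add_le w.im (z.im - w.im)
    simpa using this
  have h7 : M * w.re ≤ M * (z.re + (1 + M)⁻¹) := by
    gcongr
    linarith
  linarith

theorem closedSector_subset_sectorNhd (hM : 0 < M) : closedSector M ⊆ sectorNhd M :=
  fun _ hw => closedBall_subset_sectorNhd hM hw (Metric.mem_closedBall_self (by positivity))

theorem isClosed_sectorNhd (M : ℝ) : IsClosed (sectorNhd M) := by
  refine (isClosed_le continuous_const continuous_re).inter
    (isClosed_le (continuous_abs.comp continuous_im) ?_)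
  fun_prop

/-- The zeros are the nonzero multiples of 2πi, while the neighbourhood meets the imaginary axis
only in |Im z| ≤ 1. -/
theorem expSubOneDiv_ne_zero (hM : 0 < M) {z : ℂ} (hz : z ∈ sectorNhd M) :
    expSubOneDiv z ≠ 0 := by
  intro h
  obtain ⟨n, hn, rfl⟩ := expSubOneDiv_eq_zero h
  have h1 : |((n : ℂ) * (2 * Real.pi * I)).im| ≤
    M * (((n : ℂ) * (2 * Real.pi * I)).re + (1 + M)⁻¹) + (1 + M)⁻¹ := hz.2
  have h2 : M * (0 + (1 + M)⁻¹) + (1 + M)⁻¹ = 1 := by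
    field_simp
    ring
  have hre : ((n : ℂ) * (2 * Real.pi * I)).re = 0 := by simp
  have him : ((n : ℂ) * (2 * Real.pi * I)).im = n * (2 * Real.pi) := by simp
  rw [hre, him, h2, abs_mul, abs_of_pos Real.two_pi_pos] at h1
  have h3 : (1 : ℝ) ≤ |(n : ℝ)| := by exact_mod_cast Int.one_le_abs hn
  nlinarith [Real.pi_gt_three]

theorem analyticAt_planckKernel {z : ℂ} (hz : expSubOneDiv z ≠ 0) :
    AnalyticAt ℂ planckKernel z :=
  (differentiable_expNegRemainder.analyticAt z).div (differentiable_expSubOneDiv.analyticAt z) hz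

/-- The part of the neighbourhood with Re z ≤ 1 is compact and the kernel is continuous there; for
Re z ≥ 1 both of its terms are O(e^(-Re z)), which is more than is needed. -/
theorem exists_planckKernel_bound (hM : 0 < M) :
    ∃ C : ℝ, 0 < C ∧ ∀ z ∈ sectorNhd M, ‖planckKernel z‖ ≤ C * Real.exp (-(z.re / 2)) := by
  have hcomp : IsCompact (sectorNhd M ∩ {z | z.re ≤ 1}) := by
    refine Metric.isCompact_of_isClosed_isBounded
      ((isClosed_sectorNhd M).inter (isClosed_le continuous_re continuous_const)) ?_
    refine (isBounded_iff_forall_norm_le).2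
      ⟨max (1 + M)⁻¹ 1 + (M * (1 + (1 + M)⁻¹) + (1 + M)⁻¹), fun z hz => ?_⟩
    have hz1 : z.re ≤ 1 := hz.2
    refine (norm_le_abs_re_add_abs_im z).trans (add_le_add ?_ (hz.1.2.trans ?_))
    · refine abs_le.2 ⟨?_, hz1.trans (le_max_right _ _)⟩
      have := le_max_left (1 + M)⁻¹ (1 : ℝ)
      linarith [hz.1.1]
    · gcongr
  obtain ⟨C, hC⟩ := hcomp.exists_bound_of_continuousOn (f := planckKernel) fun z hz =>
    (analyticAt_planckKernel (expSubOneDiv_ne_zero hM hz.1)).continuousAt.continuousWithinAt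
  refine ⟨max 3 (max C 0 * Real.exp (1 / 2)), by positivity, fun z hz => ?_⟩
  rcases le_total z.re 1 with h | h
  · calc ‖planckKernel z‖ ≤ max C 0 := (hC z ⟨hz, h⟩).trans (le_max_left _ _)
      _ = max C 0 * Real.exp (1 / 2) * Real.exp (-(1 / 2)) := by
        rw [mul_assoc, ← Real.exp_add]
        simp
      _ ≤ _ := by
        gcongr
        · exact le_max_right _ _
  · have hz0 : z ≠ 0 := by
      rintro rfl
      simp at h
      linarith
    have hexp : 2 ≤ Real.exp z.re := by
      have := Real.add_one_le_exp z.re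
      linarith
    have h1 : Real.exp z.re / 2 ≤ ‖exp z - 1‖ := by
      have := norm_sub_norm_le (exp z) 1
      rw [norm_exp, norm_one] at this
      linarith
    have hne : exp z ≠ 1 := by
      intro h2
      rw [h2] at h1
      simp at h1
      linarith
    have hnz : 1 ≤ ‖z‖ := h.trans (re_le_norm z)
    rw [planckKernel_of_ne hz0 hne]
    calc ‖1 / (exp z - 1) - exp (-z) / z‖ ≤ ‖1 / (exp z - 1)‖ + ‖exp (-z) / z‖ := norm_sub_le _ _
      _ ≤ 2 * Real.exp (-z.re) + Real.exp (-z.re) := by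
        rw [norm_div, norm_div, norm_one, norm_exp, neg_re]
        gcongr
        · rw [Real.exp_neg, div_le_iff₀ (by linarith)]
          calc (1 : ℝ) = 2 * (Real.exp z.re)⁻¹ * (Real.exp z.re / 2) := by field_simp
            _ ≤ _ := by gcongr
        · exact div_le_self (Real.exp_pos _).le hnz
      _ = 3 * Real.exp (-z.re) := by ring
      _ ≤ _ := by
        gcongr
        · exact le_max_left _ _
        · linarith

/-- The primitive of `planckKernel` which vanishes at infinity. -/
noncomputable def planckPrimitive (z : ℂ) : ℂ := -∫ t in Set.Ioi (0 : ℝ), planckKernel (z + t)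

theorem add_mem_sectorNhd (hM : 0 < M) {z : ℂ} (hz : z ∈ sectorNhd M) {t : ℝ} (ht : 0 ≤ t) :
    z + t ∈ sectorNhd M := by
  have h1 := hz.1
  have h2 := hz.2
  refine ⟨?_, ?_⟩
  · simp
    linarith
  · simp
    nlinarith

theorem integrableOn_exp_neg_half (a : ℝ) :
    IntegrableOn (fun t : ℝ => Real.exp (-((a + t) / 2))) (Set.Ioi 0) := by
  have h1 := (integrableOn_exp_mul_Ioi (by norm_num : (-(1 / 2) : ℝ) < 0) 0).const_mul
    (Real.exp (-(a / 2)))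
  refine h1.congr (Eventually.of_forall fun t => ?_)
  simp only
  rw [← Real.exp_add]
  ring_nf

/-- Differentiate under the integral; the kernel vanishes at infinity, so its derivative integrates
over the ray from `w` to minus the kernel at `w`. -/
theorem hasDerivAt_planckPrimitive (hM : 0 < M) {w : ℂ} (hw : w ∈ closedSector M) :
    HasDerivAt planckPrimitive (planckKernel w) w := by
  have hr : 0 < (1 + M)⁻¹ := by positivity
  obtain ⟨C, hC0, hC⟩ := exists_planckKernel_bound hM
  have hmem : ∀ z ∈ Metric.ball w (1 + M)⁻¹, ∀ t : ℝ, 0 ≤ t → z + t ∈ sectorNhd M :=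
    fun z hz t ht => add_mem_sectorNhd hM
      (closedBall_subset_sectorNhd hM hw (Metric.ball_subset_closedBall hz)) ht
  have hana : ∀ z ∈ Metric.ball w (1 + M)⁻¹, ∀ t : ℝ, 0 ≤ t →
      AnalyticAt ℂ planckKernel (z + t) :=
    fun z hz t ht => analyticAt_planckKernel (expSubOneDiv_ne_zero hM (hmem z hz t ht))
  have hda : ∀ z ∈ Metric.ball w (1 + M)⁻¹, ∀ t : ℝ, 0 ≤ t →
      HasDerivAt (fun z => planckKernel (z + t)) (deriv planckKernel (z + t)) z :=
    fun z hz t ht => (hana z hz t ht).differentiableAt.hasDerivAt.comp_add_const z t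
  have hw0 : w ∈ Metric.ball w (1 + M)⁻¹ := Metric.mem_ball_self hr
  obtain ⟨h1, h2⟩ := hasDerivAt_integral_of_dominated (μ := volume.restrict (Set.Ioi (0 : ℝ)))
    (F := fun z (t : ℝ) => planckKernel (z + t)) (z₀ := w) hr
    (b := fun t => C * Real.exp (-((w.re - (1 + M)⁻¹ + t) / 2)))
    (fun z hz => by
      refine ContinuousOn.aestronglyMeasurable (fun t ht => ?_) measurableSet_Ioi
      have h1 : ContinuousAt (fun t : ℝ => z + t) t := by fun_prop
      exact (ContinuousAt.comp (f := fun t : ℝ => z + t) (x := t)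
        (hana z hz t (le_of_lt ht)).continuousAt h1).continuousWithinAt)
    (by
      filter_upwards [ae_restrict_mem measurableSet_Ioi] with t ht z hz
      exact (hda z hz t (le_of_lt ht)).differentiableAt.differentiableWithinAt)
    (by
      filter_upwards [ae_restrict_mem measurableSet_Ioi] with t ht z hz
      refine (hC _ (hmem z hz t (le_of_lt ht))).trans ?_
      have h3 : |z.re - w.re| ≤ (1 + M)⁻¹ := by
        have h4 := (abs_re_le_norm (z - w)).trans (mem_ball_iff_norm.1 hz).le
        simpa using h4
      have := (abs_le.1 h3).1
      simp only [add_re, ofReal_re]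
      gcongr
      linarith)
    ((integrableOn_exp_neg_half _).const_mul C)
  have h3 : ∀ t ∈ Set.Ioi (0 : ℝ), deriv (fun z => planckKernel (z + t)) w =
      deriv planckKernel (w + t) := fun t ht => (hda w hw0 t (le_of_lt ht)).deriv
  have h4 : IntegrableOn (fun t : ℝ => deriv planckKernel (w + t)) (Set.Ioi 0) :=
    (integrableOn_congr_fun h3 measurableSet_Ioi).1 h1
  have h5 : ∫ t in Set.Ioi (0 : ℝ), deriv planckKernel (w + t) = 0 - planckKernel (w + (0 : ℝ)) := by
    refine integral_Ioi_of_hasDerivAt_of_tendsto (f := fun t : ℝ => planckKernel (w + t)) ?_ ?_ h4 ?_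
    · have h1 : ContinuousAt (fun t : ℝ => w + t) 0 := by fun_prop
      exact (ContinuousAt.comp (f := fun t : ℝ => w + t) (x := (0 : ℝ))
        (hana w hw0 0 le_rfl).continuousAt h1).continuousWithinAt
    · intro t ht
      have h6 := (hana w hw0 t (le_of_lt ht)).differentiableAt.hasDerivAt
      exact (h6.comp_const_add w (t : ℂ)).comp_ofReal
    · refine squeeze_zero_norm' (a := fun t : ℝ => C * Real.exp (-((w.re + t) / 2))) ?_ ?_
      · filter_upwards [eventually_ge_atTop 0] with t ht
        simpa using hC _ (hmem w hw0 t ht)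
      · have : Tendsto (fun t : ℝ => (w.re + t) / 2) atTop atTop :=
          (tendsto_atTop_add_const_left _ _ tendsto_id).atTop_div_const two_pos
        simpa using (Real.tendsto_exp_neg_atTop_nhds_zero.comp this).const_mul C
  have h6 := h2.neg
  rw [setIntegral_congr_fun measurableSet_Ioi h3, h5] at h6
  simpa using! h6

theorem exists_planckPrimitive_bound (hM : 0 < M) :
    ∃ C : ℝ, ∀ z ∈ closedSector M, ‖planckPrimitive z‖ ≤ C * Real.exp (-(z.re / 2)) := by
  obtain ⟨C, hC0, hC⟩ := exists_planckKernel_bound hM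
  refine ⟨C * 2, fun z hz => ?_⟩
  rw [planckPrimitive, norm_neg]
  calc ‖∫ t in Set.Ioi (0 : ℝ), planckKernel (z + t)‖
      ≤ ∫ t in Set.Ioi (0 : ℝ), C * Real.exp (-((z.re + t) / 2)) := by
        refine norm_integral_le_of_norm_le ((integrableOn_exp_neg_half _).const_mul C) ?_
        filter_upwards [ae_restrict_mem measurableSet_Ioi] with t ht
        simpa using hC _ (add_mem_sectorNhd hM (closedSector_subset_sectorNhd hM hz) (le_of_lt ht))
    _ = _ := by
      rw [integral_const_mul, mul_assoc]
      congr 1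
      have h1 : ∀ t : ℝ, Real.exp (-((z.re + t) / 2)) =
          Real.exp (-(z.re / 2)) * Real.exp (-(1 / 2) * t) := by
        intro t
        rw [← Real.exp_add]
        ring_nf
      simp_rw [h1]
      rw [integral_const_mul, integral_exp_mul_Ioi (by norm_num)]
      norm_num
      ring

/-- `planckPrimitive` followed by the iterated derivatives of `planckKernel`. -/
noncomputable def planckTower : ℕ → ℂ → ℂ
  | 0 => planckPrimitive
  | k + 1 => iteratedDeriv k planckKernel

theorem isDerivTower_planckTower (hM : 0 < M) : IsDerivTower M planckTower where
  hasDerivAt := by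
    rintro (_ | k) z hz
    · simpa [planckTower] using hasDerivAt_planckPrimitive hM hz
    · simp only [planckTower]
      rw [iteratedDeriv_succ]
      have h1 := analyticAt_planckKernel
        (expSubOneDiv_ne_zero hM (closedSector_subset_sectorNhd hM hz))
      have h2 := h1.iterated_deriv k
      rw [← iteratedDeriv_eq_iterate] at h2
      exact h2.differentiableAt.hasDerivAt
  bound := by
    rintro (_ | k)
    · exact exists_planckPrimitive_bound hM
    · obtain ⟨C, hC0, hC⟩ := exists_planckKernel_bound hM
      have hr : 0 < (1 + M)⁻¹ := by positivity
      refine ⟨k.factorial * (C * Real.exp ((1 + M)⁻¹ / 2)) / (1 + M)⁻¹ ^ k, fun z hz => ?_⟩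
      have hsub := closedBall_subset_sectorNhd hM hz
      -- Cauchy's estimate on a circle of radius (1 + M)⁻¹. On it the real part drops by at most the
      -- radius, which costs the factor exp((1 + M)⁻¹ / 2).
      have h1 := norm_iteratedDeriv_le_of_forall_mem_sphere_norm_le (f := planckKernel) (c := z) k hr
        (C := C * Real.exp ((1 + M)⁻¹ / 2) * Real.exp (-(z.re / 2))) ?_ ?_
      · refine h1.trans_eq ?_
        ring
      · refine DifferentiableOn.diffContOnCl fun w hw => ?_
        have hw' := hsub ((closure_mono Metric.ball_subset_closedBall).trans
          (by rw [Metric.isClosed_closedBall.closure_eq]) hw)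
        exact (analyticAt_planckKernel
          (expSubOneDiv_ne_zero hM hw')).differentiableAt.differentiableWithinAt
      · intro w hw
        refine (hC _ (hsub (Metric.sphere_subset_closedBall hw))).trans ?_
        rw [mul_assoc, ← Real.exp_add]
        have h3 : |w.re - z.re| ≤ (1 + M)⁻¹ := by
          have h4 := (abs_re_le_norm (w - z)).trans (mem_sphere_iff_norm.1 hw).le
          simpa using h4
        have := (abs_le.1 h3).1
        gcongr
        linarith

end

/-! ### The Lambert series in the right half-plane -/

/-- The Lambert series `∑_{n ≥ 1} 1 / (e ^ (n z) - 1)`. -/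
noncomputable def lambertSeries (z : ℂ) : ℂ := ∑' n : ℕ, 1 / (exp (((n + 1 : ℕ) : ℂ) * z) - 1)

theorem norm_lambertTerm_le {a : ℝ} (ha : 0 < a) {z : ℂ} (hz : a ≤ z.re) (n : ℕ) :
    ‖1 / (exp (((n + 1 : ℕ) : ℂ) * z) - 1)‖ ≤
      (1 - Real.exp (-a))⁻¹ * (Real.exp (-z.re) * Real.exp (-(n * z.re))) := by
  have h1 : Real.exp (-a) < 1 := Real.exp_lt_one_iff.2 (by linarith)
  have h2 : ‖exp (((n + 1 : ℕ) : ℂ) * z)‖ = Real.exp ((n + 1) * z.re) := by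
    rw [norm_exp]
    simp
  have h3 : Real.exp ((n + 1) * z.re) * (1 - Real.exp (-a)) ≤
      ‖exp (((n + 1 : ℕ) : ℂ) * z) - 1‖ := by
    have h4 := norm_sub_norm_le (exp (((n + 1 : ℕ) : ℂ) * z)) 1
    rw [h2, norm_one] at h4
    refine le_trans ?_ h4
    have h5 : 1 ≤ Real.exp ((n + 1) * z.re) * Real.exp (-a) := by
      rw [← Real.exp_add]
      refine Real.one_le_exp ?_
      have : (0 : ℝ) ≤ n := n.cast_nonneg
      nlinarith
    linarith
  rw [norm_div, norm_one, div_le_iff₀ (lt_of_lt_of_le (by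
    have : 0 < 1 - Real.exp (-a) := by linarith
    positivity) h3)]
  have h6 : 0 < 1 - Real.exp (-a) := by linarith
  calc (1 : ℝ) = (1 - Real.exp (-a))⁻¹ * (Real.exp (-z.re) * Real.exp (-(n * z.re))) *
        (Real.exp ((n + 1) * z.re) * (1 - Real.exp (-a))) := by
        have h7 : Real.exp (-z.re) * Real.exp (-(n * z.re)) * Real.exp ((n + 1) * z.re) = 1 := by
          rw [← Real.exp_add, ← Real.exp_add]
          ring_nf
          simp
        calc (1 : ℝ) = ((1 - Real.exp (-a))⁻¹ * (1 - Real.exp (-a))) *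
              (Real.exp (-z.re) * Real.exp (-(n * z.re)) * Real.exp ((n + 1) * z.re)) := by
              rw [inv_mul_cancel₀ h6.ne', h7, one_mul]
          _ = _ := by ring
    _ ≤ _ := by gcongr

theorem norm_lambertSeries_le {a : ℝ} (ha : 0 < a) {z : ℂ} (hz : a ≤ z.re) :
    ‖lambertSeries z‖ ≤ (1 - Real.exp (-a))⁻¹ ^ 2 * Real.exp (-z.re) := by
  have hz0 : 0 < z.re := ha.trans_le hz
  refine (tsum_of_norm_bounded (((hasSum_exp_neg_nat_mul hz0).mul_left _).mul_left _)
    fun n => norm_lambertTerm_le ha hz n).trans ?_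
  have h1 : Real.exp (-a) < 1 := Real.exp_lt_one_iff.2 (by linarith)
  have h2 : 0 < 1 - Real.exp (-a) := by linarith
  calc _ ≤ (1 - Real.exp (-a))⁻¹ * (Real.exp (-z.re) * (1 - Real.exp (-a))⁻¹) := by gcongr
    _ = _ := by ring

theorem differentiableOn_lambertSeries : DifferentiableOn ℂ lambertSeries {z | 0 < z.re} := by
  intro z hz
  have hz' : 0 < z.re := hz
  set a := z.re / 2
  have ha : 0 < a := half_pos hz'
  have hopen : IsOpen {w : ℂ | a < w.re} := isOpen_lt continuous_const continuous_re
  have h1 : DifferentiableOn ℂ lambertSeries {w : ℂ | a < w.re} := by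
    refine differentiableOn_tsum_of_summable_norm
      (u := fun n : ℕ => (1 - Real.exp (-a))⁻¹ * (Real.exp (-a) * Real.exp (-(n * a))))
      (((hasSum_exp_neg_nat_mul ha).mul_left _).mul_left _).summable ?_ hopen ?_
    · intro n w hw
      have hw' : a < w.re := hw
      refine DifferentiableAt.differentiableWithinAt ?_
      refine (differentiableAt_const _).div (by fun_prop) ?_
      intro h
      have h2 := congrArg norm (sub_eq_zero.1 h)
      rw [norm_exp, norm_one, Real.exp_eq_one_iff] at h2
      have h3 : (((n + 1 : ℕ) : ℂ) * w).re = (n + 1) * w.re := by simp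
      rw [h3] at h2
      have : 0 < (n + 1) * w.re := by
        have := ha.trans hw'
        positivity
      linarith
    · intro n w hw
      have hw' : a < w.re := hw
      have h1 : Real.exp (-a) < 1 := Real.exp_lt_one_iff.2 (by linarith)
      have h2 : 0 < 1 - Real.exp (-a) := by linarith
      refine (norm_lambertTerm_le ha hw'.le n).trans ?_
      gcongr
  exact (h1.differentiableAt (hopen.mem_nhds (show a < z.re from half_lt_self hz'))).differentiableWithinAt

/-- This periodicity carries the point 2πi e^(-ip), close to 2πi, to a point close to 0, where the
Riemann sum expansion applies. -/
theorem lambertSeries_add_two_pi_I (z : ℂ) :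
    lambertSeries (z + 2 * Real.pi * I) = lambertSeries z := by
  unfold lambertSeries
  congr 1
  ext n
  rw [mul_add, exp_add, exp_nat_mul_two_pi_mul_I, mul_one]

theorem exp_ne_one_of_re_pos {z : ℂ} (hz : 0 < z.re) : exp z ≠ 1 := by
  intro h
  have h2 := congrArg norm h
  rw [norm_exp, norm_one, Real.exp_eq_one_iff] at h2
  linarith

theorem exists_mem_closedSector {z : ℂ} (hz : 0 < z.re) :
    ∃ M : ℝ, 0 < M ∧ z ∈ closedSector M := by
  refine ⟨|z.im| / z.re + 1, by positivity, ?_⟩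
  have : |z.im| / z.re * z.re = |z.im| := by field_simp
  simp only [closedSector, Set.mem_ofPred_eq]
  nlinarith

/-- Each term splits as e^(-nz)/(nz) plus the kernel at nz. The first parts sum in closed form to
the logarithm, and the second parts form a Riemann sum of a function that is regular at 0 and decays
exponentially. -/
theorem lambertSeries_eq {z : ℂ} (hz : 0 < z.re) :
    lambertSeries z = (-log (1 - exp (-z)) + IsDerivTower.riemannSum planckTower 1 z) / z := by
  have hz0 : z ≠ 0 := by
    rintro rfl
    simp at hz
  obtain ⟨M, hM, hzM⟩ := exists_mem_closedSector hz
  have h1 := (isDerivTower_planckTower hM).summable_add_one hM 1 hzM hz0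
  have h2 : ‖exp (-z)‖ < 1 := by
    rw [norm_exp, Real.exp_lt_one_iff, neg_re]
    linarith
  have h3 := (hasSum_taylorSeries_neg_log' h2).div_const z
  have h4 := h3.add h1.hasSum
  have h5 : ∀ n : ℕ, exp (-z) ^ (n + 1) / (n + 1) / z +
      planckTower 1 (((n + 1 : ℕ) : ℂ) * z) = 1 / (exp (((n + 1 : ℕ) : ℂ) * z) - 1) := by
    intro n
    have hn : ((n : ℂ) + 1) ≠ 0 := Nat.cast_add_one_ne_zero n
    have hre : 0 < (((n + 1 : ℕ) : ℂ) * z).re := by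
      have : (((n + 1 : ℕ) : ℂ) * z).re = (n + 1) * z.re := by simp
      rw [this]
      positivity
    simp only [planckTower, iteratedDeriv_zero]
    rw [planckKernel_of_ne (by push_cast; exact mul_ne_zero hn hz0) (exp_ne_one_of_re_pos hre),
      ← exp_nat_mul]
    push_cast
    rw [mul_neg]
    field_simp
    ring
  simp only [h5] at h4
  rw [lambertSeries, h4.tsum_eq, IsDerivTower.riemannSum]
  field_simp

/-! ### Mellin transform of the kernel and Euler's constant -/

theorem continuousAt_planckKernel_ofReal {t : ℝ} (ht : 0 ≤ t) :
    ContinuousAt (fun t : ℝ => planckKernel t) t := by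
  have hmem : (t : ℂ) ∈ closedSector 1 := by simpa [closedSector] using ht
  have h1 := analyticAt_planckKernel
    (expSubOneDiv_ne_zero one_pos (closedSector_subset_sectorNhd one_pos hmem))
  exact ContinuousAt.comp (f := fun t : ℝ => (t : ℂ)) (x := t) h1.continuousAt
    continuous_ofReal.continuousAt

theorem mellinConvergent_planckKernel {s : ℂ} (hs : 0 < s.re) :
    MellinConvergent (fun t : ℝ => planckKernel t) s ∧
      DifferentiableAt ℂ (mellin fun t : ℝ => planckKernel t) s := by
  have h1 : LocallyIntegrableOn (fun t : ℝ => planckKernel t) (Set.Ioi 0) :=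
    ContinuousOn.locallyIntegrableOn (fun t ht =>
      (continuousAt_planckKernel_ofReal (le_of_lt ht)).continuousWithinAt) measurableSet_Ioi
  have h2 : (fun t : ℝ => planckKernel t) =O[atTop] fun t : ℝ => Real.exp (-(1 / 2) * t) := by
    obtain ⟨C, hC0, hC⟩ := exists_planckKernel_bound one_pos
    refine IsBigO.of_bound C ?_
    filter_upwards [eventually_ge_atTop 0] with t ht
    have hmem : (t : ℂ) ∈ closedSector 1 := by simpa [closedSector] using ht
    have h3 := hC _ (closedSector_subset_sectorNhd one_pos hmem)
    rw [Real.norm_of_nonneg (Real.exp_pos _).le]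
    convert h3 using 3
    simp
    ring
  have h3 : (fun t : ℝ => planckKernel t) =O[𝓝[>] 0] fun t : ℝ => t ^ (-(0 : ℝ)) := by
    simp only [neg_zero, Real.rpow_zero]
    exact ((continuousAt_planckKernel_ofReal le_rfl).mono_left nhdsWithin_le_nhds).isBigO_one ℝ
  exact ⟨mellinConvergent_of_isBigO_rpow_exp (by norm_num) h1 h2 h3 hs,
    mellin_differentiableAt_of_isBigO_rpow_exp (by norm_num) h1 h2 h3 hs⟩

theorem hasMellin_exp_neg_div {s : ℂ} (hs : 1 < s.re) :
    HasMellin (fun t : ℝ => exp (-(t : ℂ)) / t) s (Gamma (s - 1)) := by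
  have hs' : 0 < (s - 1).re := by simpa using hs
  have h1 : ∀ t ∈ Set.Ioi (0 : ℝ), ((Real.exp (-t) : ℝ) : ℂ) * (t : ℂ) ^ (s - 1 - 1) =
      (t : ℂ) ^ (s - 1) • (exp (-(t : ℂ)) / t) := by
    intro t ht
    have ht0 : (t : ℂ) ≠ 0 := ofReal_ne_zero.2 (ne_of_gt ht)
    rw [cpow_sub (s - 1) 1 ht0, cpow_one, smul_eq_mul]
    push_cast
    ring
  constructor
  · exact (integrableOn_congr_fun h1 measurableSet_Ioi).1 (GammaIntegral_convergent hs')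
  · rw [Gamma_eq_integral hs', GammaIntegral, mellin]
    exact (setIntegral_congr_fun measurableSet_Ioi h1).symm

theorem hasSum_exp_neg_geometric {t : ℝ} (ht : 0 < t) :
    HasSum (fun n : ℕ => exp (-((n : ℂ) + 1) * t)) (1 / (exp t - 1)) := by
  have h0 : ‖exp (-(t : ℂ))‖ < 1 := by
    rw [norm_exp, Real.exp_lt_one_iff]
    simpa using ht
  have h1 := (hasSum_geometric_of_norm_lt_one h0).mul_left (exp (-(t : ℂ)))
  have h2 : exp (t : ℂ) - 1 ≠ 0 :=
    sub_ne_zero.2 (exp_ne_one_of_re_pos (by simpa using ht))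
  have h5 : exp (-(t : ℂ)) * (1 - exp (-(t : ℂ)))⁻¹ = 1 / (exp t - 1) := by
    have h3 := exp_ne_zero (t : ℂ)
    have h4 : 1 - (exp (t : ℂ))⁻¹ ≠ 0 := by
      rw [sub_ne_zero, ne_comm, Ne, inv_eq_one]
      exact sub_ne_zero.1 h2
    rw [exp_neg]
    field_simp
  rw [← h5]
  refine h1.congr_fun fun n => ?_
  rw [← exp_nat_mul, ← exp_add]
  ring_nf

/-- The transform of 1/(e^t - 1) is Γ ζ by expanding in a geometric series, and that of e^(-t)/t is
Γ(s - 1). Each diverges at s = 1, but the kernel converges there. -/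
theorem mellin_planckKernel {s : ℂ} (hs : 1 < s.re) :
    mellin (fun t : ℝ => planckKernel t) s = Gamma s * riemannZeta s - Gamma (s - 1) := by
  have hs0 : 0 < s.re := one_pos.trans hs
  have hsum : Summable fun n : ℕ => ‖(1 : ℂ)‖ / ((n : ℝ) + 1) ^ s.re := by
    have := (summable_nat_add_iff 1 (f := fun n : ℕ => 1 / (n : ℝ) ^ s.re)).2
      (Real.summable_one_div_nat_rpow.2 hs)
    simpa using this
  have h1 := hasSum_mellin (ι := ℕ) (a := fun _ => 1) (p := fun n => n + 1)
    (F := fun t : ℝ => 1 / (exp t - 1)) (s := s) (fun n => Or.inr (by positivity)) hs0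
    (fun t ht => by
      have := hasSum_exp_neg_geometric ht
      convert this using 2 with n
      push_cast
      simp) hsum
  have h2 : mellin (fun t : ℝ => 1 / (exp t - 1)) s = Gamma s * riemannZeta s := by
    rw [← h1.tsum_eq, zeta_eq_tsum_one_div_nat_add_one_cpow hs, ← tsum_mul_left]
    congr 1
    ext n
    push_cast
    ring
  have h3 := hasMellin_add (mellinConvergent_planckKernel hs0).1 (hasMellin_exp_neg_div hs).1
  rw [(hasMellin_exp_neg_div hs).2] at h3
  rw [eq_sub_iff_add_eq, ← h2, ← h3.2]
  refine setIntegral_congr_fun measurableSet_Ioi fun t ht => ?_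
  have ht0 : (t : ℂ) ≠ 0 := ofReal_ne_zero.2 (ne_of_gt ht)
  simp only [planckKernel_of_ne ht0 (exp_ne_one_of_re_pos (by simpa using ht))]
  ring_nf

/-- Minus this value is the Mellin transform of the kernel at 1. As s → 1 from Re s > 1 that
transform equals Γ(s) (ζ(s) - 1/(s - 1)), which tends to γ. -/
theorem planckPrimitive_zero : planckPrimitive 0 = -(Real.eulerMascheroniConstant : ℂ) := by
  have h1 : mellin (fun t : ℝ => planckKernel t) 1 = -planckPrimitive 0 := by
    simp [mellin, planckPrimitive]
  have h2 := (mellinConvergent_planckKernel (s := 1) (by simp)).2.continuousAt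
  have hf : 𝓝[{s : ℂ | 1 < s.re}] (1 : ℂ) ≤ 𝓝[≠] 1 := by
    refine nhdsWithin_mono _ ?_
    rintro s hs rfl
    simp at hs
  have : NeBot (𝓝[{s : ℂ | 1 < s.re}] (1 : ℂ)) := by
    refine mem_closure_iff_nhdsWithin_neBot.1 ?_
    rw [closure_setOfPred_lt_re]
    simp
  have h3 : Tendsto (fun s => Gamma s * (riemannZeta s - 1 / (s - 1)))
      (𝓝[{s : ℂ | 1 < s.re}] 1) (𝓝 (1 * Real.eulerMascheroniConstant)) := by
    refine Tendsto.mul ?_ (tendsto_riemannZeta_sub_one_div.mono_left hf)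
    have h4 : ContinuousAt Gamma 1 :=
      (differentiableAt_Gamma 1 fun m h => by
        have := congrArg re h
        simp at this
        have : (0 : ℝ) ≤ m := m.cast_nonneg
        linarith).continuousAt
    have := h4.tendsto
    rw [Gamma_one] at this
    exact this.mono_left nhdsWithin_le_nhds
  have h5 : Tendsto (mellin fun t : ℝ => planckKernel t) (𝓝[{s : ℂ | 1 < s.re}] 1)
      (𝓝 (1 * Real.eulerMascheroniConstant)) := by
    refine h3.congr' ?_
    filter_upwards [self_mem_nhdsWithin] with s hs
    have hs1 : 1 < s.re := hs
    have hs' : s - 1 ≠ 0 := by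
      intro h
      rw [sub_eq_zero.1 h] at hs1
      simp at hs1
    have h6 := Gamma_add_one (s - 1) hs'
    rw [sub_add_cancel] at h6
    rw [mellin_planckKernel hs1, mul_sub, h6]
    field_simp
  have h6 := tendsto_nhds_unique h5 (h2.tendsto.mono_left nhdsWithin_le_nhds)
  rw [h1, one_mul] at h6
  rw [h6, neg_neg]

/-! ### The Lambert series without its singular part -/

/-- The Lambert series minus its singular part at `0`. -/
noncomputable def lambertRemainder (z : ℂ) : ℂ :=
  lambertSeries z - (Real.eulerMascheroniConstant - log z) / z

theorem differentiableAt_lambertRemainder {z : ℂ} (hz : 0 < z.re) :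
    DifferentiableAt ℂ lambertRemainder z := by
  have hz0 : z ≠ 0 := by
    rintro rfl
    simp at hz
  have h1 := differentiableOn_lambertSeries.differentiableAt
    ((isOpen_lt continuous_const continuous_re).mem_nhds hz)
  refine h1.sub (DifferentiableAt.div ((differentiableAt_const _).sub ?_) differentiableAt_id hz0)
  exact differentiableAt_log (Or.inl hz)

/-- Both factors of z · (1 - e^(-z))/z have positive real part, so their arguments add up without
leaving (-π, π]. -/
theorem log_one_sub_exp_neg_eventually :
    ∀ᶠ z in 𝓝 (0 : ℂ), 0 < z.re → log (1 - exp (-z)) = log z + log (expSubOneDiv (-z)) := by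
  have h1 : Tendsto (fun z : ℂ => (expSubOneDiv (-z)).re) (𝓝 0) (𝓝 1) := by
    have h2 : Continuous fun z : ℂ => (expSubOneDiv (-z)).re :=
      continuous_re.comp (differentiable_expSubOneDiv.continuous.comp continuous_neg)
    have := h2.tendsto 0
    simpa [expSubOneDiv_zero] using this
  filter_upwards [h1.eventually (lt_mem_nhds one_pos)] with z hz hre
  have hz0 : z ≠ 0 := by
    rintro rfl
    simp at hre
  have h2 : 1 - exp (-z) = z * expSubOneDiv (-z) := by
    rw [expSubOneDiv_of_ne (neg_ne_zero.2 hz0)]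
    field_simp
    ring
  have h3 := abs_lt.1 (abs_arg_lt_pi_div_two_iff.2 (Or.inl hre))
  have h4 := abs_lt.1 (abs_arg_lt_pi_div_two_iff.2 (Or.inl hz))
  rw [h2, log_mul hz0 (by
    intro h
    simp [h] at hz)]
  constructor <;> linarith [h3.1, h3.2, h4.1, h4.2]

/-- Multiplied by `z`, the remainder is the Riemann sum minus its limit γ, minus the logarithm of a
function equal to 1 at the origin; both differences are O(z). -/
theorem lambertRemainder_isBigO_one {M : ℝ} (hM : 0 < M) :
    lambertRemainder =O[𝓝[closedSector M \ {0}] 0] fun _ => (1 : ℂ) := by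
  have h1 : (fun z => log (expSubOneDiv (-z))) =O[𝓝[closedSector M \ {0}] 0] fun z => z := by
    have h2 : DifferentiableAt ℂ (fun z => log (expSubOneDiv (-z))) 0 := by
      refine DifferentiableAt.clog ?_ ?_
      · exact (differentiable_expSubOneDiv.comp differentiable_neg).differentiableAt
      · simp [expSubOneDiv_zero]
    have := h2.isBigO_sub
    simp only [neg_zero, expSubOneDiv_zero, log_one, sub_zero] at this
    exact this.mono nhdsWithin_le_nhds
  have h2 := (isDerivTower_planckTower hM).isBigO_riemannSum_add hM 0
  have h3 := (h2.sub h1).mul (isBigO_refl (fun z : ℂ => z⁻¹) (𝓝[closedSector M \ {0}] 0))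
  refine h3.congr' ?_ ?_
  · filter_upwards [self_mem_nhdsWithin, nhdsWithin_le_nhds log_one_sub_exp_neg_eventually]
      with z hz hlog
    have hre := re_pos_of_mem_closedSector hM hz.1 hz.2
    rw [lambertRemainder, lambertSeries_eq hre, hlog hre]
    simp only [planckTower, planckPrimitive_zero]
    ring
  · filter_upwards [self_mem_nhdsWithin] with z hz
    exact mul_inv_cancel₀ hz.2

/-- At infinity the remainder is only as small as log z / z. Any decay exponent strictly between 1/2
and 1 makes the Mellin integrals on Re s = 1/2 converge; 3/4 is one choice. -/
theorem exists_lambertRemainder_bound {M : ℝ} (hM : 0 < M) :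
    ∃ C : ℝ, 0 < C ∧ ∀ z ∈ closedSector M, z ≠ 0 →
      ‖lambertRemainder z‖ ≤ C ∧ ‖lambertRemainder z‖ ≤ C * ‖z‖ ^ (-(3 / 4) : ℝ) := by
  obtain ⟨A, hA⟩ := (lambertRemainder_isBigO_one hM).bound
  rw [eventually_nhdsWithin_iff, Metric.eventually_nhds_iff] at hA
  obtain ⟨ε, hε, hA⟩ := hA
  set δ := min ε 1
  have hδ : 0 < δ := by positivity
  -- In the sector, ‖z‖ ≥ δ forces Re z ≥ δ / (1 + M), away from the boundary of the half-plane.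
  set a := δ / (1 + M)
  have ha : 0 < a := by positivity
  set E := (1 - Real.exp (-a))⁻¹ ^ 2 with hE
  have hE0 : 0 ≤ E := by positivity
  set B := E * (1 + M) + Real.eulerMascheroniConstant + |Real.log δ| + Real.pi with hB
  have hγ : 0 < Real.eulerMascheroniConstant :=
    one_half_pos.trans Real.one_half_lt_eulerMascheroniConstant
  have hB0 : 0 < B := by positivity
  set G := B * δ ^ (-(1 / 4) : ℝ) + 4 with hG
  have hG0 : 0 < G := by positivity
  refine ⟨max (max A G) (G * δ ^ (-(3 / 4) : ℝ)), by positivity, fun z hz hz0 => ?_⟩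
  have hnz : 0 < ‖z‖ := norm_pos_iff.2 hz0
  rcases lt_or_ge ‖z‖ δ with h | h
  · have h1 := hA (y := z) (by simpa using h.trans_le (min_le_left _ _)) ⟨hz, hz0⟩
    simp only [norm_one, mul_one] at h1
    have h2 : ‖lambertRemainder z‖ ≤ max (max A G) (G * δ ^ (-(3 / 4) : ℝ)) :=
      h1.trans ((le_max_left _ _).trans (le_max_left _ _))
    refine ⟨h2, h2.trans (le_mul_of_one_le_right ((norm_nonneg _).trans h2) ?_)⟩
    exact Real.one_le_rpow_of_pos_of_le_one_of_nonpos hnz (h.le.trans (min_le_right _ _))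
      (by norm_num)
  · have hre := norm_le_of_mem_closedSector hM hz
    have hare : a ≤ z.re := by
      rw [div_le_iff₀ (by positivity)]
      linarith
    have hre0 := ha.trans_le hare
    have h1 : ‖lambertSeries z‖ ≤ E * (1 + M) / ‖z‖ := by
      refine (norm_lambertSeries_le ha hare).trans ?_
      rw [← hE, mul_div_assoc]
      gcongr
      rw [Real.exp_neg, inv_le_comm₀ (Real.exp_pos _) (by positivity), inv_div,
        div_le_iff₀ (by positivity)]
      have := Real.add_one_le_exp z.re
      nlinarith
    have h2 : ‖log z‖ ≤ 4 * ‖z‖ ^ (1 / 4 : ℝ) + |Real.log δ| + Real.pi := by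
      refine (norm_le_abs_re_add_abs_im _).trans ?_
      rw [log_re, log_im]
      refine add_le_add (abs_le.2 ⟨?_, ?_⟩) (abs_arg_le_pi z)
      · have h3 := Real.log_le_log hδ h
        have h4 := neg_abs_le (Real.log δ)
        have h5 : 0 ≤ 4 * ‖z‖ ^ (1 / 4 : ℝ) := by positivity
        linarith
      · have h3 := Real.log_le_rpow_div hnz.le (by norm_num : (0 : ℝ) < 1 / 4)
        have h4 := abs_nonneg (Real.log δ)
        linarith
    have h3 : ‖lambertRemainder z‖ ≤ (B + 4 * ‖z‖ ^ (1 / 4 : ℝ)) / ‖z‖ := by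
      calc ‖lambertRemainder z‖ ≤ ‖lambertSeries z‖ +
            ‖((Real.eulerMascheroniConstant : ℂ) - log z) / z‖ := norm_sub_le _ _
        _ ≤ E * (1 + M) / ‖z‖ + (Real.eulerMascheroniConstant +
            (4 * ‖z‖ ^ (1 / 4 : ℝ) + |Real.log δ| + Real.pi)) / ‖z‖ := by
          rw [norm_div]
          gcongr
          refine (norm_sub_le _ _).trans (add_le_add ?_ h2)
          rw [norm_real, Real.norm_of_nonneg hγ.le]
        _ = _ := by
          rw [hB]
          ring
    have h4 : (B + 4 * ‖z‖ ^ (1 / 4 : ℝ)) / ‖z‖ ≤ G * ‖z‖ ^ (-(3 / 4) : ℝ) := by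
      have h5 : ‖z‖ ^ (1 / 4 : ℝ) / ‖z‖ = ‖z‖ ^ (-(3 / 4) : ℝ) := by
        rw [← Real.rpow_sub_one hnz.ne']
        norm_num
      have h6 : 1 ≤ δ ^ (-(1 / 4) : ℝ) * ‖z‖ ^ (1 / 4 : ℝ) := by
        rw [Real.rpow_neg hδ.le, ← div_eq_inv_mul, one_le_div (by positivity)]
        gcongr
      calc _ ≤ (B * (δ ^ (-(1 / 4) : ℝ) * ‖z‖ ^ (1 / 4 : ℝ)) + 4 * ‖z‖ ^ (1 / 4 : ℝ)) / ‖z‖ := by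
            gcongr
            exact le_mul_of_one_le_right hB0.le h6
        _ = G * (‖z‖ ^ (1 / 4 : ℝ) / ‖z‖) := by
            rw [hG]
            ring
        _ = _ := by rw [h5]
    constructor
    · refine (h3.trans h4).trans (le_trans ?_ (le_max_right _ _))
      gcongr ?_ * ?_
      exact Real.rpow_le_rpow_of_nonpos hδ h (by norm_num)
    · refine (h3.trans h4).trans ?_
      gcongr
      exact (le_max_right _ _).trans (le_max_left _ _)

/-! ### Mellin transforms of truncated powers and of the Lambert series -/

theorem locallyIntegrableOn_indicator_cpow (a : ℂ) {A : Set ℝ} (hA : MeasurableSet A) :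
    LocallyIntegrableOn (A.indicator fun t : ℝ => (t : ℂ) ^ a) (Set.Ioi 0) := by
  have h1 : LocallyIntegrableOn (fun t : ℝ => (t : ℂ) ^ a) (Set.Ioi 0) := by
    refine ContinuousOn.locallyIntegrableOn (fun t ht => ?_) measurableSet_Ioi
    exact (continuousAt_ofReal_cpow_const _ _ (Or.inr (ne_of_gt ht))).continuousWithinAt
  intro t ht
  obtain ⟨u, hu, hi⟩ := h1 t ht
  exact ⟨u, hu, hi.indicator hA⟩

/-- Obtained by differentiating the transform 1/(s + a) of the truncated power with respect to `s`.
-/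
theorem hasMellin_log_cpow_Ioc (a : ℂ) {s : ℂ} (hs : 0 < s.re + a.re) :
    HasMellin ((Set.Ioc 0 1).indicator fun t : ℝ => (Real.log t : ℂ) * (t : ℂ) ^ a) s
      (-1 / (s + a) ^ 2) := by
  -- The function vanishes beyond 1, so any exponent above Re s would serve.
  have htop : ((Set.Ioc 0 1).indicator fun t : ℝ => (t : ℂ) ^ a) =O[atTop]
      fun t : ℝ => t ^ (-(s.re + 1)) := by
    refine (isBigO_zero _ _).congr' ?_ EventuallyEq.rfl
    filter_upwards [eventually_gt_atTop 1] with t ht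
    exact (Set.indicator_of_notMem (fun h => absurd h.2 (not_le.2 ht)) _).symm
  have hbot : ((Set.Ioc 0 1).indicator fun t : ℝ => (t : ℂ) ^ a) =O[𝓝[>] 0]
      fun t : ℝ => t ^ (-(-a.re)) := by
    refine IsBigO.of_bound 1 ?_
    filter_upwards [self_mem_nhdsWithin] with t ht
    refine (norm_indicator_le_norm_self _ _).trans ?_
    rw [norm_cpow_eq_rpow_re_of_pos ht, neg_neg, one_mul]
    exact le_abs_self _
  obtain ⟨h1, h2⟩ := mellin_hasDerivAt_of_isBigO_rpow
    (locallyIntegrableOn_indicator_cpow a measurableSet_Ioc) htop (by linarith) hbot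
    (by linarith : -a.re < s.re)
  have hne : s + a ≠ 0 := by
    intro h
    have := congrArg re h
    simp at this
    linarith
  have h3 : HasDerivAt (fun z : ℂ => 1 / (z + a)) (-1 / (s + a) ^ 2) s := by
    have := ((hasDerivAt_id s).add_const a).inv hne
    simpa [one_div] using! this
  have h4 : (fun z : ℂ => 1 / (z + a)) =ᶠ[𝓝 s]
      mellin ((Set.Ioc 0 1).indicator fun t : ℝ => (t : ℂ) ^ a) := by
    have hopen : IsOpen {z : ℂ | 0 < z.re + a.re} := isOpen_lt continuous_const (by fun_prop)
    filter_upwards [hopen.mem_nhds hs] with z hz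
    exact (hasMellin_cpow_Ioc a hz).2.symm
  have h5 := (h3.congr_of_eventuallyEq h4.symm).unique h2
  have h6 : (fun t : ℝ => Real.log t • (Set.Ioc 0 1).indicator (fun t : ℝ => (t : ℂ) ^ a) t) =
      (Set.Ioc 0 1).indicator fun t : ℝ => (Real.log t : ℂ) * (t : ℂ) ^ a := by
    ext t
    by_cases ht : t ∈ Set.Ioc (0 : ℝ) 1 <;> simp [ht]
  rw [h6] at h1 h5
  exact ⟨h1, h5.symm⟩

theorem hasMellin_cpow_Ioi (a : ℂ) {s : ℂ} (hs : s.re + a.re < 0) :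
    HasMellin ((Set.Ioi 1).indicator fun t : ℝ => (t : ℂ) ^ a) s (-1 / (s + a)) := by
  have h1 : ∀ t ∈ Set.Ioi (1 : ℝ), (t : ℂ) ^ (s + a - 1) = (t : ℂ) ^ (s - 1) • (t : ℂ) ^ a := by
    intro t ht
    have ht0 : (t : ℂ) ≠ 0 := ofReal_ne_zero.2 (one_pos.trans ht).ne'
    rw [smul_eq_mul, ← cpow_add _ _ ht0]
    ring_nf
  have hre : (s + a - 1).re < -1 := by
    simp
    linarith
  have hsub : Set.Ioi (1 : ℝ) ∩ Set.Ioi 0 = Set.Ioi 1 :=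
    Set.inter_eq_left.2 (Set.Ioi_subset_Ioi zero_le_one)
  have h2 := integrableOn_Ioi_cpow_of_lt hre one_pos
  have h3 := integral_Ioi_cpow_of_lt hre one_pos
  rw [sub_add_cancel, ofReal_one, one_cpow] at h3
  rw [HasMellin, mellin, MellinConvergent]
  simp_rw [← Set.indicator_smul]
  rw [IntegrableOn, integrable_indicator_iff measurableSet_Ioi, integral_indicator measurableSet_Ioi,
    IntegrableOn, Measure.restrict_restrict measurableSet_Ioi, hsub, ← h3]
  exact ⟨(integrableOn_congr_fun h1 measurableSet_Ioi).1 h2,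
    (setIntegral_congr_fun measurableSet_Ioi h1).symm⟩

theorem hasMellin_log_cpow_Ioi (a : ℂ) {s : ℂ} (hs : s.re + a.re < 0) :
    HasMellin ((Set.Ioi 1).indicator fun t : ℝ => (Real.log t : ℂ) * (t : ℂ) ^ a) s
      (1 / (s + a) ^ 2) := by
  have hbot : ((Set.Ioi 1).indicator fun t : ℝ => (t : ℂ) ^ a) =O[𝓝[>] 0]
      fun t : ℝ => t ^ (-(s.re - 1)) := by
    refine (isBigO_zero _ _).congr' ?_ EventuallyEq.rfl
    filter_upwards [nhdsWithin_le_nhds (gt_mem_nhds one_pos)] with t ht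
    exact (Set.indicator_of_notMem (fun h => absurd h (not_lt.2 (le_of_lt ht))) _).symm
  have htop : ((Set.Ioi 1).indicator fun t : ℝ => (t : ℂ) ^ a) =O[atTop]
      fun t : ℝ => t ^ (-(-a.re)) := by
    refine IsBigO.of_bound 1 ?_
    filter_upwards [eventually_gt_atTop 0] with t ht
    refine (norm_indicator_le_norm_self _ _).trans ?_
    rw [norm_cpow_eq_rpow_re_of_pos ht, neg_neg, one_mul]
    exact le_abs_self _
  obtain ⟨h1, h2⟩ := mellin_hasDerivAt_of_isBigO_rpow
    (locallyIntegrableOn_indicator_cpow a measurableSet_Ioi) htop (by linarith) hbot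
    (by linarith : s.re - 1 < s.re)
  have hne : s + a ≠ 0 := by
    intro h
    have := congrArg re h
    simp at this
    linarith
  have h3 : HasDerivAt (fun z : ℂ => -1 / (z + a)) (1 / (s + a) ^ 2) s := by
    have := (((hasDerivAt_id s).add_const a).inv hne).neg
    refine (this.congr_deriv ?_).congr_of_eventuallyEq (Eventually.of_forall fun z => ?_)
    · simp [neg_div]
    · simp [neg_div]
  have h4 : (fun z : ℂ => -1 / (z + a)) =ᶠ[𝓝 s]
      mellin ((Set.Ioi 1).indicator fun t : ℝ => (t : ℂ) ^ a) := by
    have hopen : IsOpen {z : ℂ | z.re + a.re < 0} := isOpen_lt (by fun_prop) continuous_const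
    filter_upwards [hopen.mem_nhds hs] with z hz
    exact (hasMellin_cpow_Ioi a hz).2.symm
  have h5 := (h3.congr_of_eventuallyEq h4.symm).unique h2
  have h6 : (fun t : ℝ => Real.log t • (Set.Ioi 1).indicator (fun t : ℝ => (t : ℂ) ^ a) t) =
      (Set.Ioi 1).indicator fun t : ℝ => (Real.log t : ℂ) * (t : ℂ) ^ a := by
    ext t
    by_cases ht : t ∈ Set.Ioi (1 : ℝ) <;> simp [ht]
  rw [h6] at h1 h5
  exact ⟨h1, h5.symm⟩

theorem hasSum_lambertSeries {t : ℝ} (ht : 0 < t) :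
    HasSum (fun i : ℕ × ℕ => (1 : ℂ) * Real.exp (-((i.1 + 1 : ℝ) * (i.2 + 1)) * t))
      (lambertSeries t) := by
  have h1 : Summable fun n : ℕ => Real.exp (-(n * t)) := (hasSum_exp_neg_nat_mul ht).summable
  have h2 : Summable fun i : ℕ × ℕ => (1 : ℂ) * Real.exp (-((i.1 + 1 : ℝ) * (i.2 + 1)) * t) := by
    refine Summable.of_norm_bounded (h1.mul_of_nonneg h1 (fun _ => (Real.exp_pos _).le)
      (fun _ => (Real.exp_pos _).le)) fun i => ?_
    rw [one_mul, norm_real, Real.norm_of_nonneg (Real.exp_pos _).le, ← Real.exp_add]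
    refine Real.exp_le_exp.2 ?_
    have h3 : (0 : ℝ) ≤ i.1 := Nat.cast_nonneg _
    have h4 : (0 : ℝ) ≤ i.2 := Nat.cast_nonneg _
    nlinarith [mul_nonneg (mul_nonneg h3 h4) ht.le]
  have h3 := h2.hasSum
  rw [h2.tsum_prod] at h3
  convert h3 using 1
  rw [lambertSeries]
  congr 1
  ext n
  have h4 := hasSum_exp_neg_geometric (t := (n + 1) * t) (by positivity)
  have h5 := h4.tsum_eq
  push_cast at h5 ⊢
  rw [← h5]
  congr 1
  ext m
  rw [one_mul]
  ring_nf

/-- Termwise integration of the double series ∑ e^(-mnt) gives Γ(s) ∑ (mn)^(-s), a product of two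
zeta series. -/
theorem mellin_lambertSeries {s : ℂ} (hs : 1 < s.re) :
    mellin (fun t : ℝ => lambertSeries t) s = Gamma s * riemannZeta s ^ 2 := by
  have hs0 : 0 < s.re := one_pos.trans hs
  have hsum1 : Summable fun n : ℕ => 1 / ((n : ℝ) + 1) ^ s.re := by
    have := (summable_nat_add_iff 1 (f := fun n : ℕ => 1 / (n : ℝ) ^ s.re)).2
      (Real.summable_one_div_nat_rpow.2 hs)
    simpa using this
  have h1 := hasSum_mellin (ι := ℕ × ℕ) (a := fun _ => 1)
    (p := fun i => (i.1 + 1 : ℝ) * (i.2 + 1)) (F := fun t : ℝ => lambertSeries t) (s := s)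
    (fun n => Or.inr (by positivity)) hs0 (fun t ht => hasSum_lambertSeries ht) (by
      refine (hsum1.mul_of_nonneg hsum1 (fun _ => by positivity)
        (fun _ => by positivity)).congr fun i => ?_
      rw [norm_one, Real.mul_rpow (by positivity) (by positivity)]
      field_simp)
  have hsum2 : Summable fun n : ℕ => ‖1 / ((n : ℂ) + 1) ^ s‖ := by
    refine hsum1.congr fun n => ?_
    rw [norm_div, norm_one]
    have := norm_cpow_eq_rpow_re_of_pos (by positivity : (0 : ℝ) < n + 1) s
    push_cast at this
    rw [this]
  rw [← h1.tsum_eq, zeta_eq_tsum_one_div_nat_add_one_cpow hs, sq,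
    tsum_mul_tsum_of_summable_norm hsum2 hsum2, ← tsum_mul_left]
  congr 1
  ext i
  have := mul_cpow_ofReal_nonneg (by positivity : (0 : ℝ) ≤ i.1 + 1)
    (by positivity : (0 : ℝ) ≤ i.2 + 1) s
  push_cast at this ⊢
  rw [this]
  field_simp

theorem lambertRemainder_ofReal_isBigO :
    (fun t : ℝ => lambertRemainder t) =O[𝓝[>] 0] fun t : ℝ => t ^ (-(0 : ℝ)) := by
  obtain ⟨C, hC0, hC⟩ := exists_lambertRemainder_bound one_pos
  refine IsBigO.of_bound C ?_
  filter_upwards [self_mem_nhdsWithin] with t ht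
  have ht' : (0 : ℝ) < t := ht
  have hmem : (t : ℂ) ∈ closedSector 1 := by simpa [closedSector] using ht'.le
  simpa using (hC _ hmem (ofReal_ne_zero.2 ht'.ne')).1

/-- The singular part of the Lambert series, cut off at `1`. -/
noncomputable def lambertCutoff : ℝ → ℂ := fun t =>
  (Real.eulerMascheroniConstant : ℂ) • (Set.Ioc 0 1).indicator (fun t : ℝ => (t : ℂ) ^ (-1 : ℂ)) t -
    (Set.Ioc 0 1).indicator (fun t : ℝ => (Real.log t : ℂ) * (t : ℂ) ^ (-1 : ℂ)) t

theorem hasMellin_lambertCutoff {s : ℂ} (hs : 1 < s.re) :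
    HasMellin lambertCutoff s (Real.eulerMascheroniConstant / (s - 1) + 1 / (s - 1) ^ 2) := by
  have hs' : 0 < s.re + (-1 : ℂ).re := by simpa using hs
  have h1 := hasMellin_cpow_Ioc (-1) hs'
  have h2 := hasMellin_log_cpow_Ioc (-1) hs'
  have h3 := hasMellin_const_smul h1.1 (Real.eulerMascheroniConstant : ℂ)
  have h4 := hasMellin_sub h3.1 h2.1
  rw [h3.2, h1.2, h2.2] at h4
  refine ⟨h4.1, h4.2.trans ?_⟩
  rw [smul_eq_mul, ← sub_eq_add_neg]
  ring

theorem lambertSeries_sub_cutoff_of_le {t : ℝ} (ht : t ∈ Set.Ioc (0 : ℝ) 1) :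
    lambertSeries t - lambertCutoff t = lambertRemainder t := by
  rw [lambertCutoff, lambertRemainder, Set.indicator_of_mem ht, Set.indicator_of_mem ht,
    cpow_neg_one, ofReal_log ht.1.le, smul_eq_mul]
  ring

theorem lambertSeries_sub_cutoff_of_gt {t : ℝ} (ht : 1 < t) :
    lambertSeries t - lambertCutoff t = lambertSeries t := by
  have : t ∉ Set.Ioc (0 : ℝ) 1 := fun h => absurd h.2 (not_le.2 ht)
  rw [lambertCutoff, Set.indicator_of_notMem this, Set.indicator_of_notMem this]
  simp

theorem mellin_lambertSeries_sub_cutoff {s : ℂ} (hs : 0 < s.re) :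
    MellinConvergent (fun t : ℝ => lambertSeries t - lambertCutoff t) s ∧
      DifferentiableAt ℂ (mellin fun t : ℝ => lambertSeries t - lambertCutoff t) s := by
  have h1 : LocallyIntegrableOn (fun t : ℝ => lambertSeries t - lambertCutoff t) (Set.Ioi 0) := by
    refine LocallyIntegrableOn.sub ?_ (LocallyIntegrableOn.sub ?_ ?_)
    · refine ContinuousOn.locallyIntegrableOn (fun t ht => ?_) measurableSet_Ioi
      have h2 : 0 < (t : ℂ).re := by simpa using ht
      have h3 := (differentiableOn_lambertSeries.differentiableAt
        ((isOpen_lt continuous_const continuous_re).mem_nhds h2)).continuousAt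
      exact (ContinuousAt.comp (f := fun t : ℝ => (t : ℂ)) (x := t) h3
        continuous_ofReal.continuousAt).continuousWithinAt
    · intro t ht
      obtain ⟨u, hu, hi⟩ := locallyIntegrableOn_indicator_cpow (-1) measurableSet_Ioc t ht
      exact ⟨u, hu, Integrable.const_mul hi (Real.eulerMascheroniConstant : ℂ)⟩
    · have h2 : ContinuousOn (fun t : ℝ => (Real.log t : ℂ) * (t : ℂ) ^ (-1 : ℂ)) (Set.Ioi 0) := by
        intro t ht
        refine ContinuousAt.continuousWithinAt (ContinuousAt.mul ?_
          (continuousAt_ofReal_cpow_const _ _ (Or.inr (ne_of_gt ht))))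
        exact continuous_ofReal.continuousAt.comp (Real.continuousAt_log (ne_of_gt ht))
      have h3 : LocallyIntegrableOn (fun t : ℝ => (Real.log t : ℂ) * (t : ℂ) ^ (-1 : ℂ))
          (Set.Ioi 0) := h2.locallyIntegrableOn measurableSet_Ioi
      intro t ht
      obtain ⟨u, hu, hi⟩ := h3 t ht
      exact ⟨u, hu, hi.indicator measurableSet_Ioc⟩
  have h2 : (fun t : ℝ => lambertSeries t - lambertCutoff t) =O[atTop]
      fun t : ℝ => Real.exp (-1 * t) := by
    refine IsBigO.of_bound ((1 - Real.exp (-1))⁻¹ ^ 2) ?_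
    filter_upwards [eventually_gt_atTop 1] with t ht
    rw [lambertSeries_sub_cutoff_of_gt ht, Real.norm_of_nonneg (Real.exp_pos _).le]
    have := norm_lambertSeries_le one_pos (z := (t : ℂ)) (by simpa using ht.le)
    simpa using this
  have h3 : (fun t : ℝ => lambertSeries t - lambertCutoff t) =O[𝓝[>] 0]
      fun t : ℝ => t ^ (-(0 : ℝ)) := by
    refine lambertRemainder_ofReal_isBigO.congr' ?_ EventuallyEq.rfl
    filter_upwards [Ioc_mem_nhdsGT one_pos] with t ht
    exact (lambertSeries_sub_cutoff_of_le ht).symm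
  exact ⟨mellinConvergent_of_isBigO_rpow_exp one_pos h1 h2 h3 hs,
    mellin_differentiableAt_of_isBigO_rpow_exp one_pos h1 h2 h3 hs⟩

theorem differentiable_update_sub_one_mul_riemannZeta :
    Differentiable ℂ (Function.update (fun s => (s - 1) * riemannZeta s) 1 1) := by
  have h1 : ∀ s : ℂ, s ≠ 1 →
      DifferentiableAt ℂ (Function.update (fun s => (s - 1) * riemannZeta s) 1 1) s := by
    intro s hs
    have h2 : DifferentiableAt ℂ (fun s => (s - 1) * riemannZeta s) s :=
      (by fun_prop : DifferentiableAt ℂ (fun s : ℂ => s - 1) s).mul (differentiableAt_riemannZeta hs)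
    refine h2.congr_of_eventuallyEq ?_
    filter_upwards [isOpen_ne.mem_nhds hs] with z hz
    exact Function.update_of_ne hz _ _
  intro s
  by_cases hs : s = 1
  · subst hs
    refine (analyticAt_of_differentiable_on_punctured_nhds_of_continuousAt ?_ ?_).differentiableAt
    · filter_upwards [self_mem_nhdsWithin] with z hz using h1 z hz
    · exact continuousAt_update_same.2 riemannZeta_residue_one
  · exact h1 s hs

/-- Multiplied by (s - 1)², both sides are analytic for Re s > 0; they agree near 2, hence on the
whole half-plane. -/
theorem mellin_lambertSeries_sub_cutoff_eq {s : ℂ} (hs : 0 < s.re) (hs1 : s ≠ 1) :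
    mellin (fun t : ℝ => lambertSeries t - lambertCutoff t) s =
      Gamma s * riemannZeta s ^ 2 - (Real.eulerMascheroniConstant / (s - 1) + 1 / (s - 1) ^ 2) := by
  set U : Set ℂ := {s | 0 < s.re}
  have hU : IsOpen U := isOpen_lt continuous_const continuous_re
  have hUc : IsPreconnected U := (convex_halfSpace_re_gt 0).isPreconnected
  set f : ℂ → ℂ := fun s => (s - 1) ^ 2 * mellin (fun t : ℝ => lambertSeries t - lambertCutoff t) s +
    Real.eulerMascheroniConstant * (s - 1) + 1
  set g : ℂ → ℂ := fun s =>
    Gamma s * (Function.update (fun s => (s - 1) * riemannZeta s) 1 1 s) ^ 2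
  have hf : AnalyticOnNhd ℂ f U := by
    refine DifferentiableOn.analyticOnNhd (fun z hz => ?_) hU
    refine DifferentiableAt.differentiableWithinAt ?_
    have := (mellin_lambertSeries_sub_cutoff hz).2
    fun_prop
  have hg : AnalyticOnNhd ℂ g U := by
    refine DifferentiableOn.analyticOnNhd (fun z hz => ?_) hU
    refine DifferentiableAt.differentiableWithinAt (DifferentiableAt.mul ?_
      ((differentiable_update_sub_one_mul_riemannZeta z).pow 2))
    refine differentiableAt_Gamma z fun m h => ?_
    have hz' : 0 < z.re := hz
    rw [h] at hz'
    simp at hz'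
    have : (0 : ℝ) ≤ m := m.cast_nonneg
    linarith
  have h2 : f =ᶠ[𝓝 2] g := by
    have : {s : ℂ | 1 < s.re} ∈ 𝓝 (2 : ℂ) :=
      (isOpen_lt continuous_const continuous_re).mem_nhds (by norm_num)
    filter_upwards [this] with z hz
    have hz1 : 1 < z.re := hz
    have hne : z ≠ 1 := by
      rintro rfl
      simp at hz1
    have hne' : z - 1 ≠ 0 := sub_ne_zero.2 hne
    have h3 := hasMellin_add (mellin_lambertSeries_sub_cutoff (one_pos.trans hz1)).1
      (hasMellin_lambertCutoff hz1).1
    simp only [sub_add_cancel] at h3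
    have h4 := h3.2
    rw [mellin_lambertSeries hz1, (hasMellin_lambertCutoff hz1).2] at h4
    simp only [f, g, Function.update_of_ne hne]
    rw [← sub_eq_iff_eq_add] at h4
    rw [← h4]
    field_simp
    ring
  have h3 := hf.eqOn_of_preconnected_of_eventuallyEq hg hUc
    (show (2 : ℂ) ∈ U by simp [U]) h2 (show s ∈ U from hs)
  simp only [f, g, Function.update_of_ne hs1] at h3
  have hne' : s - 1 ≠ 0 := sub_ne_zero.2 hs1
  field_simp
  linear_combination h3

/-- The singular part on (0, 1] and its negative on (1, ∞) have the same rational Mellin transform,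
the first for Re s > 1 and the second for Re s < 1. Subtracting the singular part on all of (0, ∞)
therefore leaves Γ ζ² unchanged in the strip. -/
theorem mellin_lambertRemainder {s : ℂ} (hs : 0 < s.re) (hs1 : s.re < 1) :
    mellin (fun t : ℝ => lambertRemainder t) s = Gamma s * riemannZeta s ^ 2 := by
  have hne : s ≠ 1 := by
    rintro rfl
    simp at hs1
  have hs' : s.re + (-1 : ℂ).re < 0 := by
    simp
    linarith
  have h1 := hasMellin_cpow_Ioi (-1) hs'
  have h2 := hasMellin_log_cpow_Ioi (-1) hs'
  have h3 := hasMellin_const_smul h1.1 (Real.eulerMascheroniConstant : ℂ)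
  have h4 := hasMellin_sub h3.1 h2.1
  rw [h3.2, h1.2, h2.2] at h4
  have h5 := hasMellin_sub (mellin_lambertSeries_sub_cutoff hs).1 h4.1
  rw [h4.2, mellin_lambertSeries_sub_cutoff_eq hs hne] at h5
  have h6 : Gamma s * riemannZeta s ^ 2 = Gamma s * riemannZeta s ^ 2 -
      (Real.eulerMascheroniConstant / (s - 1) + 1 / (s - 1) ^ 2) -
      ((Real.eulerMascheroniConstant : ℂ) • (-1 / (s + -1)) - 1 / (s + -1) ^ 2) := by
    rw [smul_eq_mul, ← sub_eq_add_neg]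
    ring
  rw [h6, ← h5.2]
  refine setIntegral_congr_fun measurableSet_Ioi fun t ht => ?_
  have ht' : (0 : ℝ) < t := ht
  simp only
  congr 1
  rcases le_or_gt t 1 with h | h
  · have : t ∉ Set.Ioi (1 : ℝ) := not_lt.2 h
    rw [lambertSeries_sub_cutoff_of_le ⟨ht', h⟩, Set.indicator_of_notMem this,
      Set.indicator_of_notMem this]
    simp
  · have : t ∈ Set.Ioi (1 : ℝ) := h
    rw [lambertSeries_sub_cutoff_of_gt h, Set.indicator_of_mem this, Set.indicator_of_mem this,
      cpow_neg_one, ofReal_log ht'.le, lambertRemainder, smul_eq_mul]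
    ring

/-! ### Rotation of the ray in the Mellin integral -/

theorem integrable_exp_neg_mul_abs {c : ℝ} (hc : 0 < c) :
    Integrable fun x : ℝ => Real.exp (-(c * |x|)) := by
  rw [← integrableOn_univ, ← Set.Iic_union_Ioi (a := (0 : ℝ))]
  refine IntegrableOn.union ?_ ?_
  · refine (integrableOn_congr_fun (fun x hx => ?_) measurableSet_Iic).1
      (integrableOn_exp_mul_Iic hc 0)
    rw [abs_of_nonpos hx]
    ring_nf
  · refine (integrableOn_congr_fun (fun x hx => ?_) measurableSet_Ioi).1
      (integrableOn_exp_mul_Ioi (neg_lt_zero.2 hc) 0)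
    rw [abs_of_pos hx]
    ring_nf

/-- An integrable majorant for the rotated Mellin integrals on the critical line. -/
noncomputable def rotationMajorant (C r : ℝ) (t : ℝ) : ℝ :=
  t ^ ((1 / 2 : ℝ) - 1) * min C (C * (r * t) ^ (-(3 / 4) : ℝ))

theorem integrableOn_rotationMajorant {C r : ℝ} (hC : 0 < C) (hr : 0 < r) :
    IntegrableOn (rotationMajorant C r) (Set.Ioi 0) := by
  have h1 : ContinuousOn (fun t : ℝ => min C (C * (r * t) ^ (-(3 / 4) : ℝ))) (Set.Ioi 0) := by
    refine continuousOn_const.inf (continuousOn_const.mul ?_)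
    refine ContinuousOn.rpow_const (by fun_prop) fun t ht => Or.inl ?_
    exact (mul_pos hr ht).ne'
  refine mellin_convergent_of_isBigO_scalar (a := 3 / 4) (b := 0)
    (h1.locallyIntegrableOn measurableSet_Ioi) ?_ (by norm_num) ?_ (by norm_num)
  · refine IsBigO.of_bound (C * r ^ (-(3 / 4) : ℝ)) ?_
    filter_upwards [eventually_gt_atTop 0] with t ht
    rw [Real.norm_of_nonneg (by positivity), Real.norm_of_nonneg (by positivity)]
    refine (min_le_right _ _).trans_eq ?_
    rw [Real.mul_rpow hr.le ht.le, mul_assoc]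
  · refine IsBigO.of_bound C ?_
    filter_upwards [self_mem_nhdsWithin] with t ht
    have ht' : (0 : ℝ) < t := ht
    rw [Real.norm_of_nonneg (by positivity)]
    simp

theorem norm_mellinIntegrand_le {M C r : ℝ}
    (hC : 0 < C) (hφ : ∀ z ∈ closedSector M, z ≠ 0 →
      ‖lambertRemainder z‖ ≤ C ∧ ‖lambertRemainder z‖ ≤ C * ‖z‖ ^ (-(3 / 4) : ℝ))
    (hr : 0 < r) {a : ℂ} (ha : a ∈ closedSector M) (har : r ≤ ‖a‖) {s : ℂ} (hs : s.re = 1 / 2)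
    {t : ℝ} (ht : 0 < t) :
    ‖(t : ℂ) ^ (s - 1) • lambertRemainder (a * t)‖ ≤ rotationMajorant C r t := by
  have ha0 : a ≠ 0 := norm_pos_iff.1 (hr.trans_le har)
  have hmem : a * t ∈ closedSector M := by
    rw [mul_comm]
    exact mul_mem_closedSector ha ht.le
  obtain ⟨h1, h2⟩ := hφ _ hmem (mul_ne_zero ha0 (ofReal_ne_zero.2 ht.ne'))
  rw [norm_smul, norm_cpow_eq_rpow_re_of_pos ht, sub_re, hs, one_re, rotationMajorant]
  gcongr
  refine le_min h1 (h2.trans ?_)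
  rw [norm_mul, norm_real, Real.norm_of_nonneg ht.le]
  gcongr ?_ * ?_
  exact Real.rpow_le_rpow_of_nonpos (by positivity) (by gcongr) (by norm_num)

theorem continuousOn_mellinIntegrand {a : ℂ} (ha : 0 < a.re) (s : ℂ) :
    ContinuousOn (fun t : ℝ => (t : ℂ) ^ (s - 1) • lambertRemainder (a * t)) (Set.Ioi 0) := by
  intro t ht
  have ht' : (0 : ℝ) < t := ht
  refine ContinuousAt.continuousWithinAt (ContinuousAt.smul
    (continuousAt_ofReal_cpow_const _ _ (Or.inr ht'.ne')) ?_)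
  have h1 : 0 < (a * t).re := by
    simp
    positivity
  exact ContinuousAt.comp (f := fun t : ℝ => a * (t : ℂ)) (x := t)
    (differentiableAt_lambertRemainder h1).continuousAt (by fun_prop)

theorem mellinConvergent_rotate {a : ℂ} (ha : 0 < a.re) {s : ℂ} (hs : s.re = 1 / 2) :
    MellinConvergent (fun t : ℝ => lambertRemainder (a * t)) s := by
  obtain ⟨M, hM, haM⟩ := exists_mem_closedSector ha
  obtain ⟨C, hC0, hC⟩ := exists_lambertRemainder_bound hM
  have hna : 0 < ‖a‖ := ha.trans_le (re_le_norm a)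
  refine Integrable.mono' (integrableOn_rotationMajorant hC0 hna)
    ((continuousOn_mellinIntegrand ha s).aestronglyMeasurable measurableSet_Ioi) ?_
  filter_upwards [ae_restrict_mem measurableSet_Ioi] with t ht
  exact norm_mellinIntegrand_le hC0 hC hna haM le_rfl hs ht

theorem differentiableAt_mellin_rotate {a₀ : ℂ} (ha₀ : 0 < a₀.re) {s : ℂ} (hs : s.re = 1 / 2) :
    DifferentiableAt ℂ (fun a => mellin (fun t : ℝ => lambertRemainder (a * t)) s) a₀ := by
  set r := a₀.re / 2
  have hr : 0 < r := half_pos ha₀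
  set M := (|a₀.im| + r) / r
  have hM : 0 < M := by positivity
  obtain ⟨C, hC0, hC⟩ := exists_lambertRemainder_bound hM
  have hball : ∀ a ∈ Metric.ball a₀ r, r < a.re ∧ a ∈ closedSector M := by
    intro a ha
    rw [mem_ball_iff_norm] at ha
    have h1 : |a.re - a₀.re| < r := by simpa using (abs_re_le_norm (a - a₀)).trans_lt ha
    have h2 : |a.im - a₀.im| < r := by simpa using (abs_im_le_norm (a - a₀)).trans_lt ha
    have h3 : r < a.re := by
      have := (abs_lt.1 h1).1
      have h4 : a₀.re = r + r := (add_halves _).symm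
      linarith
    refine ⟨h3, ?_⟩
    have h4 : |a.im| ≤ |a₀.im| + |a.im - a₀.im| := by
      have := abs_add_le a₀.im (a.im - a₀.im)
      simpa using this
    calc |a.im| ≤ |a₀.im| + r := by linarith
      _ = M * r := by
        simp only [M]
        field_simp
      _ ≤ M * a.re := by gcongr
  refine (hasDerivAt_integral_of_dominated (μ := volume.restrict (Set.Ioi (0 : ℝ)))
    (F := fun a (t : ℝ) => (t : ℂ) ^ (s - 1) • lambertRemainder (a * t)) hr
    (fun a ha => (continuousOn_mellinIntegrand (hr.trans (hball a ha).1) s).aestronglyMeasurable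
      measurableSet_Ioi) ?_ ?_ (integrableOn_rotationMajorant hC0 hr)).2.differentiableAt
  · filter_upwards [ae_restrict_mem measurableSet_Ioi] with t ht a ha
    have ht' : (0 : ℝ) < t := ht
    have h1 : 0 < (a * t).re := by
      have := hr.trans (hball a ha).1
      simp
      positivity
    have h2 : DifferentiableAt ℂ (fun a : ℂ => lambertRemainder (a * t)) a :=
      DifferentiableAt.comp (f := fun a : ℂ => a * t) a (differentiableAt_lambertRemainder h1)
        (by fun_prop)
    exact (h2.const_mul ((t : ℂ) ^ (s - 1))).differentiableWithinAt
  · filter_upwards [ae_restrict_mem measurableSet_Ioi] with t ht a ha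
    exact norm_mellinIntegrand_le hC0 hC hr (hball a ha).2
      ((hball a ha).1.le.trans (re_le_norm a)) hs ht

/-- Both sides are analytic in `a` on the right half-plane, and for real `a > 0` the identity is a
change of variables. -/
theorem mellin_rotate {a : ℂ} (ha : 0 < a.re) {s : ℂ} (hs : s.re = 1 / 2) :
    mellin (fun t : ℝ => lambertRemainder (a * t)) s =
      a ^ (-s) * (Gamma s * riemannZeta s ^ 2) := by
  set U : Set ℂ := {s | 0 < s.re}
  have hU : IsOpen U := isOpen_lt continuous_const continuous_re
  have hUc : IsPreconnected U := (convex_halfSpace_re_gt 0).isPreconnected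
  have hf : AnalyticOnNhd ℂ (fun a => mellin (fun t : ℝ => lambertRemainder (a * t)) s) U :=
    DifferentiableOn.analyticOnNhd (fun z hz =>
      (differentiableAt_mellin_rotate hz hs).differentiableWithinAt) hU
  have hg : AnalyticOnNhd ℂ (fun a : ℂ => a ^ (-s) * (Gamma s * riemannZeta s ^ 2)) U := by
    refine DifferentiableOn.analyticOnNhd (fun z hz => ?_) hU
    refine DifferentiableAt.differentiableWithinAt (DifferentiableAt.mul_const ?_ _)
    exact differentiableAt_id.cpow_const (Or.inl hz)
  refine hf.eqOn_of_preconnected_of_frequently_eq hg hUc (show (1 : ℂ) ∈ U by simp [U]) ?_ ha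
  -- Real points accumulating at 1 are enough for the identity theorem.
  have h1 : Tendsto (fun n : ℕ => 1 + ((1 / ((n : ℝ) + 1) : ℝ) : ℂ)) atTop (𝓝[≠] 1) := by
    rw [tendsto_nhdsWithin_iff]
    constructor
    · have h2 := (continuous_ofReal.tendsto 0).comp (tendsto_one_div_add_atTop_nhds_zero_nat (𝕜 := ℝ))
      simpa using h2.const_add 1
    · refine Eventually.of_forall fun n => ?_
      have : ((1 / ((n : ℝ) + 1) : ℝ) : ℂ) ≠ 0 := ofReal_ne_zero.2 (by positivity)
      simpa only [Set.mem_compl_iff, Set.mem_singleton_iff, add_eq_left] using this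
  refine h1.frequently (Frequently.of_forall fun n => ?_)
  have hb : (0 : ℝ) < 1 + 1 / ((n : ℝ) + 1) := by positivity
  have h2 := mellin_comp_mul_left (fun t : ℝ => lambertRemainder t) s hb
  rw [mellin_lambertRemainder (by rw [hs]; norm_num) (by rw [hs]; norm_num), smul_eq_mul] at h2
  rw [show (1 : ℂ) + ((1 / ((n : ℝ) + 1) : ℝ) : ℂ) = ((1 + 1 / ((n : ℝ) + 1) : ℝ) : ℂ) by push_cast; ring, ← h2]
  simp only [ofReal_mul]

/-! ### Decay of Γ ζ², the functional equation and growth of |ζ|² -/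

/-- `Γ(s) ζ(s)²` on the critical line. -/
noncomputable def gammaZetaSq (y : ℝ) : ℂ :=
  Gamma (1 / 2 + I * y) * riemannZeta (1 / 2 + I * y) ^ 2

/-- `|ζ(1/2 + iy)|²`. -/
noncomputable def zetaNormSq (y : ℝ) : ℝ := ‖riemannZeta (1 / 2 + I * y)‖ ^ 2

theorem critical_ne_one (y : ℝ) : (1 / 2 + I * y : ℂ) ≠ 1 := by
  intro h
  have := congrArg re h
  simp at this

theorem critical_ne_neg_nat (y : ℝ) (n : ℕ) : (1 / 2 + I * y : ℂ) ≠ -n := by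
  intro h
  have := congrArg re h
  simp at this
  have h2 : (0 : ℝ) ≤ n := n.cast_nonneg
  linarith

theorem continuous_riemannZeta_critical :
    Continuous fun y : ℝ => riemannZeta (1 / 2 + I * y) := by
  refine continuous_iff_continuousAt.2 fun y => ?_
  exact ContinuousAt.comp (f := fun y : ℝ => (1 / 2 + I * y : ℂ)) (x := y)
    (differentiableAt_riemannZeta (critical_ne_one y)).continuousAt (by fun_prop)

theorem continuous_zetaNormSq : Continuous zetaNormSq :=
  continuous_riemannZeta_critical.norm.pow 2

theorem continuous_gammaZetaSq : Continuous gammaZetaSq := by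
  refine Continuous.mul ?_ (continuous_riemannZeta_critical.pow 2)
  refine continuous_iff_continuousAt.2 fun y => ?_
  exact ContinuousAt.comp (f := fun y : ℝ => (1 / 2 + I * y : ℂ)) (x := y)
    (differentiableAt_Gamma _ (critical_ne_neg_nat y)).continuousAt (by fun_prop)

theorem exp_I_mul_re_pos {α : ℝ} (hα : |α| < Real.pi / 2) : 0 < (exp (I * α)).re := by
  rw [exp_re]
  simp
  exact Real.cos_pos_of_mem_Ioo ⟨(abs_lt.1 hα).1, (abs_lt.1 hα).2⟩

theorem exp_I_mul_cpow {α : ℝ} (hα : |α| < Real.pi / 2) (s : ℂ) :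
    exp (I * α) ^ s = exp (I * α * s) := by
  rw [cpow_def_of_ne_zero (exp_ne_zero _), log_exp]
  · have := (abs_lt.1 hα).1
    simp
    linarith [Real.pi_pos]
  · have := (abs_lt.1 hα).2
    simp
    linarith [Real.pi_pos]

/-- For a = e^(iα) the factor a^(-s) has modulus e^(αy) on the critical line, while the rotated
Mellin integral is bounded uniformly in `y`. Decay of Γ ζ² at every rate below π/2 follows without
Stirling's formula or convexity bounds. -/
theorem exists_gammaZetaSq_mul_exp_le {α : ℝ} (hα : |α| < Real.pi / 2) :
    ∃ C : ℝ, ∀ y : ℝ, ‖gammaZetaSq y‖ * Real.exp (α * y) ≤ C := by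
  have ha := exp_I_mul_re_pos hα
  refine ⟨∫ t in Set.Ioi (0 : ℝ), t ^ ((1 / 2 : ℝ) - 1) * ‖lambertRemainder (exp (I * α) * t)‖,
    fun y => ?_⟩
  have hs : (1 / 2 + I * y : ℂ).re = 1 / 2 := by simp
  have h1 := mellin_rotate ha hs
  have h2 : ‖gammaZetaSq y‖ * Real.exp (α * y) =
      ‖mellin (fun t : ℝ => lambertRemainder (exp (I * α) * t)) (1 / 2 + I * y)‖ := by
    rw [h1, norm_mul, mul_comm, exp_I_mul_cpow hα, norm_exp, gammaZetaSq]
    congr 2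
    simp
  rw [h2, mellin]
  refine (norm_integral_le_integral_norm _).trans_eq ?_
  refine setIntegral_congr_fun measurableSet_Ioi fun t ht => ?_
  rw [norm_smul, norm_cpow_eq_rpow_re_of_pos ht, sub_re, hs, one_re]

theorem exists_gammaZetaSq_le {α : ℝ} (hα0 : 0 ≤ α) (hα : α < Real.pi / 2) :
    ∃ C : ℝ, 0 < C ∧ ∀ y : ℝ, ‖gammaZetaSq y‖ ≤ C * Real.exp (-(α * |y|)) := by
  obtain ⟨C₁, h₁⟩ := exists_gammaZetaSq_mul_exp_le (α := α) (by rwa [abs_of_nonneg hα0])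
  obtain ⟨C₂, h₂⟩ := exists_gammaZetaSq_mul_exp_le (α := -α) (by rwa [abs_neg, abs_of_nonneg hα0])
  refine ⟨max (max C₁ C₂) 1, by positivity, fun y => ?_⟩
  rw [Real.exp_neg, ← div_eq_mul_inv, le_div_iff₀ (Real.exp_pos _)]
  rcases le_total 0 y with h | h
  · rw [abs_of_nonneg h]
    exact (h₁ y).trans ((le_max_left _ _).trans (le_max_left _ _))
  · rw [abs_of_nonpos h, mul_neg, ← neg_mul]
    exact (h₂ y).trans ((le_max_right _ _).trans (le_max_left _ _))

theorem one_add_I_mul_exp_ne_zero (x : ℝ) : (1 + I * Real.exp x : ℂ) ≠ 0 := by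
  intro h
  have := congrArg re h
  simp at this

/-- The functional equation of `ζ` on the critical line. -/
theorem zetaNormSq_eq (y : ℝ) :
    (zetaNormSq y : ℂ) = (2 * Real.pi : ℂ) ^ (-(1 / 2 + I * y : ℂ)) *
      exp (-(I * (Real.pi / 2) * (1 / 2 + I * y))) * (1 + I * Real.exp (-(Real.pi * y))) *
        gammaZetaSq y := by
  set s : ℂ := 1 / 2 + I * y with hs
  have h1 := riemannZeta_one_sub (critical_ne_neg_nat y) (critical_ne_one y)
  have hconj : 1 - s = (starRingEnd ℂ) s := by
    apply Complex.ext <;> simp [hs]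
    norm_num
  have h2 : (zetaNormSq y : ℂ) = riemannZeta s * riemannZeta (1 - s) := by
    rw [hconj, riemannZeta_conj, mul_conj, normSq_eq_norm_sq, zetaNormSq]
  -- Here 2 cos(πs/2) = e^(-iπs/2) (1 + e^(iπs)), and e^(iπs) = i e^(-πy) on the critical line.
  have h3 : 2 * cos (Real.pi * s / 2) =
      exp (-(I * (Real.pi / 2) * s)) * (1 + I * Real.exp (-(Real.pi * y))) := by
    have h4 : exp (-(I * (Real.pi / 2) * s)) * (I * Real.exp (-(Real.pi * y))) =
        exp (Real.pi * s / 2 * I) := by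
      have h5 : I = exp (Real.pi / 2 * I) := exp_pi_div_two_mul_I.symm
      rw [ofReal_exp]
      nth_rewrite 2 [h5]
      rw [← exp_add, ← exp_add]
      congr 1
      rw [hs]
      push_cast
      ring_nf
      rw [I_sq]
      ring
    rw [mul_add (exp _), mul_one, h4, cos]
    have h6 : -(I * (Real.pi / 2 : ℂ) * s) = -(Real.pi * s / 2) * I := by ring
    rw [h6]
    ring
  rw [h2, h1, gammaZetaSq, ← hs]
  linear_combination riemannZeta s ^ 2 * (2 * Real.pi : ℂ) ^ (-s) * Gamma s * h3

/-- The factors multiplying Γ ζ² in the functional equation have size at most a constant times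
e^(π|y|/2), and Γ ζ² decays at rate π/2 - δ; only e^(δ|y|) is left. -/
theorem exists_zetaNormSq_le {ε : ℝ} (hε : 0 < ε) :
    ∃ C : ℝ, 0 < C ∧ ∀ y : ℝ, zetaNormSq y ≤ C * Real.exp (ε * |y|) := by
  have hπ := Real.pi_pos
  set δ := min ε (Real.pi / 2)
  have hδ : 0 < δ := by positivity
  obtain ⟨C, hC0, hC⟩ := exists_gammaZetaSq_le (α := Real.pi / 2 - δ)
    (sub_nonneg.2 (min_le_right _ _)) (by linarith)
  refine ⟨‖(2 * Real.pi : ℂ) ^ (-(1 / 2) : ℂ)‖ * 2 * C + 1, by positivity, fun y => ?_⟩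
  have h0 : zetaNormSq y = ‖(zetaNormSq y : ℂ)‖ := by
    rw [norm_real, Real.norm_of_nonneg (by unfold zetaNormSq; positivity)]
  have h1 : ‖(2 * Real.pi : ℂ) ^ (-(1 / 2 + I * y : ℂ))‖ =
      ‖(2 * Real.pi : ℂ) ^ (-(1 / 2) : ℂ)‖ := by
    have h2 : (2 * Real.pi : ℂ) = ((2 * Real.pi : ℝ) : ℂ) := by push_cast; rfl
    rw [h2, norm_cpow_eq_rpow_re_of_pos (by positivity), norm_cpow_eq_rpow_re_of_pos (by positivity)]
    simp
  have h2 : ‖exp (-(I * (Real.pi / 2) * (1 / 2 + I * y)))‖ = Real.exp (Real.pi / 2 * y) := by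
    rw [norm_exp]
    congr 1
    simp
  have h3 : Real.exp (Real.pi / 2 * y) * ‖(1 + I * Real.exp (-(Real.pi * y)) : ℂ)‖ ≤
      2 * Real.exp (Real.pi / 2 * |y|) := by
    have h4 : ‖(1 + I * Real.exp (-(Real.pi * y)) : ℂ)‖ ≤ 1 + Real.exp (-(Real.pi * y)) := by
      refine (norm_add_le _ _).trans ?_
      rw [norm_one, norm_mul, norm_I, one_mul, norm_real, Real.norm_of_nonneg (Real.exp_pos _).le]
    calc _ ≤ Real.exp (Real.pi / 2 * y) * (1 + Real.exp (-(Real.pi * y))) := by gcongr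
      _ = Real.exp (Real.pi / 2 * y) + Real.exp (Real.pi / 2 * (-y)) := by
        rw [mul_add, ← Real.exp_add]
        ring_nf
      _ ≤ Real.exp (Real.pi / 2 * |y|) + Real.exp (Real.pi / 2 * |y|) := by
        gcongr
        · exact le_abs_self y
        · exact neg_le_abs y
      _ = _ := by ring
  rw [h0, zetaNormSq_eq, norm_mul, norm_mul, norm_mul, h1, h2]
  calc _ = ‖(2 * Real.pi : ℂ) ^ (-(1 / 2) : ℂ)‖ * (Real.exp (Real.pi / 2 * y) *
        ‖(1 + I * Real.exp (-(Real.pi * y)) : ℂ)‖) * ‖gammaZetaSq y‖ := by ring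
    _ ≤ ‖(2 * Real.pi : ℂ) ^ (-(1 / 2) : ℂ)‖ * (2 * Real.exp (Real.pi / 2 * |y|)) *
        (C * Real.exp (-((Real.pi / 2 - δ) * |y|))) := by
        gcongr
        exact hC y
    _ = ‖(2 * Real.pi : ℂ) ^ (-(1 / 2) : ℂ)‖ * 2 * C * Real.exp (δ * |y|) := by
      have : Real.exp (δ * |y|) =
          Real.exp (Real.pi / 2 * |y|) * Real.exp (-((Real.pi / 2 - δ) * |y|)) := by
        rw [← Real.exp_add]
        ring_nf
      rw [this]
      ring
    _ ≤ (‖(2 * Real.pi : ℂ) ^ (-(1 / 2) : ℂ)‖ * 2 * C + 1) * Real.exp (ε * |y|) := by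
      gcongr
      · linarith
      · exact min_le_left _ _

/-! ### The two-sided Laplace transform of |ζ|² by Mellin inversion -/

/-- The two-sided Laplace transform of `|ζ(1/2 + iy)|²` in terms of the Lambert series. -/
theorem integral_zetaNormSq {p : ℝ} (hp : 0 < p) (hp' : p < Real.pi) :
    ∫ y : ℝ, (zetaNormSq y : ℂ) * exp (-(p * y)) / (1 + I * Real.exp (-(Real.pi * y))) =
      2 * Real.pi * exp (-(I * p / 2)) * lambertRemainder (2 * Real.pi * I * exp (-(I * p))) := by
  -- With this angle e^(-iαs) = e^(ips) e^(-iπs/2). The second factor belongs to the functional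
  -- equation, and the first is e^(ip/2) e^(-py).
  set α := Real.pi / 2 - p with hα
  have hαabs : |α| < Real.pi / 2 := by
    rw [abs_lt]
    constructor <;> linarith
  set a := exp (I * α) with ha
  have hare : 0 < a.re := exp_I_mul_re_pos hαabs
  have hs0 : ((1 / 2 : ℝ) : ℂ).re = 1 / 2 := by simp
  have hconv : MellinConvergent (fun t : ℝ => lambertRemainder (a * t)) ((1 / 2 : ℝ) : ℂ) :=
    mellinConvergent_rotate hare hs0
  have hmel : ∀ y : ℝ, mellin (fun t : ℝ => lambertRemainder (a * t)) (((1 / 2 : ℝ) : ℂ) + y * I) =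
      exp (-(I * α * (1 / 2 + I * y))) * gammaZetaSq y := by
    intro y
    have h1 : ((1 / 2 : ℝ) : ℂ) + y * I = 1 / 2 + I * y := by
      push_cast
      ring
    rw [h1, mellin_rotate hare (by simp), ha, exp_I_mul_cpow hαabs, gammaZetaSq, mul_neg]
  have hvert : VerticalIntegrable (mellin fun t : ℝ => lambertRemainder (a * t)) (1 / 2) := by
    rw [VerticalIntegrable]
    simp_rw [hmel]
    -- A rate β strictly above |α| beats the factor e^(αy) and leaves exponential decay.
    obtain ⟨β, hβ1, hβ2⟩ := exists_between hαabs
    obtain ⟨C, hC0, hC⟩ := exists_gammaZetaSq_le ((abs_nonneg α).trans hβ1.le) hβ2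
    refine Integrable.mono' ((integrable_exp_neg_mul_abs (sub_pos.2 hβ1)).const_mul C)
      (Continuous.aestronglyMeasurable ?_) (Eventually.of_forall fun y => ?_)
    · have := continuous_gammaZetaSq
      fun_prop
    · rw [norm_mul, norm_exp]
      have h1 : (-(I * α * (1 / 2 + I * y))).re = α * y := by simp
      rw [h1]
      calc Real.exp (α * y) * ‖gammaZetaSq y‖ ≤
          Real.exp (|α| * |y|) * (C * Real.exp (-(β * |y|))) := by
            refine mul_le_mul (Real.exp_le_exp.2 ?_) (hC y) (norm_nonneg _) (Real.exp_pos _).le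
            rw [← abs_mul]
            exact le_abs_self _
        _ = C * Real.exp (-((β - |α|) * |y|)) := by
          rw [mul_left_comm, ← Real.exp_add]
          ring_nf
  have h2π : (0 : ℝ) < 2 * Real.pi := Real.two_pi_pos
  have hcont : ContinuousAt (fun t : ℝ => lambertRemainder (a * t)) (2 * Real.pi) := by
    have h1 : 0 < (a * ((2 * Real.pi : ℝ) : ℂ)).re := by
      rw [re_mul_ofReal]
      positivity
    exact ContinuousAt.comp (f := fun t : ℝ => a * (t : ℂ)) (x := 2 * Real.pi)
      (differentiableAt_lambertRemainder h1).continuousAt (by fun_prop)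
  -- Inversion at 2π produces the factor (2π)^(-s) of the functional equation.
  have hinv := mellinInv_mellin_eq (1 / 2) _ h2π hconv hvert hcont
  have harg : a * ((2 * Real.pi : ℝ) : ℂ) = 2 * Real.pi * I * exp (-(I * p)) := by
    have h1 : a = I * exp (-(I * p)) := by
      have h5 : I = exp (Real.pi / 2 * I) := exp_pi_div_two_mul_I.symm
      nth_rewrite 1 [h5]
      rw [ha, hα, ← exp_add]
      congr 1
      push_cast
      ring
    rw [h1]
    push_cast
    ring
  rw [harg] at hinv
  rw [← hinv, mellinInv]
  simp_rw [hmel]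
  have hcongr : ∀ y : ℝ, ((2 * Real.pi : ℝ) : ℂ) ^ (-(((1 / 2 : ℝ) : ℂ) + y * I)) •
      (exp (-(I * α * (1 / 2 + I * y))) * gammaZetaSq y) = exp (I * p / 2) *
      ((zetaNormSq y : ℂ) * exp (-(p * y)) / (1 + I * Real.exp (-(Real.pi * y)))) := by
    intro y
    have h1 : ((1 / 2 : ℝ) : ℂ) + y * I = 1 / 2 + I * y := by
      push_cast
      ring
    have h2 := one_add_I_mul_exp_ne_zero (-(Real.pi * y))
    have h3 : exp (-(I * α * (1 / 2 + I * y))) = exp (I * p / 2) * exp (-(p * y)) *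
        exp (-(I * (Real.pi / 2) * (1 / 2 + I * y))) := by
      rw [← exp_add, ← exp_add, hα]
      congr 1
      push_cast
      ring_nf
      rw [I_sq]
      ring
    rw [h1, zetaNormSq_eq, h3, smul_eq_mul]
    push_cast at h2 ⊢
    field_simp
  simp_rw [hcongr]
  rw [integral_const_mul]
  have h4 : exp (-(I * p / 2)) * exp (I * p / 2) = 1 := by
    rw [← exp_add]
    simp
  rw [real_smul]
  have hπ : (Real.pi : ℂ) ≠ 0 := ofReal_ne_zero.2 Real.pi_ne_zero
  push_cast
  rw [← mul_assoc, ← mul_assoc]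
  have h5 : 2 * (Real.pi : ℂ) * exp (-(I * p / 2)) * (1 / (2 * Real.pi)) * exp (I * p / 2) = 1 := by
    calc _ = (2 * (Real.pi : ℂ)) * (1 / (2 * Real.pi)) * (exp (-(I * p / 2)) * exp (I * p / 2)) := by
          ring
      _ = 1 := by
        rw [h4]
        field_simp
  rw [h5, one_mul]

/-! ### Uniqueness and existence of asymptotic series -/

/-- `c` is the sequence of coefficients of an asymptotic power series of `f` in powers of `x`. -/
def IsAsymptoticSeries {α : Type*} (l : Filter α) (x f : α → ℂ) (c : ℕ → ℂ) : Prop :=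
  ∀ m : ℕ, (fun a => f a - ∑ k ∈ Finset.range m, c k * x a ^ k) =O[l] fun a => x a ^ m

section

variable {α : Type*} {l : Filter α} {x f : α → ℂ}

theorem eq_zero_of_sum_isBigO [NeBot l] (hx : Tendsto x l (𝓝 0)) (hx0 : ∀ᶠ a in l, x a ≠ 0)
    (m : ℕ) : ∀ q : ℕ → ℂ,
      (fun a => ∑ k ∈ Finset.range m, q k * x a ^ k) =O[l] (fun a => x a ^ m) →
      ∀ k < m, q k = 0 := by
  induction m with
  | zero => exact fun q _ k hk => absurd hk (Nat.not_lt_zero k)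
  | succ m ih =>
    intro q hq k hk
    have hsum : ∀ a, ∑ k ∈ Finset.range (m + 1), q k * x a ^ k =
        x a * (∑ k ∈ Finset.range m, q (k + 1) * x a ^ k) + q 0 := by
      intro a
      rw [Finset.sum_range_succ', Finset.mul_sum, pow_zero, mul_one]
      congr 1
      exact Finset.sum_congr rfl fun k _ => by ring
    simp only [hsum] at hq
    have hq0 : q 0 = 0 := by
      have h1 : Tendsto (fun a => x a ^ (m + 1)) l (𝓝 0) := by
        simpa using hx.pow (m + 1)
      have h2 := hq.trans_tendsto h1
      have h3 : Tendsto (fun a => x a * (∑ k ∈ Finset.range m, q (k + 1) * x a ^ k) + q 0) l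
          (𝓝 (0 * (∑ k ∈ Finset.range m, q (k + 1) * 0 ^ k) + q 0)) :=
        (hx.mul (tendsto_finsetSum _ fun k _ => (hx.pow k).const_mul _)).add_const _
      rw [zero_mul, zero_add] at h3
      exact tendsto_nhds_unique h3 h2
    have h1 : (fun a => ∑ k ∈ Finset.range m, q (k + 1) * x a ^ k) =O[l] fun a => x a ^ m := by
      refine (hq.mul (isBigO_refl (fun a => (x a)⁻¹) l)).congr' ?_ ?_
      · filter_upwards [hx0] with a ha
        rw [hq0]
        field_simp
        ring
      · filter_upwards [hx0] with a ha
        rw [pow_succ, mul_assoc, mul_inv_cancel₀ ha, mul_one]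
    rcases k with _ | k
    · exact hq0
    · exact ih (fun k => q (k + 1)) h1 k (by omega)

theorem isBigO_sub_sum_of_le (hx : Tendsto x l (𝓝 0)) {c : ℕ → ℂ} {n m : ℕ} (hnm : n ≤ m)
    (h : (fun a => f a - ∑ k ∈ Finset.range m, c k * x a ^ k) =O[l] fun a => x a ^ m) :
    (fun a => f a - ∑ k ∈ Finset.range n, c k * x a ^ k) =O[l] fun a => x a ^ n := by
  obtain ⟨d, rfl⟩ := Nat.exists_eq_add_of_le hnm
  have h1 : ∀ j, (fun a => x a ^ (n + j)) =O[l] fun a => x a ^ n := by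
    intro j
    have h2 : (fun a => x a ^ j) =O[l] fun _ => (1 : ℂ) := (hx.pow j).isBigO_one ℂ
    refine ((isBigO_refl (fun a => x a ^ n) l).mul h2).congr (fun a => ?_) (fun a => mul_one _)
    rw [pow_add]
  have h2 : (fun a => ∑ j ∈ Finset.range d, c (n + j) * x a ^ (n + j)) =O[l] fun a => x a ^ n :=
    IsBigO.fun_sum fun j _ => (h1 j).const_mul_left _
  refine ((h.trans (h1 d)).add h2).congr_left fun a => ?_
  rw [Finset.sum_range_add]
  ring

theorem IsAsymptoticSeries.unique [NeBot l] (hx : Tendsto x l (𝓝 0)) (hx0 : ∀ᶠ a in l, x a ≠ 0)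
    {c d : ℕ → ℂ} {m : ℕ}
    (hc : (fun a => f a - ∑ k ∈ Finset.range m, c k * x a ^ k) =O[l] fun a => x a ^ m)
    (hd : (fun a => f a - ∑ k ∈ Finset.range m, d k * x a ^ k) =O[l] fun a => x a ^ m)
    {k : ℕ} (hk : k < m) : c k = d k := by
  refine sub_eq_zero.1 (eq_zero_of_sum_isBigO hx hx0 m (fun k => c k - d k) ?_ k hk)
  refine (hd.sub hc).congr_left fun a => ?_
  simp only [sub_mul, Finset.sum_sub_distrib]
  ring

/-- The polynomials for different orders are unrelated and of uncontrolled degree, but uniqueness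
makes their low coefficients agree, so they fit together into one sequence. -/
theorem exists_isAsymptoticSeries [NeBot l] (hx : Tendsto x l (𝓝 0)) (hx0 : ∀ᶠ a in l, x a ≠ 0)
    (h : ∀ m, HasExpansion l x f m) : ∃ c : ℕ → ℂ, IsAsymptoticSeries l x f c := by
  choose P hP using h
  have h1 : ∀ m, (fun a => f a - ∑ k ∈ Finset.range m, (P m).coeff k * x a ^ k) =O[l]
      fun a => x a ^ m := by
    intro m
    have h2 : (fun a => f a - ∑ k ∈ Finset.range (m + ((P m).natDegree + 1)),
        (P m).coeff k * x a ^ k) =O[l] fun a => x a ^ m := by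
      refine (hP m).congr_left fun a => ?_
      rw [Polynomial.eval_eq_sum_range' (by omega : (P m).natDegree < m + ((P m).natDegree + 1))]
    rw [show (fun a => f a - ∑ k ∈ Finset.range m, (P m).coeff k * x a ^ k) = fun a =>
      (f a - ∑ k ∈ Finset.range (m + ((P m).natDegree + 1)), (P m).coeff k * x a ^ k) +
      ∑ j ∈ Finset.range ((P m).natDegree + 1), (P m).coeff (m + j) * x a ^ (m + j) by
        ext a
        rw [Finset.sum_range_add]
        ring]
    refine h2.add (IsBigO.fun_sum fun j _ => IsBigO.const_mul_left ?_ _)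
    have h3 : (fun a => x a ^ j) =O[l] fun _ => (1 : ℂ) := (hx.pow j).isBigO_one ℂ
    refine ((isBigO_refl (fun a => x a ^ m) l).mul h3).congr (fun a => ?_) (fun a => mul_one _)
    rw [pow_add]
  -- An expansion with error O(x^(k+1)) is the first one that determines the coefficient of x^k.
  refine ⟨fun k => (P (k + 1)).coeff k, fun m => ?_⟩
  have h2 : ∀ k < m, (P (k + 1)).coeff k = (P m).coeff k := by
    intro k hk
    exact IsAsymptoticSeries.unique hx hx0 (h1 (k + 1))
      (isBigO_sub_sum_of_le hx (by omega : k + 1 ≤ m) (h1 m)) (Nat.lt_succ_self k)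
  refine (h1 m).congr_left fun a => ?_
  congr 1
  refine Finset.sum_congr rfl fun k hk => ?_
  rw [← h2 k (Finset.mem_range.1 hk)]

theorem IsAsymptoticSeries.coeff_zero [NeBot l] (hx : Tendsto x l (𝓝 0)) {c : ℕ → ℂ}
    (h : IsAsymptoticSeries l x f c) {v : ℂ} (hf : Tendsto f l (𝓝 v)) : c 0 = v := by
  have h1 := h 1
  simp only [Finset.sum_range_one, pow_zero, mul_one, pow_one] at h1
  have h2 := h1.trans_tendsto hx
  have h3 := hf.sub_const (c 0)
  exact (sub_eq_zero.1 (tendsto_nhds_unique h3 h2)).symm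

end

/-! ### The even series of z / (2 sin (z/2)) -/

theorem tendsto_ofReal_nhdsGT : Tendsto (fun p : ℝ => (p : ℂ)) (𝓝[>] 0) (𝓝 0) := by
  have := (continuous_ofReal.tendsto 0).mono_left (nhdsWithin_le_nhds (s := Set.Ioi (0 : ℝ)))
  simpa using this

theorem eventually_ofReal_ne_zero : ∀ᶠ p : ℝ in 𝓝[>] 0, (p : ℂ) ≠ 0 := by
  filter_upwards [self_mem_nhdsWithin] with p hp
  exact ofReal_ne_zero.2 (ne_of_gt hp)

/-- The entire function `2 sin (z / 2) / z`. -/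
noncomputable def sinHalfDiv : ℂ → ℂ := dslope (fun z => 2 * sin (z / 2)) 0

/-- The even function `z / (2 sin (z / 2))`. -/
noncomputable def cosecHalf (z : ℂ) : ℂ := (sinHalfDiv z)⁻¹

theorem sinHalfDiv_of_ne {z : ℂ} (hz : z ≠ 0) : sinHalfDiv z = 2 * sin (z / 2) / z := by
  rw [sinHalfDiv, dslope_of_ne _ hz, slope_def_field]
  simp

theorem sinHalfDiv_zero : sinHalfDiv 0 = 1 := by
  have h : HasDerivAt (fun z : ℂ => 2 * sin (z / 2)) 1 0 := by
    have h1 : HasDerivAt (fun z : ℂ => z / 2) (1 / 2) 0 := (hasDerivAt_id (0 : ℂ)).div_const 2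
    refine (h1.csin.const_mul 2).congr_deriv ?_
    simp
  rw [sinHalfDiv, dslope_same, h.deriv]

theorem cosecHalf_zero : cosecHalf 0 = 1 := by simp [cosecHalf, sinHalfDiv_zero]

theorem analyticAt_cosecHalf : AnalyticAt ℂ cosecHalf 0 := by
  have h1 : Differentiable ℂ sinHalfDiv := Differentiable.dslope (by fun_prop) 0
  exact (h1.analyticAt 0).inv (by simp [sinHalfDiv_zero])

theorem cosecHalf_neg (z : ℂ) : cosecHalf (-z) = cosecHalf z := by
  by_cases hz : z = 0
  · simp [hz]
  · rw [cosecHalf, cosecHalf, sinHalfDiv_of_ne hz, sinHalfDiv_of_ne (neg_ne_zero.2 hz), neg_div,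
      sin_neg, mul_neg, neg_div_neg_eq]

/-- Odd coefficients vanish by evenness and uniqueness. The comparison z ↦ -z takes place in a
punctured complex neighbourhood, since the one-sided filter on the reals is not symmetric. -/
theorem exists_cosecHalf_series : ∃ e : ℕ → ℂ, e 0 = 1 ∧ (∀ k, Odd k → e k = 0) ∧
    IsAsymptoticSeries (𝓝[>] 0) (fun p : ℝ => (p : ℂ)) (fun p => cosecHalf p) e := by
  have hx : Tendsto (fun z : ℂ => z) (𝓝[≠] 0) (𝓝 0) := tendsto_id.mono_left nhdsWithin_le_nhds
  have hx0 : ∀ᶠ z in 𝓝[≠] (0 : ℂ), z ≠ 0 := self_mem_nhdsWithin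
  obtain ⟨e, he⟩ := exists_isAsymptoticSeries (f := cosecHalf) hx hx0
    fun m => HasExpansion.of_analyticAt hx analyticAt_cosecHalf
  refine ⟨e, ?_, ?_, ?_⟩
  · refine he.coeff_zero hx ?_
    have := analyticAt_cosecHalf.continuousAt.tendsto
    rw [cosecHalf_zero] at this
    exact this.mono_left nhdsWithin_le_nhds
  · intro k hk
    have hneg : Tendsto (fun z : ℂ => -z) (𝓝[≠] 0) (𝓝[≠] 0) := by
      rw [tendsto_nhdsWithin_iff]
      refine ⟨by simpa using hx.neg, ?_⟩
      filter_upwards [hx0] with z hz using neg_ne_zero.2 hz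
    have h1 : (fun z : ℂ => cosecHalf z -
        ∑ j ∈ Finset.range (k + 1), ((-1) ^ j * e j) * z ^ j) =O[𝓝[≠] 0] fun z => z ^ (k + 1) := by
      have h2 := (he (k + 1)).comp_tendsto hneg
      refine IsBigO.trans (h2.congr_left fun z => ?_)
        (IsBigO.of_bound 1 (Eventually.of_forall fun z => ?_))
      · simp only [Function.comp, cosecHalf_neg]
        congr 1
        refine Finset.sum_congr rfl fun j _ => ?_
        rw [neg_pow z]
        ring
      · simp
    have h3 := IsAsymptoticSeries.unique hx hx0 h1 (he (k + 1)) (Nat.lt_succ_self k)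
    rw [hk.neg_one_pow] at h3
    have h4 : 2 * e k = 0 := by linear_combination -h3
    simpa using h4
  · intro m
    have : Tendsto (fun p : ℝ => (p : ℂ)) (𝓝[>] 0) (𝓝[≠] 0) :=
      tendsto_nhdsWithin_iff.2 ⟨tendsto_ofReal_nhdsGT, eventually_ofReal_ne_zero⟩
    exact (he m).comp_tendsto this

/-! ### From the two-sided to the truncated Laplace transform -/

/-- The Laplace transform of `|ζ(1/2 + it)|²` over `t > 1`. -/
noncomputable def truncatedLaplace (p : ℝ) : ℂ :=
  ∫ t in Set.Ioi (1 : ℝ), (zetaNormSq t : ℂ) * exp (-(p * t))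

/-- The weight by which the truncated and the two-sided Laplace transform differ. -/
noncomputable def laplaceWeight (t : ℝ) : ℂ :=
  (Set.Ioi (1 : ℝ)).indicator 1 t - 1 / (1 + I * Real.exp (-(Real.pi * t)))

theorem norm_one_add_I_mul_ge (u : ℝ) : 1 ≤ ‖(1 + I * u : ℂ)‖ ∧ u ≤ ‖(1 + I * u : ℂ)‖ := by
  have h1 := re_le_norm (1 + I * u : ℂ)
  have h2 := im_le_norm (1 + I * u : ℂ)
  simp at h1 h2
  exact ⟨h1, h2⟩

/-- With u = e^(-πt) the weight is iu/(1 + iu) for t > 1 and -1/(1 + iu) otherwise, small for small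
and for large u respectively. The factor e^π covers 0 ≤ t ≤ 1, where the modulus is only known to be
at most 1. -/
theorem norm_laplaceWeight_le (t : ℝ) :
    ‖laplaceWeight t‖ ≤ Real.exp Real.pi * Real.exp (-(Real.pi * |t|)) := by
  have hπ := Real.pi_pos
  obtain ⟨h1, h2⟩ := norm_one_add_I_mul_ge (Real.exp (-(Real.pi * t)))
  have h0 := one_add_I_mul_exp_ne_zero (-(Real.pi * t))
  have hone : 1 ≤ Real.exp Real.pi := Real.one_le_exp hπ.le
  by_cases ht : 1 < t
  · have h3 : laplaceWeight t = I * Real.exp (-(Real.pi * t)) /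
        (1 + I * Real.exp (-(Real.pi * t))) := by
      rw [laplaceWeight, Set.indicator_of_mem (Set.mem_Ioi.2 ht), Pi.one_apply]
      field_simp
      ring
    rw [h3, norm_div, norm_mul, norm_I, one_mul, norm_real, Real.norm_of_nonneg (Real.exp_pos _).le,
      abs_of_pos (one_pos.trans ht)]
    calc _ ≤ Real.exp (-(Real.pi * t)) := div_le_self (Real.exp_pos _).le h1
      _ ≤ _ := le_mul_of_one_le_left (Real.exp_pos _).le hone
  · have h3 : laplaceWeight t = -(1 / (1 + I * Real.exp (-(Real.pi * t)))) := by
      rw [laplaceWeight, Set.indicator_of_notMem (by simpa using ht), zero_sub]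
    rw [h3, norm_neg, norm_div, norm_one, ← Real.exp_add]
    rcases le_total 0 t with h | h
    · rw [abs_of_nonneg h]
      calc 1 / ‖(1 + I * Real.exp (-(Real.pi * t)) : ℂ)‖ ≤ 1 := by
            rw [div_le_one (by linarith)]
            exact h1
        _ ≤ _ := Real.one_le_exp (by nlinarith [not_lt.1 ht])
    · rw [abs_of_nonpos h]
      calc 1 / ‖(1 + I * Real.exp (-(Real.pi * t)) : ℂ)‖ ≤ 1 / Real.exp (-(Real.pi * t)) := by
            gcongr
        _ = Real.exp (Real.pi * t) := by
          rw [Real.exp_neg]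
          simp
        _ ≤ _ := Real.exp_le_exp.2 (by nlinarith)

theorem measurable_laplaceWeight : Measurable laplaceWeight := by
  refine (measurable_one.indicator measurableSet_Ioi).sub ?_
  fun_prop

/-- The difference of the truncated and the two-sided Laplace transform. -/
noncomputable def laplaceDifference (z : ℂ) : ℂ :=
  ∫ t : ℝ, (zetaNormSq t : ℂ) * exp (-(z * t)) * laplaceWeight t

theorem norm_laplaceDifference_integrand_le {C : ℝ} (hC : 0 < C)
    (hZ : ∀ y : ℝ, zetaNormSq y ≤ C * Real.exp (|y| / 2)) {r : ℝ} {z : ℂ} (hz : |z.re| ≤ r)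
    (t : ℝ) : ‖(zetaNormSq t : ℂ) * exp (-(z * t)) * laplaceWeight t‖ ≤
      C * Real.exp Real.pi * Real.exp (-((Real.pi - r - 1 / 2) * |t|)) := by
  have h0 : 0 ≤ zetaNormSq t := sq_nonneg _
  rw [norm_mul, norm_mul, norm_real, Real.norm_of_nonneg h0, norm_exp]
  have h1 : (-(z * t)).re ≤ r * |t| := by
    have h2 : (-(z * t)).re = -z.re * t := by simp
    rw [h2]
    refine (le_abs_self _).trans ?_
    rw [abs_mul, abs_neg]
    gcongr
  calc _ ≤ C * Real.exp (|t| / 2) * Real.exp (r * |t|) *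
        (Real.exp Real.pi * Real.exp (-(Real.pi * |t|))) := by
        gcongr
        · exact hZ t
        · exact norm_laplaceWeight_le t
    _ = C * Real.exp Real.pi *
        (Real.exp (|t| / 2) * Real.exp (r * |t|) * Real.exp (-(Real.pi * |t|))) := by ring
    _ = _ := by
      rw [← Real.exp_add, ← Real.exp_add]
      ring_nf

/-- The weight decays like e^(-π|t|) and |ζ|² grows at most like e^(|t|/2). Real parts up to 2 are
therefore allowed, because π - 2 - 1/2 > 0. -/
theorem analyticAt_laplaceDifference : AnalyticAt ℂ laplaceDifference 0 := by
  obtain ⟨C, hC0, hC⟩ := exists_zetaNormSq_le (ε := 1 / 2) (by norm_num)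
  have hC' : ∀ y : ℝ, zetaNormSq y ≤ C * Real.exp (|y| / 2) := by
    intro y
    refine (hC y).trans_eq ?_
    ring_nf
  have hπ := Real.pi_gt_three
  have hcont := continuous_zetaNormSq
  have hd : ∀ z ∈ Metric.ball (0 : ℂ) 1, DifferentiableAt ℂ laplaceDifference z := by
    intro z hz
    have hre : ∀ w ∈ Metric.ball z 1, |w.re| ≤ 2 := by
      intro w hw
      rw [mem_ball_iff_norm] at hw hz
      refine (abs_re_le_norm w).trans ?_
      have := norm_add_le (w - z) (z - 0)
      simp only [sub_zero, sub_add_cancel] at this hz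
      linarith
    refine (hasDerivAt_integral_of_dominated (μ := volume)
      (F := fun z (t : ℝ) => (zetaNormSq t : ℂ) * exp (-(z * t)) * laplaceWeight t) one_pos
      (fun w hw => ?_) (Eventually.of_forall fun t w hw => ?_)
      (Eventually.of_forall fun t w hw => norm_laplaceDifference_integrand_le hC0 hC' (hre w hw) t)
      ((integrable_exp_neg_mul_abs (by linarith)).const_mul _)).2.differentiableAt
    · refine AEStronglyMeasurable.mul (Continuous.aestronglyMeasurable (by fun_prop))
        measurable_laplaceWeight.aestronglyMeasurable
    · fun_prop
  exact DifferentiableOn.analyticAt (fun z hz => (hd z hz).differentiableWithinAt)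
    (Metric.ball_mem_nhds 0 one_pos)

theorem integrable_zetaNormSq_mul {p : ℝ} (hp : 0 < p) :
    IntegrableOn (fun t : ℝ => (zetaNormSq t : ℂ) * exp (-(p * t))) (Set.Ioi 1) := by
  obtain ⟨C, hC0, hC⟩ := exists_zetaNormSq_le (half_pos hp)
  have hcont := continuous_zetaNormSq
  refine Integrable.mono' ((integrable_exp_neg_mul_abs (half_pos hp)).const_mul C).integrableOn
    (Continuous.aestronglyMeasurable (by fun_prop)) ?_
  filter_upwards [ae_restrict_mem measurableSet_Ioi] with t ht
  have ht0 : 0 < t := one_pos.trans ht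
  have h0 : 0 ≤ zetaNormSq t := sq_nonneg _
  rw [norm_mul, norm_real, Real.norm_of_nonneg h0, norm_exp]
  have h2 : (-((p : ℂ) * t)).re = -(p * t) := by simp
  rw [h2]
  calc _ ≤ C * Real.exp (p / 2 * |t|) * Real.exp (-(p * t)) := by
        gcongr
        exact hC t
    _ = _ := by
      rw [abs_of_pos ht0, mul_assoc, ← Real.exp_add]
      ring_nf

theorem truncatedLaplace_eq {p : ℝ} (hp : 0 < p) (hp1 : p < 1) :
    truncatedLaplace p = 2 * Real.pi * exp (-(I * p / 2)) *
      lambertRemainder (2 * Real.pi * I * exp (-(I * p))) + laplaceDifference p := by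
  obtain ⟨C, hC0, hC⟩ := exists_zetaNormSq_le (ε := 1 / 2) (by norm_num)
  have hC' : ∀ y : ℝ, zetaNormSq y ≤ C * Real.exp (|y| / 2) := by
    intro y
    refine (hC y).trans_eq ?_
    ring_nf
  have hπ := Real.pi_gt_three
  have hcont := continuous_zetaNormSq
  have hint : Integrable fun t : ℝ => (zetaNormSq t : ℂ) * exp (-(p * t)) * laplaceWeight t := by
    refine Integrable.mono' ((integrable_exp_neg_mul_abs (c := Real.pi - 1 - 1 / 2)
      (by linarith)).const_mul (C * Real.exp Real.pi)) (AEStronglyMeasurable.mul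
        (Continuous.aestronglyMeasurable (by fun_prop))
        measurable_laplaceWeight.aestronglyMeasurable) (Eventually.of_forall fun t => ?_)
    refine norm_laplaceDifference_integrand_le hC0 hC' (z := (p : ℂ)) ?_ t
    rw [ofReal_re, abs_of_pos hp]
    exact hp1.le
  have h1 : Integrable ((Set.Ioi (1 : ℝ)).indicator
      fun t : ℝ => (zetaNormSq t : ℂ) * exp (-(p * t))) :=
    (integrable_indicator_iff measurableSet_Ioi).2 (integrable_zetaNormSq_mul hp)
  rw [← integral_zetaNormSq hp (by linarith), truncatedLaplace,
    ← integral_indicator measurableSet_Ioi, laplaceDifference, ← sub_eq_iff_eq_add,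
    ← integral_sub h1 hint]
  congr 1
  ext t
  by_cases ht : t ∈ Set.Ioi (1 : ℝ)
  · rw [laplaceWeight, Set.indicator_of_mem ht, Set.indicator_of_mem ht, Pi.one_apply]
    ring
  · rw [laplaceWeight, Set.indicator_of_notMem ht, Set.indicator_of_notMem ht]
    ring

/-! ### Expansion of the truncated Laplace transform at 0 -/

/-- The argument at which the Lambert series is evaluated. -/
noncomputable def lambertArg (z : ℂ) : ℂ := 2 * Real.pi * I * (exp (-(I * z)) - 1)

/-- The function `(1 - e ^ (-lambertArg z)) / z`. -/
noncomputable def lambertArgDiv : ℂ → ℂ := dslope (fun z => 1 - exp (-lambertArg z)) 0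

theorem differentiable_lambertArg : Differentiable ℂ lambertArg := by
  unfold lambertArg
  fun_prop

theorem lambertArg_zero : lambertArg 0 = 0 := by simp [lambertArg]

theorem differentiable_lambertArgDiv : Differentiable ℂ lambertArgDiv := by
  have := differentiable_lambertArg
  exact Differentiable.dslope (by fun_prop) 0

theorem lambertArgDiv_zero : lambertArgDiv 0 = ((2 * Real.pi : ℝ) : ℂ) := by
  have h1 : HasDerivAt lambertArg (2 * Real.pi) 0 := by
    have h2 : HasDerivAt (fun z : ℂ => -(I * z)) (-(I * 1)) 0 :=
      ((hasDerivAt_id (0 : ℂ)).const_mul I).neg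
    refine ((h2.cexp.sub_const 1).const_mul (2 * Real.pi * I)).congr_deriv ?_
    simp
    linear_combination (-2 * Real.pi : ℂ) * I_mul_I
  have h2 := (h1.neg.cexp.const_sub 1)
  rw [lambertArgDiv, dslope_same]
  refine h2.deriv.trans ?_
  simp [lambertArg_zero]

/-- The factor 2π e^(-iz/2) is exactly the prefactor of the Laplace formula; their quotient leaves z
/ (2 sin (z/2)) as coefficient of the logarithm. -/
theorem lambertArg_eq (z : ℂ) :
    lambertArg z = 2 * Real.pi * exp (-(I * z / 2)) * (2 * sin (z / 2)) := by
  have h1 : exp (-(I * z)) = exp (-(I * z / 2)) * exp (-(I * z / 2)) := by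
    rw [← exp_add]
    ring_nf
  have h2 : exp (-(I * z / 2)) * exp (z / 2 * I) = 1 := by
    rw [← exp_add]
    ring_nf
    simp
  have h3 : exp (-(z / 2) * I) = exp (-(I * z / 2)) := by ring_nf
  rw [lambertArg, sin, h1, h3]
  linear_combination (2 * Real.pi * I : ℂ) * h2

/-- The real part is 2π sin p, the imaginary part is 2π (cos p - 1), and 1 - cos p ≤ sin p on this
range. -/
theorem lambertArg_mem {p : ℝ} (hp : 0 < p) (hp1 : p < 1) :
    0 < (lambertArg p).re ∧ lambertArg p ∈ closedSector 1 := by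
  have hπ := Real.pi_gt_three
  have hs : 0 < Real.sin p := Real.sin_pos_of_pos_of_lt_pi hp (by linarith)
  have hc : 0 < Real.cos p := Real.cos_pos_of_mem_Ioo ⟨by linarith, by linarith⟩
  have h1 : exp (-(I * p)) = (Real.cos p : ℂ) - Real.sin p * I := by
    rw [show -(I * (p : ℂ)) = ((-p : ℝ) : ℂ) * I by push_cast; ring, exp_mul_I]
    push_cast
    rw [cos_neg, sin_neg]
    ring
  have hre : (lambertArg p).re = 2 * Real.pi * Real.sin p := by
    rw [lambertArg, h1]
    simp [-ofReal_cos, -ofReal_sin]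
  have him : (lambertArg p).im = 2 * Real.pi * (Real.cos p - 1) := by
    rw [lambertArg, h1]
    simp [-ofReal_cos, -ofReal_sin]
  constructor
  · rw [hre]
    positivity
  · simp only [closedSector, Set.mem_ofPred_eq]
    rw [hre, him, abs_mul, abs_of_pos Real.two_pi_pos, one_mul]
    have h2 := Real.sin_sq_add_cos_sq p
    have h3 := Real.cos_le_one p
    rw [abs_of_nonpos (by linarith)]
    have h4 : -(Real.cos p - 1) ≤ Real.sin p := by nlinarith [Real.sin_le_one p]
    gcongr

/-- The part of `p * truncatedLaplace p` which is analytic at `0`. -/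
noncomputable def laplaceAnalyticPart (z : ℂ) : ℂ :=
  -(cosecHalf z * log (lambertArgDiv z)) - z * (2 * Real.pi * exp (-(I * z / 2)) *
    ((Real.eulerMascheroniConstant - log (2 * Real.pi * I * exp (-(I * z)))) /
      (2 * Real.pi * I * exp (-(I * z))))) + z * laplaceDifference z

theorem analyticAt_laplaceAnalyticPart : AnalyticAt ℂ laplaceAnalyticPart 0 := by
  have hπ : (Real.pi : ℂ) ≠ 0 := ofReal_ne_zero.2 Real.pi_ne_zero
  have h1 : AnalyticAt ℂ (fun z => log (lambertArgDiv z)) 0 := by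
    refine (differentiable_lambertArgDiv.analyticAt 0).clog ?_
    rw [lambertArgDiv_zero]
    exact ofReal_mem_slitPlane.2 Real.two_pi_pos
  have h2 : AnalyticAt ℂ (fun z : ℂ => 2 * Real.pi * I * exp (-(I * z))) 0 := by fun_prop
  have h3 : AnalyticAt ℂ (fun z : ℂ => log (2 * Real.pi * I * exp (-(I * z)))) 0 := by
    refine h2.clog ?_
    rw [mem_slitPlane_iff]
    right
    simp
  have h4 : AnalyticAt ℂ (fun z : ℂ => 2 * Real.pi * exp (-(I * z / 2))) 0 := by fun_prop
  have h5 : AnalyticAt ℂ (fun z : ℂ => z) 0 := analyticAt_id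
  refine ((analyticAt_cosecHalf.mul h1).neg.sub (h5.mul (h4.mul
    ((analyticAt_const.sub h3).div h2 ?_)))).add (h5.mul analyticAt_laplaceDifference)
  exact mul_ne_zero (mul_ne_zero (mul_ne_zero two_ne_zero hπ) I_ne_zero) (exp_ne_zero _)

theorem laplaceAnalyticPart_zero : laplaceAnalyticPart 0 = -(Real.log (2 * Real.pi) : ℂ) := by
  rw [laplaceAnalyticPart, cosecHalf_zero, lambertArgDiv_zero, ofReal_log Real.two_pi_pos.le]
  simp

/-- Since 1 - e^(-w) is p times a factor close to 2π at w = `lambertArg p`, the logarithm in the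
Lambert series splits off log p. This is the only term that is not a power series or a Riemann sum,
and its coefficient is -`cosecHalf p`. -/
theorem mul_truncatedLaplace_eventually : ∀ᶠ p : ℝ in 𝓝[>] 0,
    cosecHalf p * IsDerivTower.riemannSum planckTower 1 (lambertArg p) + laplaceAnalyticPart p =
      p * truncatedLaplace p + Real.log p * cosecHalf p := by
  have h1 : ∀ᶠ p : ℝ in 𝓝[>] 0, lambertArgDiv p ≠ 0 := by
    have h2 := (differentiable_lambertArgDiv.continuous.tendsto 0).comp tendsto_ofReal_nhdsGT
    rw [lambertArgDiv_zero] at h2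
    exact h2.eventually_ne (ofReal_ne_zero.2 Real.two_pi_pos.ne')
  filter_upwards [h1, Ioo_mem_nhdsGT one_pos] with p hdiv hp
  obtain ⟨hp0, hp1⟩ := hp
  have hpc : (p : ℂ) ≠ 0 := ofReal_ne_zero.2 hp0.ne'
  obtain ⟨hre, hmem⟩ := lambertArg_mem hp0 hp1
  have hz : lambertArg p ≠ 0 := by
    intro h
    rw [h] at hre
    simp at hre
  have hw : 2 * Real.pi * I * exp (-(I * p)) = lambertArg p + 2 * Real.pi * I := by
    rw [lambertArg]
    ring
  have hlog : log (1 - exp (-lambertArg p)) = Real.log p + log (lambertArgDiv p) := by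
    rw [← log_ofReal_mul hp0 hdiv]
    congr 1
    rw [lambertArgDiv, dslope_of_ne _ hpc, slope_def_field]
    simp [lambertArg_zero]
    field_simp
  have hsin : sin ((p : ℂ) / 2) ≠ 0 := by
    intro h
    rw [lambertArg_eq, h] at hz
    simp at hz
  have hE : p * (2 * Real.pi * exp (-(I * p / 2))) / lambertArg p = cosecHalf p := by
    have hπ : (Real.pi : ℂ) ≠ 0 := ofReal_ne_zero.2 Real.pi_ne_zero
    have := exp_ne_zero (-(I * (p : ℂ) / 2))
    rw [cosecHalf, sinHalfDiv_of_ne hpc, lambertArg_eq]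
    field_simp
  rw [truncatedLaplace_eq hp0 hp1, lambertRemainder, laplaceAnalyticPart]
  -- The third occurrence is the argument of the Lambert series. The other two belong to the
  -- subtracted singular part, which is analytic near 2πi and is left alone.
  nth_rewrite 3 [hw]
  rw [lambertSeries_add_two_pi_I, lambertSeries_eq hre, hlog]
  linear_combination (Real.log p + log (lambertArgDiv p) -
    IsDerivTower.riemannSum planckTower 1 (lambertArg p)) * hE

theorem tendsto_lambertArg :
    Tendsto (fun p : ℝ => lambertArg p) (𝓝[>] 0) (𝓝[closedSector 1 \ {0}] 0) := by
  rw [tendsto_nhdsWithin_iff]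
  constructor
  · have := (differentiable_lambertArg.continuous.tendsto 0).comp tendsto_ofReal_nhdsGT
    rwa [lambertArg_zero] at this
  · filter_upwards [Ioo_mem_nhdsGT one_pos] with p hp
    obtain ⟨hre, hmem⟩ := lambertArg_mem hp.1 hp.2
    refine ⟨hmem, ?_⟩
    rintro (h : lambertArg p = 0)
    rw [h] at hre
    simp at hre

theorem exists_truncatedLaplace_series : ∃ c : ℕ → ℂ,
    c 0 = Real.eulerMascheroniConstant - Real.log (2 * Real.pi) ∧
    IsAsymptoticSeries (𝓝[>] 0) (fun p : ℝ => (p : ℂ))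
      (fun p => p * truncatedLaplace p + Real.log p * cosecHalf p) c := by
  have hT := isDerivTower_planckTower one_pos
  have hexp : ∀ m, HasExpansion (𝓝[>] 0) (fun p : ℝ => (p : ℂ))
      (fun p => p * truncatedLaplace p + Real.log p * cosecHalf p) m := by
    intro m
    have h1 : HasExpansion (𝓝[>] 0) (fun p : ℝ => (p : ℂ))
        (fun p : ℝ => IsDerivTower.riemannSum planckTower 1 (lambertArg p)) m := by
      obtain ⟨P, hP⟩ := hT.hasExpansion_riemannSum one_pos m 0
      refine HasExpansion.comp_analyticAt tendsto_ofReal_nhdsGT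
        (differentiable_lambertArg.analyticAt 0) lambertArg_zero ⟨P, ?_⟩
      exact hP.comp_tendsto tendsto_lambertArg
    exact (((HasExpansion.of_analyticAt tendsto_ofReal_nhdsGT analyticAt_cosecHalf).mul
      tendsto_ofReal_nhdsGT h1).add (HasExpansion.of_analyticAt tendsto_ofReal_nhdsGT
        analyticAt_laplaceAnalyticPart)).congr' mul_truncatedLaplace_eventually
  obtain ⟨c, hc⟩ := exists_isAsymptoticSeries tendsto_ofReal_nhdsGT eventually_ofReal_ne_zero hexp
  refine ⟨c, ?_, hc⟩
  refine hc.coeff_zero tendsto_ofReal_nhdsGT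
    (Tendsto.congr' mul_truncatedLaplace_eventually ?_)
  -- The constant term is the sum of two limits: γ from the Riemann sum and -log 2π from the
  -- analytic part.
  have h1 : Tendsto (fun z => IsDerivTower.riemannSum planckTower 1 z)
      (𝓝[closedSector 1 \ {0}] 0) (𝓝 Real.eulerMascheroniConstant) := by
    have h2 := (hT.isBigO_riemannSum_add one_pos 0).trans_tendsto
      IsDerivTower.tendsto_id_closedSector
    have h3 := h2.sub_const (planckTower 0 0)
    simp only [add_sub_cancel_right, zero_sub] at h3
    rwa [show planckTower 0 0 = planckPrimitive 0 from rfl, planckPrimitive_zero, neg_neg] at h3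
  have h2 := (analyticAt_cosecHalf.continuousAt.tendsto).comp tendsto_ofReal_nhdsGT
  have h3 := (analyticAt_laplaceAnalyticPart.continuousAt.tendsto).comp tendsto_ofReal_nhdsGT
  have h4 := (h2.mul (h1.comp tendsto_lambertArg)).add h3
  rw [cosecHalf_zero, one_mul, laplaceAnalyticPart_zero, ← sub_eq_add_neg] at h4
  exact h4

/-! ### Logarithmic expansions and the Mellin transform of L -/

/-- `K` is continuous on the positive reals, decays exponentially at infinity, and has an
asymptotic expansion `∑ (c k - e k * log t) * t ^ (k - 1)` at `0`. -/
structure HasLogExpansion (K : ℝ → ℂ) (c e : ℕ → ℂ) : Prop where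
  continuousOn : ContinuousOn K (Set.Ioi 0)
  isBigO_atTop : K =O[atTop] fun t => Real.exp (-1 * t)
  isBigO_zero : ∀ (N : ℕ) (ε : ℝ), 0 < ε →
    (fun t : ℝ => K t - ∑ k ∈ Finset.range N, (c k - e k * Real.log t) * (t : ℂ) ^ ((k : ℂ) - 1))
      =O[𝓝[>] 0] fun t => t ^ (-(1 + ε - N))

theorem continuousOn_truncatedLaplace : ContinuousOn truncatedLaplace (Set.Ioi 0) := by
  intro p hp
  have hp0 : (0 : ℝ) < p := hp
  have hp2 : 0 < p / 2 := half_pos hp0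
  have hcont := continuous_zetaNormSq
  have h1 : DifferentiableAt ℂ (fun z : ℂ => ∫ t in Set.Ioi (1 : ℝ),
      (zetaNormSq t : ℂ) * exp (-(z * t))) p := by
    refine (hasDerivAt_integral_of_dominated (μ := volume.restrict (Set.Ioi (1 : ℝ)))
      (F := fun z (t : ℝ) => (zetaNormSq t : ℂ) * exp (-(z * t))) hp2
      (b := fun t => ‖(zetaNormSq t : ℂ) * exp (-(((p / 2 : ℝ) : ℂ) * t))‖)
      (fun w hw => Continuous.aestronglyMeasurable (by fun_prop))
      (Eventually.of_forall fun t w hw => by fun_prop) ?_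
      (integrable_zetaNormSq_mul hp2).norm).2.differentiableAt
    filter_upwards [ae_restrict_mem measurableSet_Ioi] with t ht w hw
    have ht0 : 0 < t := one_pos.trans ht
    rw [mem_ball_iff_norm] at hw
    have h2 : |w.re - p| < p / 2 := by
      simpa using (abs_re_le_norm (w - p)).trans_lt hw
    have h3 := (abs_lt.1 h2).1
    rw [norm_mul, norm_mul, norm_exp, norm_exp]
    have h4 : (-(w * t)).re = -(w.re * t) := by simp
    have h5 : (-(((p / 2 : ℝ) : ℂ) * t)).re = -(p / 2 * t) := by
      rw [← ofReal_mul, ← ofReal_neg, ofReal_re]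
    rw [h4, h5]
    gcongr
    linarith
  exact (ContinuousAt.comp (f := fun p : ℝ => (p : ℂ)) (x := p) h1.continuousAt
    continuous_ofReal.continuousAt).continuousWithinAt

theorem truncatedLaplace_eq_ofReal (p : ℝ) :
    truncatedLaplace p = ((∫ t in Set.Ioi (1 : ℝ), zetaNormSq t * Real.exp (-(p * t)) : ℝ) : ℂ) := by
  refine Eq.trans ?_ (integral_ofReal (𝕜 := ℂ))
  rw [truncatedLaplace]
  congr 1
  ext t
  simp

/-- There is no cancellation, because the integrand is nonnegative. The same fact lets Tonelli turn
convergence of the Mellin transform of L into absolute convergence of 𝒵₁. -/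
theorem integral_norm_truncatedLaplace (p : ℝ) :
    ∫ t in Set.Ioi (1 : ℝ), ‖(zetaNormSq t : ℂ) * exp (-(p * t))‖ = ‖truncatedLaplace p‖ := by
  have h0 : ∀ t, 0 ≤ zetaNormSq t := fun t => sq_nonneg _
  rw [truncatedLaplace_eq_ofReal, norm_real, Real.norm_of_nonneg
    (integral_nonneg fun t => mul_nonneg (h0 t) (Real.exp_pos _).le)]
  congr 1
  ext t
  rw [norm_mul, norm_real, Real.norm_of_nonneg (h0 t), norm_exp]
  simp

theorem truncatedLaplace_isBigO_atTop :
    truncatedLaplace =O[atTop] fun p => Real.exp (-1 * p) := by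
  refine IsBigO.of_bound (Real.exp 1 * ‖truncatedLaplace 1‖) ?_
  filter_upwards [eventually_ge_atTop 1] with p hp
  rw [← integral_norm_truncatedLaplace p, ← integral_norm_truncatedLaplace 1,
    Real.norm_of_nonneg (Real.exp_pos _).le, mul_right_comm, ← Real.exp_add, ← integral_const_mul]
  refine setIntegral_mono_on (integrable_zetaNormSq_mul (one_pos.trans_le hp)).norm
    ((integrable_zetaNormSq_mul one_pos).norm.const_mul _) measurableSet_Ioi fun t ht => ?_
  have ht1 : 1 < t := ht
  rw [norm_mul, norm_mul, mul_left_comm, norm_exp, norm_exp, ← Real.exp_add]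
  gcongr
  simp
  nlinarith

theorem exists_hasLogExpansion_truncatedLaplace : ∃ c e : ℕ → ℂ,
    c 0 = Real.eulerMascheroniConstant - Real.log (2 * Real.pi) ∧ e 0 = 1 ∧
    (∀ k, Odd k → e k = 0) ∧ HasLogExpansion truncatedLaplace c e := by
  obtain ⟨c, hc0, hc⟩ := exists_truncatedLaplace_series
  obtain ⟨e, he0, heo, he⟩ := exists_cosecHalf_series
  refine ⟨c, e, hc0, he0, heo, continuousOn_truncatedLaplace, truncatedLaplace_isBigO_atTop, ?_⟩
  intro N ε hε
  have hpow : ∀ M : ℕ, (fun t : ℝ => (t : ℂ) ^ M) =O[𝓝[>] 0] fun t : ℝ => t ^ (-(-(M : ℝ))) := by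
    intro M
    refine IsBigO.of_bound 1 (Eventually.of_forall fun t => ?_)
    rw [neg_neg, Real.rpow_natCast, one_mul, norm_pow, norm_real, norm_pow]
  have hmono : (fun t : ℝ => t ^ (-(-(N : ℝ)))) =O[𝓝[>] 0] fun t : ℝ => t ^ (-(ε - N)) := by
    refine IsBigO.of_bound 1 ?_
    filter_upwards [Ioo_mem_nhdsGT one_pos] with t ht
    rw [one_mul, Real.norm_of_nonneg (Real.rpow_nonneg ht.1.le _),
      Real.norm_of_nonneg (Real.rpow_nonneg ht.1.le _)]
    exact Real.rpow_le_rpow_of_exponent_ge ht.1 ht.2.le (by linarith)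
  have h1 := ((hc N).trans (hpow N)).trans hmono
  -- Multiplication by log t costs an arbitrarily small power, which is the reason for `ε` in the
  -- expansion.
  have h2 := isBigO_rpow_zero_log_smul (by linarith : -(N : ℝ) < ε - N) ((he N).trans (hpow N))
  have h3 : (fun t : ℝ => (t : ℂ)⁻¹) =O[𝓝[>] 0] fun t : ℝ => t ^ (-1 : ℝ) := by
    refine IsBigO.of_bound 1 (Eventually.of_forall fun t => ?_)
    rw [Real.rpow_neg_one, one_mul, norm_inv, norm_inv, norm_real]
  refine ((h1.sub h2).mul h3).congr' ?_ ?_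
  · filter_upwards [self_mem_nhdsWithin] with t ht
    have ht0 : (t : ℂ) ≠ 0 := ofReal_ne_zero.2 (ne_of_gt ht)
    have h4 : ∑ k ∈ Finset.range N, (c k - e k * Real.log t) * (t : ℂ) ^ ((k : ℂ) - 1) =
        ((∑ k ∈ Finset.range N, c k * (t : ℂ) ^ k) -
          Real.log t * ∑ k ∈ Finset.range N, e k * (t : ℂ) ^ k) * (t : ℂ)⁻¹ := by
      rw [Finset.mul_sum, ← Finset.sum_sub_distrib, Finset.sum_mul]
      refine Finset.sum_congr rfl fun k _ => ?_
      rw [cpow_sub _ _ ht0, cpow_one, cpow_natCast]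
      ring
    rw [h4, real_smul]
    field_simp
    ring
  · filter_upwards [self_mem_nhdsWithin] with t ht
    rw [← Real.rpow_add ht]
    congr 1
    ring

/-- The Mellin transform of the Laplace transform, and absolute convergence. -/
theorem mellin_truncatedLaplace {s : ℂ} (hs : 0 < s.re) (hconv : MellinConvergent truncatedLaplace s) :
    IntegrableOn (zetaMellinIntegrand 1 s) (Set.Ioi 1) ∧
      mellin truncatedLaplace s = Gamma s * modifiedMellinZeta 1 s := by
  set f : ℝ → ℝ → ℂ := fun t p => (p : ℂ) ^ (s - 1) * ((zetaNormSq t : ℂ) * exp (-(p * t)))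
    with hf
  have hmeas : Measurable (Function.uncurry f) := by
    have h1 : Measurable zetaNormSq := continuous_zetaNormSq.measurable
    have h2 : Measurable fun x : ℝ × ℝ => ((x.2 : ℝ) : ℂ) ^ (s - 1) :=
      (measurable_ofReal.comp measurable_snd).pow_const _
    have h3 : Measurable fun x : ℝ × ℝ => (zetaNormSq x.1 : ℂ) :=
      measurable_ofReal.comp (h1.comp measurable_fst)
    have h4 : Measurable fun x : ℝ × ℝ => exp (-((x.2 : ℂ) * x.1)) :=
      Continuous.measurable (by fun_prop)
    exact h2.mul (h3.mul h4)
  -- Integrating the modulus in `t` first gives |p^(s-1)| |L(p)|, which is integrable by hypothesis.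
  have hint : Integrable (Function.uncurry f)
      ((volume.restrict (Set.Ioi (1 : ℝ))).prod (volume.restrict (Set.Ioi (0 : ℝ)))) := by
    rw [integrable_prod_iff' hmeas.aestronglyMeasurable]
    constructor
    · filter_upwards [ae_restrict_mem measurableSet_Ioi] with p hp
      exact (integrable_zetaNormSq_mul hp).const_mul ((p : ℂ) ^ (s - 1))
    · refine (Integrable.norm hconv).congr (Eventually.of_forall fun p => ?_)
      simp only [hf, Function.uncurry]
      simp_rw [norm_mul _ ((zetaNormSq _ : ℂ) * _)]
      rw [integral_const_mul, integral_norm_truncatedLaplace, norm_smul]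
  have hinner : ∀ t ∈ Set.Ioi (1 : ℝ), ∫ p in Set.Ioi (0 : ℝ), f t p =
      Gamma s * zetaMellinIntegrand 1 s t := by
    intro t ht
    have ht0 : (0 : ℝ) < t := one_pos.trans ht
    have h1 := integral_cpow_mul_exp_neg_mul_Ioi hs (r := t) ht0
    have h2 : ∀ p : ℝ, f t p = (zetaNormSq t : ℂ) * ((p : ℂ) ^ (s - 1) * exp (-(t * p))) := by
      intro p
      simp only [hf]
      rw [mul_comm (p : ℂ) t]
      ring
    simp_rw [h2]
    rw [integral_const_mul, h1, zetaMellinIntegrand, one_div,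
      inv_cpow _ _ (by rw [arg_ofReal_of_nonneg ht0.le]; exact Real.pi_ne_zero.symm), cpow_neg,
      zetaNormSq, mul_one]
    push_cast
    ring
  have hΓ : Gamma s ≠ 0 := Gamma_ne_zero_of_re_pos hs
  constructor
  · have h1 := hint.integral_prod_left
    have h2 : IntegrableOn (fun t => Gamma s * zetaMellinIntegrand 1 s t) (Set.Ioi 1) :=
      (integrableOn_congr_fun hinner measurableSet_Ioi).1 h1
    have h3 := Integrable.const_mul h2 (Gamma s)⁻¹
    refine Integrable.congr h3 (Eventually.of_forall fun t => ?_)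
    simp only
    rw [inv_mul_cancel_left₀ hΓ]
  · have h1 := integral_integral_swap hint
    rw [setIntegral_congr_fun measurableSet_Ioi hinner, integral_const_mul] at h1
    rw [modifiedMellinZeta, h1, mellin]
    congr 1
    ext p
    rw [truncatedLaplace, smul_eq_mul, ← integral_const_mul]

/-! ### Meromorphic continuation of the Mellin transform -/

namespace HasLogExpansion

variable {K : ℝ → ℂ} {c e : ℕ → ℂ}

/-- The `k`-th term of the expansion, cut off at `1`. -/
noncomputable def cutoffTerm (c e : ℕ → ℂ) (k : ℕ) : ℝ → ℂ := fun t =>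
  c k • (Set.Ioc 0 1).indicator (fun t : ℝ => (t : ℂ) ^ ((k : ℂ) - 1)) t -
    e k • (Set.Ioc 0 1).indicator (fun t : ℝ => (Real.log t : ℂ) * (t : ℂ) ^ ((k : ℂ) - 1)) t

/-- The Mellin transform of the `k`-th term. -/
noncomputable def polarTerm (c e : ℕ → ℂ) (k : ℕ) (s : ℂ) : ℂ :=
  c k / (s - (1 - k)) + e k / (s - (1 - k)) ^ 2

theorem hasMellin_cutoffTerm (c e : ℕ → ℂ) {k : ℕ} {s : ℂ} (hs : 1 - k < s.re) :
    HasMellin (cutoffTerm c e k) s (polarTerm c e k s) := by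
  have hs' : 0 < s.re + ((k : ℂ) - 1).re := by
    simp
    linarith
  have h1 := hasMellin_cpow_Ioc _ hs'
  have h2 := hasMellin_log_cpow_Ioc _ hs'
  have h3 := hasMellin_const_smul h1.1 (c k)
  have h4 := hasMellin_const_smul h2.1 (e k)
  have h5 := hasMellin_sub h3.1 h4.1
  rw [h3.2, h4.2, h1.2, h2.2] at h5
  refine ⟨h5.1, h5.2.trans ?_⟩
  rw [polarTerm, smul_eq_mul, smul_eq_mul, show s - (1 - (k : ℂ)) = s + (k - 1) by ring]
  ring

theorem cutoffTerm_of_mem {k : ℕ} {t : ℝ} (ht : t ∈ Set.Ioc (0 : ℝ) 1) :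
    cutoffTerm c e k t = (c k - e k * Real.log t) * (t : ℂ) ^ ((k : ℂ) - 1) := by
  rw [cutoffTerm, Set.indicator_of_mem ht, Set.indicator_of_mem ht, smul_eq_mul, smul_eq_mul]
  ring

theorem cutoffTerm_of_gt {k : ℕ} {t : ℝ} (ht : 1 < t) : cutoffTerm c e k t = 0 := by
  have : t ∉ Set.Ioc (0 : ℝ) 1 := fun h => absurd h.2 (not_le.2 ht)
  rw [cutoffTerm, Set.indicator_of_notMem this, Set.indicator_of_notMem this]
  simp

theorem locallyIntegrableOn_cutoffTerm (c e : ℕ → ℂ) (k : ℕ) :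
    LocallyIntegrableOn (cutoffTerm c e k) (Set.Ioi 0) := by
  have h1 : ContinuousOn (fun t : ℝ => (t : ℂ) ^ ((k : ℂ) - 1)) (Set.Ioi 0) := fun t ht =>
    (continuousAt_ofReal_cpow_const _ _ (Or.inr (ne_of_gt ht))).continuousWithinAt
  have h2 : ContinuousOn (fun t : ℝ => (Real.log t : ℂ) * (t : ℂ) ^ ((k : ℂ) - 1)) (Set.Ioi 0) := by
    refine ContinuousOn.mul (fun t ht => ?_) h1
    exact (continuous_ofReal.continuousAt.comp
      (Real.continuousAt_log (ne_of_gt ht))).continuousWithinAt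
  have h3 : LocallyIntegrableOn (fun t : ℝ => (t : ℂ) ^ ((k : ℂ) - 1)) (Set.Ioi 0) :=
    h1.locallyIntegrableOn measurableSet_Ioi
  have h4 : LocallyIntegrableOn (fun t : ℝ => (Real.log t : ℂ) * (t : ℂ) ^ ((k : ℂ) - 1))
    (Set.Ioi 0) := h2.locallyIntegrableOn measurableSet_Ioi
  refine LocallyIntegrableOn.sub ?_ ?_
  · intro t ht
    obtain ⟨u, hu, hi⟩ := h3 t ht
    exact ⟨u, hu, Integrable.const_mul (hi.indicator measurableSet_Ioc) (c k)⟩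
  · intro t ht
    obtain ⟨u, hu, hi⟩ := h4 t ht
    exact ⟨u, hu, Integrable.const_mul (hi.indicator measurableSet_Ioc) (e k)⟩

/-- `K` minus the first `N` terms of its expansion. -/
noncomputable def tail (K : ℝ → ℂ) (c e : ℕ → ℂ) : ℕ → ℝ → ℂ
  | 0 => K
  | N + 1 => fun t => tail K c e N t - cutoffTerm c e N t

theorem tail_eq (N : ℕ) (t : ℝ) :
    tail K c e N t = K t - ∑ k ∈ Finset.range N, cutoffTerm c e k t := by
  induction N with
  | zero => simp [tail]
  | succ N ih =>
    change tail K c e N t - cutoffTerm c e N t = _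
    rw [ih, Finset.sum_range_succ]
    ring

theorem mellin_tail (h : HasLogExpansion K c e) {N : ℕ} {s : ℂ} (hs : 1 - N < s.re) :
    MellinConvergent (tail K c e N) s ∧ DifferentiableAt ℂ (mellin (tail K c e N)) s := by
  have h1 : LocallyIntegrableOn (tail K c e N) (Set.Ioi 0) := by
    clear hs
    induction N with
    | zero => exact h.continuousOn.locallyIntegrableOn measurableSet_Ioi
    | succ N ih => exact ih.sub (locallyIntegrableOn_cutoffTerm c e N)
  have h2 : tail K c e N =O[atTop] fun t => Real.exp (-1 * t) := by
    refine h.isBigO_atTop.congr' ?_ EventuallyEq.rfl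
    filter_upwards [eventually_gt_atTop 1] with t ht
    rw [tail_eq, Finset.sum_eq_zero fun k _ => cutoffTerm_of_gt ht, sub_zero]
  -- Half the distance from Re s to the line Re s = 1 - N, so that 1 + ε - N is still below Re s.
  obtain ⟨ε, hε⟩ : ∃ ε : ℝ, ε = (s.re - (1 - N)) / 2 := ⟨_, rfl⟩
  have hε0 : 0 < ε := by linarith
  have h3 : tail K c e N =O[𝓝[>] 0] fun t => t ^ (-(1 + ε - N)) := by
    refine (h.isBigO_zero N ε hε0).congr' ?_ EventuallyEq.rfl
    filter_upwards [Ioc_mem_nhdsGT one_pos] with t ht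
    rw [tail_eq]
    congr 1
    exact Finset.sum_congr rfl fun k _ => (cutoffTerm_of_mem ht).symm
  have hlt : 1 + ε - N < s.re := by linarith
  exact ⟨mellinConvergent_of_isBigO_rpow_exp one_pos h1 h2 h3 hlt,
    mellin_differentiableAt_of_isBigO_rpow_exp one_pos h1 h2 h3 hlt⟩

/-- The continuation of the Mellin transform of `K` to the half-plane `1 - N < Re s`. -/
noncomputable def continuation (K : ℝ → ℂ) (c e : ℕ → ℂ) (N : ℕ) (s : ℂ) : ℂ :=
  mellin (tail K c e N) s + ∑ k ∈ Finset.range N, polarTerm c e k s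

/-- In the smaller half-plane the extra subtracted term has a convergent Mellin transform, equal to
the polar term added back. -/
theorem continuation_succ (h : HasLogExpansion K c e) {N : ℕ} {s : ℂ} (hs : 1 - N < s.re) :
    continuation K c e (N + 1) s = continuation K c e N s := by
  have h1 := hasMellin_cutoffTerm c e hs
  have h2 := hasMellin_sub (h.mellin_tail hs).1 h1.1
  rw [h1.2] at h2
  have h3 : mellin (tail K c e (N + 1)) s = mellin (tail K c e N) s - polarTerm c e N s := h2.2
  rw [continuation, continuation, h3, Finset.sum_range_succ]
  ring

theorem continuation_of_le (h : HasLogExpansion K c e) {N N' : ℕ} (hN : N ≤ N') {s : ℂ}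
    (hs : 1 - N < s.re) : continuation K c e N' s = continuation K c e N s := by
  induction N', hN using Nat.le_induction with
  | base => rfl
  | succ n hn ih =>
    rw [h.continuation_succ, ih]
    have : (N : ℝ) ≤ n := by exact_mod_cast hn
    linarith

/-- The continuation of the Mellin transform of `K` to `ℂ`. -/
noncomputable def fullContinuation (K : ℝ → ℂ) (c e : ℕ → ℂ) (s : ℂ) : ℂ :=
  continuation K c e (⌈|s.re|⌉₊ + 2) s

theorem fullContinuation_eq (h : HasLogExpansion K c e) {N : ℕ} {s : ℂ} (hs : 1 - N < s.re) :
    fullContinuation K c e s = continuation K c e N s := by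
  have h1 : 1 - ((⌈|s.re|⌉₊ + 2 : ℕ) : ℝ) < s.re := by
    have h2 := Nat.le_ceil |s.re|
    have h3 := neg_abs_le s.re
    push_cast
    linarith
  rw [fullContinuation]
  rcases le_total N (⌈|s.re|⌉₊ + 2) with hN | hN
  · exact h.continuation_of_le hN hs
  · exact (h.continuation_of_le hN h1).symm

theorem fullContinuation_eq_mellin (h : HasLogExpansion K c e) {s : ℂ} (hs : 1 < s.re) :
    fullContinuation K c e s = mellin K s := by
  rw [h.fullContinuation_eq (N := 0) (by simpa using hs), continuation]
  simp [tail]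

theorem eventually_fullContinuation_eq (h : HasLogExpansion K c e) {N : ℕ} {s : ℂ}
    (hs : 1 - N < s.re) : fullContinuation K c e =ᶠ[𝓝 s] continuation K c e N := by
  filter_upwards [(isOpen_lt continuous_const continuous_re).mem_nhds hs] with z hz
  exact h.fullContinuation_eq hz

theorem exists_nat_lt_re (s : ℂ) : ∃ N : ℕ, 1 - N < s.re := by
  obtain ⟨N, hN⟩ := exists_nat_gt (1 - s.re)
  exact ⟨N, by linarith⟩

theorem analyticAt_mellin_tail (h : HasLogExpansion K c e) {N : ℕ} {s : ℂ} (hs : 1 - N < s.re) :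
    AnalyticAt ℂ (mellin (tail K c e N)) s := by
  have hopen : IsOpen {z : ℂ | 1 - (N : ℝ) < z.re} := isOpen_lt continuous_const continuous_re
  exact DifferentiableOn.analyticAt (fun z hz => (h.mellin_tail hz).2.differentiableWithinAt)
    (hopen.mem_nhds hs)

theorem analyticAt_polarTerm {k : ℕ} {s : ℂ} (hs : s ≠ 1 - k) :
    AnalyticAt ℂ (polarTerm c e k) s := by
  have h1 : AnalyticAt ℂ (fun s : ℂ => s - (1 - k)) s := by fun_prop
  have h2 : s - (1 - k) ≠ 0 := sub_ne_zero.2 hs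
  exact (analyticAt_const.div h1 h2).add (analyticAt_const.div (h1.pow 2) (pow_ne_zero 2 h2))

theorem analyticAt_fullContinuation (h : HasLogExpansion K c e) {s : ℂ}
    (hs : ∀ k : ℕ, s ≠ 1 - k) : AnalyticAt ℂ (fullContinuation K c e) s := by
  obtain ⟨N, hN⟩ := exists_nat_lt_re s
  refine AnalyticAt.congr ?_ (h.eventually_fullContinuation_eq hN).symm
  exact (h.analyticAt_mellin_tail hN).add
    (Finset.analyticAt_fun_sum _ fun k _ => analyticAt_polarTerm (hs k))

/-- The singular part of the continuation at `1 - k`. -/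
theorem exists_fullContinuation_eq (h : HasLogExpansion K c e) (k : ℕ) :
    ∃ A : ℂ → ℂ, AnalyticAt ℂ A (1 - k) ∧ ∀ᶠ s in 𝓝 (1 - k : ℂ),
      fullContinuation K c e s = A s + polarTerm c e k s := by
  have hN : 1 - ((k + 1 : ℕ) : ℝ) < (1 - k : ℂ).re := by
    simp
  refine ⟨fun s => mellin (tail K c e (k + 1)) s + ∑ j ∈ Finset.range k, polarTerm c e j s, ?_, ?_⟩
  · refine (h.analyticAt_mellin_tail hN).add
      (Finset.analyticAt_fun_sum _ fun j hj => analyticAt_polarTerm ?_)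
    intro h1
    have h2 : (k : ℂ) = j := by linear_combination -h1
    exact (Finset.mem_range.1 hj).ne' (Nat.cast_injective h2)
  · filter_upwards [h.eventually_fullContinuation_eq hN] with s hs
    rw [hs, continuation, Finset.sum_range_succ]
    ring

end HasLogExpansion

/-! ### Division by Γ and the order of the poles -/

theorem analyticAt_Gamma_inv (s : ℂ) : AnalyticAt ℂ (fun z => (Gamma z)⁻¹) s :=
  differentiable_one_div_Gamma.analyticAt s

theorem AnalyticAt.dslope_self {f : ℂ → ℂ} {a : ℂ} (hf : AnalyticAt ℂ f a) :
    AnalyticAt ℂ (dslope f a) a := by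
  obtain ⟨p, hp⟩ := hf
  exact ⟨_, hp.has_fpower_series_dslope_fslope⟩

theorem hasDerivAt_Gamma_inv_one :
    HasDerivAt (fun z => (Gamma z)⁻¹) (Real.eulerMascheroniConstant : ℂ) 1 := by
  have h := hasDerivAt_Gamma_one.fun_inv (by simp)
  simpa using! h

namespace HasLogExpansion

variable {K : ℝ → ℂ} {c e : ℕ → ℂ}

/-- The continuation divided by `Γ`. -/
noncomputable def gammaQuotient (K : ℝ → ℂ) (c e : ℕ → ℂ) (s : ℂ) : ℂ :=
  (Gamma s)⁻¹ * fullContinuation K c e s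

theorem analyticAt_gammaQuotient (h : HasLogExpansion K c e) {s : ℂ} (hs : ∀ k : ℕ, s ≠ 1 - k) :
    AnalyticAt ℂ (gammaQuotient K c e) s :=
  (analyticAt_Gamma_inv s).mul (h.analyticAt_fullContinuation hs)

/-- Division by `Γ` lowers the order of the pole at `-n` by one. -/
theorem exists_gammaQuotient_eq (h : HasLogExpansion K c e) (n : ℕ) :
    ∃ B D : ℂ → ℂ, AnalyticAt ℂ B (-n) ∧ AnalyticAt ℂ D (-n) ∧ ∀ᶠ s in 𝓝[≠] (-n : ℂ),
      gammaQuotient K c e s = B s + e (n + 1) * D s / (s - -n) := by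
  obtain ⟨A, hA, hAe⟩ := h.exists_fullContinuation_eq (n + 1)
  have hn : (1 - (n + 1 : ℕ) : ℂ) = -n := by push_cast; ring
  rw [hn] at hA hAe
  set D := dslope (fun z => (Gamma z)⁻¹) (-n : ℂ) with hD
  have hDa : AnalyticAt ℂ D (-n) := (analyticAt_Gamma_inv _).dslope_self
  -- With 1/Γ(s) = (s + n) D(s), the analytic part and the simple pole become analytic, and the
  -- double pole becomes e_(n+1) D(s)/(s + n).
  refine ⟨fun s => (s - -n) * D s * A s + c (n + 1) * D s, D, by fun_prop, hDa, ?_⟩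
  filter_upwards [nhdsWithin_le_nhds hAe, self_mem_nhdsWithin] with s hs hne
  have hne' : s - -n ≠ 0 := sub_ne_zero.2 hne
  have h1 : (Gamma s)⁻¹ = (s - -n) * D s := by
    have h2 := sub_smul_dslope (fun z => (Gamma z)⁻¹) (-n : ℂ) s
    rw [smul_eq_mul, Gamma_neg_nat_eq_zero, inv_zero, sub_zero] at h2
    exact h2.symm
  rw [gammaQuotient, hs, h1, polarTerm, hn]
  field_simp
  ring

/-- 1/Γ(s) = 1 + γ(s - 1) + O((s - 1)²) multiplies 1/(s - 1)² + c_0/(s - 1), so the double pole adds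
γ to the residue c_0. -/
theorem exists_gammaQuotient_eq_one (h : HasLogExpansion K c e) (he : e 0 = 1) :
    ∃ g : ℂ → ℂ, AnalyticAt ℂ g 1 ∧ ∀ᶠ s in 𝓝[≠] (1 : ℂ), gammaQuotient K c e s =
      1 / (s - 1) ^ 2 + (Real.eulerMascheroniConstant + c 0) / (s - 1) + g s := by
  obtain ⟨A, hA, hAe⟩ := h.exists_fullContinuation_eq 0
  have hn : (1 - (0 : ℕ) : ℂ) = 1 := by simp
  rw [hn] at hA hAe
  set γ : ℂ := (Real.eulerMascheroniConstant : ℂ) with hγ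
  set D := dslope (fun z => (Gamma z)⁻¹) (1 : ℂ) with hD
  have hDa : AnalyticAt ℂ D 1 := (analyticAt_Gamma_inv _).dslope_self
  have hQa : AnalyticAt ℂ (dslope D 1) 1 := hDa.dslope_self
  have hD1 : D 1 = γ := by
    rw [hD, dslope_same]
    exact hasDerivAt_Gamma_inv_one.deriv
  have hΓa := analyticAt_Gamma_inv 1
  refine ⟨fun s => (Gamma s)⁻¹ * A s + c 0 * D s + dslope D 1 s, by fun_prop, ?_⟩
  filter_upwards [nhdsWithin_le_nhds hAe, self_mem_nhdsWithin] with s hs hne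
  have hne' : s - 1 ≠ 0 := sub_ne_zero.2 hne
  have h1 : (Gamma s)⁻¹ = 1 + (s - 1) * D s := by
    have h2 := sub_smul_dslope (fun z => (Gamma z)⁻¹) (1 : ℂ) s
    rw [smul_eq_mul, Gamma_one, inv_one] at h2
    linear_combination -h2
  have h3 : D s = γ + (s - 1) * dslope D 1 s := by
    have h2 := sub_smul_dslope D (1 : ℂ) s
    rw [smul_eq_mul, hD1] at h2
    linear_combination -h2
  have h4 : gammaQuotient K c e s = (Gamma s)⁻¹ * A s +
      (1 + (s - 1) * D s) * c 0 / (s - 1) + (1 + (s - 1) * D s) / (s - 1) ^ 2 := by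
    rw [gammaQuotient, hs, mul_add, add_assoc]
    congr 1
    rw [h1, polarTerm, hn, he]
    ring
  rw [h4]
  have h5 : (1 + (s - 1) * D s) / (s - 1) ^ 2 =
      1 / (s - 1) ^ 2 + γ / (s - 1) + dslope D 1 s := by
    rw [h3]
    field_simp
    ring
  rw [h5]
  field_simp
  ring

theorem meromorphicAt_gammaQuotient (h : HasLogExpansion K c e) (s : ℂ) :
    MeromorphicAt (gammaQuotient K c e) s := by
  by_cases hs : ∀ k : ℕ, s ≠ 1 - k
  · exact (h.analyticAt_gammaQuotient hs).meromorphicAt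
  · push Not at hs
    obtain ⟨k, rfl⟩ := hs
    obtain ⟨A, hA, hAe⟩ := h.exists_fullContinuation_eq k
    have h1 : MeromorphicAt (fun s => (Gamma s)⁻¹ * (A s + polarTerm c e k s)) (1 - k) := by
      have h2 := (analyticAt_Gamma_inv (1 - k)).meromorphicAt
      have h3 := hA.meromorphicAt
      unfold polarTerm
      fun_prop
    refine h1.congr (nhdsWithin_le_nhds ?_)
    filter_upwards [hAe] with s hs
    rw [gammaQuotient, hs]

theorem meromorphicOrderAt_gammaQuotient_neg (h : HasLogExpansion K c e) (n : ℕ) :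
    ((-1 : ℤ) : WithTop ℤ) ≤ meromorphicOrderAt (gammaQuotient K c e) (-n) := by
  obtain ⟨B, D, hB, hD, hBD⟩ := h.exists_gammaQuotient_eq n
  have h1 : gammaQuotient K c e =ᶠ[𝓝[≠] (-n : ℂ)]
      ((fun s : ℂ => s - -n) ^ (-1 : ℤ)) * fun s : ℂ => (s - -n) * B s + e (n + 1) * D s := by
    filter_upwards [hBD, self_mem_nhdsWithin] with s hs hne
    have hne' : s - -n ≠ 0 := sub_ne_zero.2 hne
    rw [hs, Pi.mul_apply, Pi.pow_apply, zpow_neg_one]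
    field_simp
  have h2 : AnalyticAt ℂ (fun s => (s - -n) * B s + e (n + 1) * D s) (-n) := by fun_prop
  rw [meromorphicOrderAt_congr h1, meromorphicOrderAt_mul (by fun_prop) h2.meromorphicAt,
    meromorphicOrderAt_zpow_id_sub_const]
  exact le_add_of_nonneg_right h2.meromorphicOrderAt_nonneg

theorem meromorphicOrderAt_gammaQuotient_neg_nonneg (h : HasLogExpansion K c e) {n : ℕ}
    (hn : e (n + 1) = 0) : 0 ≤ meromorphicOrderAt (gammaQuotient K c e) (-n) := by
  obtain ⟨B, D, hB, hD, hBD⟩ := h.exists_gammaQuotient_eq n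
  have h1 : gammaQuotient K c e =ᶠ[𝓝[≠] (-n : ℂ)] B := by
    filter_upwards [hBD] with s hs
    rw [hs, hn]
    simp
  rw [meromorphicOrderAt_congr h1]
  exact hB.meromorphicOrderAt_nonneg

theorem meromorphicOrderAt_gammaQuotient_one (h : HasLogExpansion K c e) (he : e 0 = 1) :
    meromorphicOrderAt (gammaQuotient K c e) 1 = (-2 : ℤ) := by
  obtain ⟨g, hg, hge⟩ := h.exists_gammaQuotient_eq_one he
  rw [meromorphicOrderAt_eq_int_iff (h.meromorphicAt_gammaQuotient 1)]
  refine ⟨fun s => 1 + (Real.eulerMascheroniConstant + c 0) * (s - 1) + (s - 1) ^ 2 * g s,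
    by fun_prop, by simp, ?_⟩
  filter_upwards [hge, self_mem_nhdsWithin] with s hs hne
  have hne' : s - 1 ≠ 0 := sub_ne_zero.2 hne
  rw [hs, smul_eq_mul, zpow_neg]
  norm_cast
  field_simp

/-- The continuation divided by `Γ`, with removable singularities removed. -/
noncomputable def quotientNF (K : ℝ → ℂ) (c e : ℕ → ℂ) : ℂ → ℂ :=
  toMeromorphicNFOn (gammaQuotient K c e) Set.univ

theorem meromorphicOn_gammaQuotient (h : HasLogExpansion K c e) :
    MeromorphicOn (gammaQuotient K c e) Set.univ := fun s _ => h.meromorphicAt_gammaQuotient s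

theorem meromorphicOrderAt_quotientNF (h : HasLogExpansion K c e) (s : ℂ) :
    meromorphicOrderAt (quotientNF K c e) s = meromorphicOrderAt (gammaQuotient K c e) s :=
  meromorphicOrderAt_toMeromorphicNFOn h.meromorphicOn_gammaQuotient (Set.mem_univ s)

/-- At the points 1 - k the explicit quotient takes values dictated by division by zero. The normal
form repairs them, so that analyticity depends on the order alone. -/
theorem analyticAt_quotientNF_iff (h : HasLogExpansion K c e) (s : ℂ) :
    AnalyticAt ℂ (quotientNF K c e) s ↔ 0 ≤ meromorphicOrderAt (gammaQuotient K c e) s := by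
  rw [← h.meromorphicOrderAt_quotientNF]
  exact ((meromorphicNFOn_toMeromorphicNFOn (gammaQuotient K c e) Set.univ
    (Set.mem_univ s)).meromorphicOrderAt_nonneg_iff_analyticAt).symm

theorem quotientNF_eq (h : HasLogExpansion K c e) {s : ℂ}
    (hs : AnalyticAt ℂ (gammaQuotient K c e) s) :
    quotientNF K c e s = gammaQuotient K c e s := by
  rw [quotientNF, toMeromorphicNFOn_eq_toMeromorphicNFAt h.meromorphicOn_gammaQuotient
    (Set.mem_univ s), toMeromorphicNFAt_eq_self.2 hs.meromorphicNFAt]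

end HasLogExpansion

/-! ### The continuation of 𝒵₁ -/

theorem theorem4 :
    -- the integral defining `𝒵_1(s)` converges absolutely for `Re s > 1`
    (∀ s : ℂ, 1 < s.re →
      MeasureTheory.IntegrableOn (zetaMellinIntegrand 1 s) (Set.Ioi (1 : ℝ))) ∧
    ∃ F : ℂ → ℂ,
      -- `F` is a meromorphic continuation of `𝒵_1` to all of `ℂ`
      MeromorphicOn F Set.univ ∧
      (∀ s : ℂ, 1 < s.re → F s = modifiedMellinZeta 1 s) ∧
      -- no poles besides `1` and `-1, -3, -5, …`
      (∀ s : ℂ, s ≠ 1 → (∀ n : ℕ, s ≠ -(2 * (n : ℂ) + 1)) → AnalyticAt ℂ F s) ∧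
      -- a double pole at `1`, and at most simple poles at `-1, -3, -5, …`
      meromorphicOrderAt F 1 = (-2 : ℤ) ∧
      (∀ n : ℕ, ((-1 : ℤ) : WithTop ℤ) ≤ meromorphicOrderAt F (-(2 * (n : ℂ) + 1))) ∧
      -- the principal part at `1`
      (∃ g : ℂ → ℂ, AnalyticAt ℂ g 1 ∧
        ∀ᶠ s in nhdsWithin (1 : ℂ) {1}ᶜ,
          F s = 1 / (s - 1) ^ 2 +
            ((2 * Real.eulerMascheroniConstant - Real.log (2 * Real.pi) : ℝ) : ℂ) / (s - 1)
            + g s) := by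
  obtain ⟨c, e, hc0, he0, heo, h⟩ := exists_hasLogExpansion_truncatedLaplace
  have hmellin : ∀ s : ℂ, 1 < s.re → IntegrableOn (zetaMellinIntegrand 1 s) (Set.Ioi (1 : ℝ)) ∧
      -- For N = 0 nothing is subtracted: L(p) = O(p^(-1-ε)) at 0 already gives convergence for Re s
      -- > 1.
      mellin truncatedLaplace s = Gamma s * modifiedMellinZeta 1 s := fun s hs =>
    mellin_truncatedLaplace (one_pos.trans hs) (h.mellin_tail (N := 0) (by simpa using hs)).1
  have hne : ∀ s : ℂ, 1 < s.re → ∀ k : ℕ, s ≠ 1 - k := by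
    rintro s hs k rfl
    have : (0 : ℝ) ≤ k := k.cast_nonneg
    simp at hs
    linarith
  refine ⟨fun s hs => (hmellin s hs).1, HasLogExpansion.quotientNF truncatedLaplace c e,
    (meromorphicNFOn_toMeromorphicNFOn _ _).meromorphicOn, fun s hs => ?_, fun s hs1 hs => ?_,
    ?_, fun n => ?_, ?_⟩
  · rw [h.quotientNF_eq (h.analyticAt_gammaQuotient (hne s hs)), HasLogExpansion.gammaQuotient,
      h.fullContinuation_eq_mellin hs, (hmellin s hs).2,
      inv_mul_cancel_left₀ (Gamma_ne_zero_of_re_pos (one_pos.trans hs))]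
  · rw [h.analyticAt_quotientNF_iff]
    by_cases hk : ∀ k : ℕ, s ≠ 1 - k
    · exact (h.analyticAt_gammaQuotient hk).meromorphicOrderAt_nonneg
    · push Not at hk
      obtain ⟨k, rfl⟩ := hk
      rcases k with _ | n
      · simp at hs1
      · have hn : (1 - (n + 1 : ℕ) : ℂ) = -n := by push_cast; ring
        rw [hn] at hs ⊢
        -- The pole at -n is governed by e_(n+1), which vanishes for even n; odd n = 2m + 1 is
        -- excluded by the hypothesis on `s`.
        refine h.meromorphicOrderAt_gammaQuotient_neg_nonneg (heo _ ?_)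
        rcases Nat.even_or_odd' n with ⟨m, rfl | rfl⟩
        · exact ⟨m, rfl⟩
        · exact absurd (by push_cast; ring) (hs m)
  · rw [h.meromorphicOrderAt_quotientNF, h.meromorphicOrderAt_gammaQuotient_one he0]
  · have hn : -(2 * (n : ℂ) + 1) = -((2 * n + 1 : ℕ) : ℂ) := by push_cast; ring
    rw [h.meromorphicOrderAt_quotientNF, hn]
    exact h.meromorphicOrderAt_gammaQuotient_neg _
  · obtain ⟨g, hg, hge⟩ := h.exists_gammaQuotient_eq_one he0
    refine ⟨g, hg, ?_⟩
    filter_upwards [hge, MeromorphicOn.toMeromorphicNFOn_eq_self_on_nhdsNE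
      h.meromorphicOn_gammaQuotient (Set.mem_univ 1)] with s hs hs'
    -- The residue is γ + c_0 = γ + (γ - log 2π).
    rw [HasLogExpansion.quotientNF, hs', hs, hc0]
    push_cast
    ring
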